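/- Let $\mathbb T^2=\mathbb R^2/\mathbb Z^2$ and let $P\subset\mathbb T^2$ be a (filled, nondegenerate) polygon, that is, a closed set with nonempty interior, $P\neq\mathbb T^2$, whose topological boundary is contained in the image in $\mathbb T^2$ of a finite union of straight line segments of $\mathbb R^2$. (This covers the image in $\mathbb T^2$ of every filled planar polygon, convex or not, as long as that image is not all of $\mathbb T^2$.) Let $\chi_P\in L^2(\mathbb T^2)$ be its characteristic function and let $$u(x,t)=e^{it\Delta}\chi_P(x)=\sum_{m\in\mathbb Z^2}e^{-4\pi^2 i|m|^2t}\,\widehat{\chi_P}(m)\,e^{2\pi i m\cdot x}$$ (convergence in $L^2(\mathbb T^2)$) be the solution of the linear Schrödinger equation $iu_t+\Delta u=0$, $u(\cdot,0)=\chi_P$. For a set $E$ in $\mathbb T^2\times\mathbb R$ let $\overline{\dim}\,E=\limsup_{\varepsilon\to0+}\frac{\log\mathcal N(E,\varepsilon)}{\log(1/\varepsilon)}$ be its upper Minkowski (box) dimension, where $\mathcal N(E,\varepsilon)$ is the minimum number of boxes of side length $\varepsilon$ needed to cover $E$. Then for almost every $t\in\mathbb R$ the function $u(\cdot,t)$ has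 a (unique) continuous representative, and, for this representative, the maximum of the upper box dimensions of the graphs of $\operatorname{Re}u(\cdot,t)$ and $\operatorname{Im}u(\cdot,t)$, as subsets of $\mathbb T^2\times\mathbb R$, equals exactly $\tfrac52$. -/

import Mathlib

open MeasureTheory Filter Topology
open scoped NNReal ENNReal

/-! ### Upper box dimension and graphs -/

/-- The upper Minkowski (box) dimension
`limsup_{ε → 0+} log N(E, ε) / log (1 / ε)`, where `N(E, ε)` is the least number of closed balls of
radius `ε / 2` that cover `E`. In a product of circles and lines with the sup metric, these balls
are exactly the boxes of side length `ε`. It takes values in the extended reals. -/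
noncomputable def upperBoxDim {X : Type*} [PseudoEMetricSpace X] (E : Set X) : EReal :=
  limsup (fun ε : ℝ≥0 =>
      ENNReal.log ((Metric.externalCoveringNumber (ε / 2) E : ℕ∞) : ℝ≥0∞) /
        ((Real.log (1 / (ε : ℝ)) : ℝ) : EReal))
    (𝓝[>] (0 : ℝ≥0))

/-- The two-dimensional torus `ℝ² / ℤ²`. -/
abbrev Torus2 : Type := UnitAddTorus (Fin 2)

/-- The graph of a real function on the torus, as a subset of `𝕋² × ℝ`. -/
def torusGraph (g : Torus2 → ℝ) : Set (Torus2 × ℝ) :=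
  Set.range fun x => (x, g x)

/-! ### Polygons in the torus -/

/-- The projection `ℝ² → ℝ² / ℤ²`. -/
def torusProj (x : Fin 2 → ℝ) : Torus2 :=
  fun i => (x i : UnitAddCircle)

/-- `P` is a (filled, nondegenerate) polygon in the torus: a closed set with nonempty interior, not
the whole torus, whose topological boundary lies in a finite union of straight line segments.
Convex or not, simply connected or not, this covers the image in the torus of every filled planar
polygon, unless that image is the whole torus. -/
structure IsTorusPolygon (P : Set Torus2) : Prop where
  isClosed : IsClosed P
  nonempty_interior : (interior P).Nonempty
  ne_univ : P ≠ Set.univ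
  frontier_subset : ∃ E : Set ((Fin 2 → ℝ) × (Fin 2 → ℝ)), E.Finite ∧
    frontier P ⊆ ⋃ e ∈ E, torusProj '' segment ℝ e.1 e.2

/-- The Haar probability measure on the torus, that is, Lebesgue measure on `ℝ² / ℤ²`. -/
noncomputable abbrev torusMeasure : Measure Torus2 :=
  Measure.pi fun _ => (AddCircle.haarAddCircle : Measure UnitAddCircle)

/-- The characteristic function of a closed subset of the torus, as an element of `L²(𝕋²)`. -/
noncomputable def torusCharFun (P : Set Torus2) (hP : IsClosed P) : Lp ℂ 2 torusMeasure :=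
  indicatorConstLp 2 hP.measurableSet (measure_ne_top torusMeasure P) (1 : ℂ)

/-! ### The linear Schrödinger evolution on the torus -/

/-- The Fourier multiplier `exp (-4 π² i t |m|²)` of `exp (i t Δ)` on `ℝ² / ℤ²`: the character
`exp (2 π i m · x)` is an eigenfunction of `Δ` with eigenvalue `-4 π² |m|²`. -/
noncomputable def schrodingerMultiplier (t : ℝ) (m : Fin 2 → ℤ) : ℂ :=
  Complex.exp (((-(4 * Real.pi ^ 2 * t * ∑ i, (m i : ℝ) ^ 2) : ℝ) : ℂ) * Complex.I)

theorem norm_schrodingerMultiplier (t : ℝ) (m : Fin 2 → ℤ) :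
    ‖schrodingerMultiplier t m‖ = 1 :=
  Complex.norm_exp_ofReal_mul_I _

/-- The Hilbert basis of `L²(𝕋²)` that consists of the characters `exp (2 π i m · x)`. -/
noncomputable def torusFourierBasis : HilbertBasis (Fin 2 → ℤ) ℂ (Lp ℂ 2 torusMeasure) :=
  UnitAddTorus.mFourierBasis

/-- The solution at time `t` of `i u_t + Δ u = 0`, `u(0) = f`, on `ℝ² / ℤ²`: the element of `L²`
whose Fourier coefficients are `exp (-4 π² i t |m|²)` times those of `f`. -/
noncomputable def schrodingerEvolution (t : ℝ) (f : Lp ℂ 2 torusMeasure) : Lp ℂ 2 torusMeasure :=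
  torusFourierBasis.repr.symm
    ⟨fun m => schrodingerMultiplier t m * torusFourierBasis.repr f m,
      (memℓp_gen_iff (by norm_num)).2 (by
        simpa only [norm_mul, norm_schrodingerMultiplier, one_mul] using
          (memℓp_gen_iff (by norm_num)).1 (lp.memℓp (torusFourierBasis.repr f)))⟩

/-! ### Lattice points on circles -/

theorem exists_add_one_le_mul_rpow {ε : ℝ} (hε : 0 < ε) :
    ∃ C : ℝ, 1 ≤ C ∧ ∀ x : ℝ, 2 ≤ x → ∀ k : ℕ, (k : ℝ) + 1 ≤ C * (x ^ ε) ^ k := by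
  have hl : 0 < ε * Real.log 2 := mul_pos hε (Real.log_pos one_lt_two)
  refine ⟨max 1 (1 / (ε * Real.log 2)), le_max_left _ _, fun x hx k => ?_⟩
  have h1 : 1 + (k : ℝ) * (ε * Real.log 2) ≤ (x ^ ε) ^ k := by
    have h2 : 1 + ε * Real.log 2 ≤ x ^ ε := by
      calc 1 + ε * Real.log 2 ≤ Real.exp (ε * Real.log 2) := by
            linarith [Real.add_one_le_exp (ε * Real.log 2)]
        _ = 2 ^ ε := by rw [Real.rpow_def_of_pos two_pos, mul_comm]
        _ ≤ x ^ ε := Real.rpow_le_rpow two_pos.le hx hε.le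
    exact (one_add_mul_le_pow (by linarith) k).trans (pow_le_pow_left₀ (by linarith) h2 k)
  calc (k : ℝ) + 1 ≤ max 1 (1 / (ε * Real.log 2)) * (1 + (k : ℝ) * (ε * Real.log 2)) := by
        have a1 := le_max_left 1 (1 / (ε * Real.log 2))
        have a2 : (k : ℝ) = 1 / (ε * Real.log 2) * (k * (ε * Real.log 2)) := by field_simp
        have a3 : 1 / (ε * Real.log 2) * (k * (ε * Real.log 2)) ≤
            max 1 (1 / (ε * Real.log 2)) * (k * (ε * Real.log 2)) :=
          mul_le_mul_of_nonneg_right (le_max_right _ _) (by positivity)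
        nlinarith
    _ ≤ _ := by gcongr

theorem finite_gaussianInt_norm_lt (X : ℝ) :
    {z : GaussianInt | ((Zsqrtd.norm z : ℤ) : ℝ) < X}.Finite := by
  have : {z : GaussianInt | ((Zsqrtd.norm z : ℤ) : ℝ) < X} ⊆
      (fun p : ℤ × ℤ => (⟨p.1, p.2⟩ : GaussianInt)) ''
        (Set.Icc (-⌈X⌉) ⌈X⌉ ×ˢ Set.Icc (-⌈X⌉) ⌈X⌉) := by
    intro z hz
    refine ⟨(z.re, z.im), ?_, rfl⟩
    have h1 : Zsqrtd.norm z ≤ ⌈X⌉ := by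
      have := (show ((Zsqrtd.norm z : ℤ) : ℝ) < X from hz).le.trans (Int.le_ceil X)
      exact_mod_cast this
    have h2 : Zsqrtd.norm z = z.re * z.re + z.im * z.im := by
      rw [Zsqrtd.norm_def]; ring
    simp only [Set.mem_prod, Set.mem_Icc]
    refine ⟨⟨?_, ?_⟩, ?_, ?_⟩ <;> nlinarith [mul_self_nonneg (z.re - 1), mul_self_nonneg (z.re + 1),
      mul_self_nonneg (z.im - 1), mul_self_nonneg (z.im + 1), mul_self_nonneg z.re,
      mul_self_nonneg z.im]
  exact ((Set.finite_Icc _ _).prod (Set.finite_Icc _ _)).image _ |>.subset this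

theorem card_Iic_multiset_le {α : Type*} [DecidableEq α] (N : α → ℝ) {ε : ℝ} (hε : 0 < ε)
    (hfin : ∀ X : ℝ, {a | N a < X}.Finite) :
    ∃ C : ℝ, 1 ≤ C ∧ ∀ s : Multiset α, (∀ a ∈ s, 2 ≤ N a) →
      ((Finset.Iic s).card : ℝ) ≤ C * (s.map fun a => N a ^ ε).prod := by
  obtain ⟨C₀, hC₀, h₀⟩ := exists_add_one_le_mul_rpow hε
  set S := (hfin (2 ^ (1 / ε))).toFinset with hS
  refine ⟨C₀ ^ S.card, one_le_pow₀ hC₀, fun s hs => ?_⟩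
  rw [Multiset.card_Iic, Finset.prod_multiset_map_count]
  push_cast
  have key : ∀ a ∈ s.toFinset, ((s.count a : ℝ) + 1) ≤
      (if a ∈ S then C₀ else 1) * (N a ^ ε) ^ s.count a := by
    intro a ha
    have h2 := hs a (Multiset.mem_toFinset.1 ha)
    split_ifs with h
    · exact h₀ _ h2 _
    · have h3 : (2 : ℝ) ^ (1 / ε) ≤ N a := by simpa [hS] using h
      have h4 : (2 : ℝ) ≤ N a ^ ε := by
        calc (2 : ℝ) = (2 ^ (1 / ε)) ^ ε := by
              rw [← Real.rpow_mul two_pos.le, one_div_mul_cancel hε.ne', Real.rpow_one]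
          _ ≤ _ := by gcongr
      rw [one_mul]
      calc (s.count a : ℝ) + 1 ≤ 2 ^ s.count a := by
            exact_mod_cast Nat.lt_two_pow_self
        _ ≤ _ := by gcongr
  refine (Finset.prod_le_prod (fun a _ => by positivity) key).trans ?_
  rw [Finset.prod_mul_distrib]
  refine mul_le_mul_of_nonneg_right ?_ (Finset.prod_nonneg fun a ha => ?_)
  · rw [Finset.prod_ite]
    simp only [Finset.prod_const, one_pow, mul_one]
    exact pow_le_pow_right₀ hC₀ (Finset.card_le_card fun a ha => (Finset.mem_filter.1 ha).2)
  · have h2 := hs a (Multiset.mem_toFinset.1 ha)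
    positivity

theorem gaussianInt_abs_le_one {u : GaussianInt} (hu : Zsqrtd.norm u = 1) :
    |u.re| ≤ 1 ∧ |u.im| ≤ 1 := by
  rw [Zsqrtd.norm_def] at hu
  constructor <;> rw [← sq_le_one_iff_abs_le_one] <;>
    nlinarith [mul_self_nonneg u.re, mul_self_nonneg u.im]

open UniqueFactorizationMonoid in
theorem card_gaussianInt_norm_eq_le {ε : ℝ} (hε : 0 < ε) :
    ∃ C : ℝ, 1 ≤ C ∧ ∀ N : ℤ, 1 ≤ N → ∀ F : Finset GaussianInt, (∀ z ∈ F, Zsqrtd.norm z = N) →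
      (F.card : ℝ) ≤ C * (N : ℝ) ^ ε := by
  classical
  let _ : StrongNormalizationMonoid GaussianInt :=
    UniqueFactorizationMonoid.strongNormalizationMonoid
  obtain ⟨C, hC, h⟩ := card_Iic_multiset_le (fun z : GaussianInt => ((Zsqrtd.norm z : ℤ) : ℝ))
    (half_pos hε) finite_gaussianInt_norm_lt
  refine ⟨9 * C, by linarith, fun N hN F hF => ?_⟩
  have hN0 : (N : GaussianInt) ≠ 0 := by
    intro h0
    have := congrArg Zsqrtd.re h0
    simp at this
    omega
  have hz0 : ∀ z ∈ F, z ≠ 0 := by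
    rintro z hz rfl
    have := hF _ hz
    simp at this
    omega
  set s := normalizedFactors (N : GaussianInt) with hs
  have hle : ∀ z ∈ F, normalizedFactors z ≤ s := by
    intro z hz
    rw [hs, ← dvd_iff_normalizedFactors_le_normalizedFactors (hz0 z hz) hN0, ← hF z hz,
      Zsqrtd.norm_eq_mul_conj]
    exact dvd_mul_right _ _
  have hcard : F.card ≤ 9 * (F.image normalizedFactors).card := by
    refine Finset.card_le_mul_card_image _ _ fun b hb => ?_
    obtain ⟨z, hz, rfl⟩ := Finset.mem_image.1 hb
    let U : Finset GaussianInt := (Finset.Icc (-1 : ℤ) 1 ×ˢ Finset.Icc (-1 : ℤ) 1).image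
      fun p => (⟨p.1, p.2⟩ : GaussianInt)
    have hU : U.card ≤ 9 := Finset.card_image_le.trans (by decide)
    refine le_trans (Finset.card_le_card (t := U.image fun u => z * u) ?_)
      (Finset.card_image_le.trans hU)
    intro w hw
    obtain ⟨hw, hwz⟩ := Finset.mem_filter.1 hw
    have hass : Associated z w := by
      rw [associated_iff_normalizedFactors_eq_normalizedFactors (hz0 z hz) (hz0 w hw)]
      exact hwz.symm
    obtain ⟨u, hu⟩ := hass
    refine Finset.mem_image.2 ⟨u, ?_, hu⟩
    have hn : Zsqrtd.norm (u : GaussianInt) = 1 := by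
      have := congrArg Zsqrtd.norm hu
      rw [Zsqrtd.norm_mul, hF z hz, hF w hw] at this
      exact mul_left_cancel₀ (by omega : N ≠ 0) (by rw [this, mul_one])
    obtain ⟨h1, h2⟩ := gaussianInt_abs_le_one hn
    exact Finset.mem_image.2 ⟨((u : GaussianInt).re, (u : GaussianInt).im),
      Finset.mem_product.2 ⟨Finset.mem_Icc.2 (abs_le.1 h1), Finset.mem_Icc.2 (abs_le.1 h2)⟩, rfl⟩
  have himg : F.image normalizedFactors ⊆ Finset.Iic s := by
    intro b hb
    obtain ⟨z, hz, rfl⟩ := Finset.mem_image.1 hb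
    exact Finset.mem_Iic.2 (hle z hz)
  have hprime : ∀ p ∈ s, (2 : ℝ) ≤ ((Zsqrtd.norm p : ℤ) : ℝ) := by
    intro p hp
    have hp' := prime_of_normalized_factor p hp
    have h1 : Zsqrtd.norm p ≠ 0 := fun h0 => hp'.ne_zero (GaussianInt.norm_eq_zero.1 h0)
    have h2 : Zsqrtd.norm p ≠ 1 := fun h0 => hp'.not_isUnit
      ((Zsqrtd.norm_eq_one_iff' (by norm_num) p).1 h0)
    have h3 := GaussianInt.norm_nonneg p
    have : (2 : ℤ) ≤ Zsqrtd.norm p := by omega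
    exact_mod_cast this
  have hprod : (s.map fun p => ((Zsqrtd.norm p : ℤ) : ℝ)).prod = (N : ℝ) ^ 2 := by
    have h1 : Zsqrtd.norm s.prod = N * N := by
      obtain ⟨u, hu⟩ := prod_normalizedFactors hN0
      have h2 := congrArg Zsqrtd.norm hu
      have hun : Zsqrtd.norm (u : GaussianInt) = 1 :=
        (Zsqrtd.norm_eq_one_iff' (by norm_num) _).2 u.isUnit
      rw [Zsqrtd.norm_mul, hun, mul_one] at h2
      rw [hs, h2, Zsqrtd.norm_intCast]
    have h3 : Zsqrtd.norm s.prod = (s.map Zsqrtd.norm).prod := by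
      have := map_multiset_prod (Zsqrtd.normMonoidHom (d := -1)) s
      exact this
    have h4 : (s.map fun p => ((Zsqrtd.norm p : ℤ) : ℝ)).prod =
        (((s.map Zsqrtd.norm).prod : ℤ) : ℝ) := by
      rw [Int.cast_multiset_prod, Multiset.map_map]; rfl
    rw [h4, ← h3, h1]; push_cast; ring
  have hfin : (s.map fun p => ((Zsqrtd.norm p : ℤ) : ℝ) ^ (ε / 2)).prod = (N : ℝ) ^ ε := by
    rw [Real.multiset_prod_map_rpow s _ (fun p hp => by linarith [hprime p hp]), hprod,
      ← Real.rpow_natCast, ← Real.rpow_mul (by positivity)]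
    congr 1; push_cast; ring
  calc (F.card : ℝ) ≤ 9 * ((F.image normalizedFactors).card : ℝ) := by exact_mod_cast hcard
    _ ≤ 9 * ((Finset.Iic s).card : ℝ) := by gcongr
    _ ≤ 9 * (C * (N : ℝ) ^ ε) := by rw [← hfin]; gcongr; exact h s hprime
    _ = _ := by ring

/-- The number of lattice points on a circle is smaller than any power of the radius. -/
theorem card_sq_add_sq_eq_le {ε : ℝ} (hε : 0 < ε) :
    ∃ C : ℝ, 1 ≤ C ∧ ∀ N : ℤ, 1 ≤ N → ∀ F : Finset (ℤ × ℤ), (∀ p ∈ F, p.1 ^ 2 + p.2 ^ 2 = N) →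
      (F.card : ℝ) ≤ C * (N : ℝ) ^ ε := by
  classical
  obtain ⟨C, hC, h⟩ := card_gaussianInt_norm_eq_le hε
  refine ⟨C, hC, fun N hN F hF => ?_⟩
  have hinj : Function.Injective fun p : ℤ × ℤ => (⟨p.1, p.2⟩ : GaussianInt) := by
    rintro ⟨a, b⟩ ⟨c, d⟩ hab
    simpa [Zsqrtd.ext_iff] using hab
  rw [← Finset.card_image_of_injective F hinj]
  refine h N hN _ fun z hz => ?_
  obtain ⟨p, hp, rfl⟩ := Finset.mem_image.1 hz
  rw [Zsqrtd.norm_def, ← hF p hp]; ring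

/-! ### Weights on the lattice of frequencies -/

/-- The size `1 + |m|₁` of a frequency. -/
noncomputable def freqSize (m : Fin 2 → ℤ) : ℝ := 1 + |(m 0 : ℝ)| + |(m 1 : ℝ)|

/-- The size `1 + |m · τ|` of a frequency in the direction `τ`. -/
noncomputable def dirSize (τ : Fin 2 → ℝ) (m : Fin 2 → ℤ) : ℝ :=
  1 + |τ 0 * (m 0 : ℝ) + τ 1 * (m 1 : ℝ)|

/-- The square `|m|²` of the Euclidean length of a frequency. -/
def freqSq (m : Fin 2 → ℤ) : ℤ := m 0 ^ 2 + m 1 ^ 2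

theorem one_le_freqSize (m : Fin 2 → ℤ) : 1 ≤ freqSize m := by
  unfold freqSize; linarith [abs_nonneg (m 0 : ℝ), abs_nonneg (m 1 : ℝ)]

theorem one_le_dirSize (τ : Fin 2 → ℝ) (m : Fin 2 → ℤ) : 1 ≤ dirSize τ m := by
  unfold dirSize; linarith [abs_nonneg (τ 0 * (m 0 : ℝ) + τ 1 * (m 1 : ℝ))]

theorem freqSize_pos (m : Fin 2 → ℤ) : 0 < freqSize m := one_pos.trans_le (one_le_freqSize m)

theorem dirSize_pos (τ : Fin 2 → ℝ) (m : Fin 2 → ℤ) : 0 < dirSize τ m :=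
  one_pos.trans_le (one_le_dirSize τ m)

theorem freqSize_add_le (m n : Fin 2 → ℤ) : freqSize (m + n) ≤ freqSize m + freqSize n := by
  simp only [freqSize, Pi.add_apply, Int.cast_add]
  linarith [abs_add_le (m 0 : ℝ) (n 0), abs_add_le (m 1 : ℝ) (n 1)]

theorem dirSize_add_le (τ : Fin 2 → ℝ) (m n : Fin 2 → ℤ) :
    dirSize τ (m + n) ≤ dirSize τ m * dirSize τ n := by
  simp only [dirSize, Pi.add_apply, Int.cast_add]
  have h := abs_add_le (τ 0 * (m 0 : ℝ) + τ 1 * (m 1 : ℝ)) (τ 0 * (n 0 : ℝ) + τ 1 * (n 1 : ℝ))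
  have e : τ 0 * ((m 0 : ℝ) + n 0) + τ 1 * ((m 1 : ℝ) + n 1) =
    (τ 0 * (m 0 : ℝ) + τ 1 * (m 1 : ℝ)) + (τ 0 * (n 0 : ℝ) + τ 1 * (n 1 : ℝ)) := by ring
  rw [e]
  nlinarith [abs_nonneg (τ 0 * (m 0 : ℝ) + τ 1 * (m 1 : ℝ)),
    abs_nonneg (τ 0 * (n 0 : ℝ) + τ 1 * (n 1 : ℝ))]

theorem dirSize_le (τ : Fin 2 → ℝ) (m : Fin 2 → ℤ) :
    dirSize τ m ≤ (1 + |τ 0| + |τ 1|) * freqSize m := by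
  simp only [dirSize, freqSize]
  have h := abs_add_le (τ 0 * (m 0 : ℝ)) (τ 1 * (m 1 : ℝ))
  rw [abs_mul, abs_mul] at h
  nlinarith [abs_nonneg (m 0 : ℝ), abs_nonneg (m 1 : ℝ), abs_nonneg (τ 0), abs_nonneg (τ 1),
    mul_nonneg (abs_nonneg (τ 0)) (abs_nonneg (m 1 : ℝ)),
    mul_nonneg (abs_nonneg (τ 1)) (abs_nonneg (m 0 : ℝ))]

theorem summable_one_add_abs_int_rpow {s : ℝ} (hs : 1 < s) :
    Summable fun n : ℤ => (1 + |(n : ℝ)|) ^ (-s) := by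
  have h := Real.summable_abs_int_rpow hs
  refine Summable.of_norm_bounded_eventually h ?_
  filter_upwards [(Set.finite_singleton (0 : ℤ)).compl_mem_cofinite] with n hn
  have hn0 : 0 < |(n : ℝ)| := abs_pos.2 (by exact_mod_cast hn)
  rw [Real.norm_of_nonneg (by positivity)]
  exact Real.rpow_le_rpow_of_nonpos hn0 (by linarith) (by linarith)

theorem exists_summable_affine_rpow {b s : ℝ} (hb : b ≠ 0) (hs : 1 < s) :
    ∃ C : ℝ, ∀ a : ℝ, Summable (fun n : ℤ => (1 + |a + b * (n : ℝ)|) ^ (-s)) ∧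
      ∑' n : ℤ, (1 + |a + b * (n : ℝ)|) ^ (-s) ≤ C := by
  set c : ℝ := min 1 (|b| / 2) with hc
  have hb' : 0 < |b| := abs_pos.2 hb
  have hc0 : 0 < c := lt_min one_pos (by positivity)
  have hS := summable_one_add_abs_int_rpow hs
  refine ⟨c ^ (-s) * ∑' n : ℤ, (1 + |(n : ℝ)|) ^ (-s), fun a => ?_⟩
  set n₀ : ℤ := round (-a / b) with hn₀
  have hr : |a + b * n₀| ≤ |b| / 2 := by
    have h1 := abs_sub_round (-a / b)
    have h2 : a + b * n₀ = -(b * (-a / b - n₀)) := by field_simp; ring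
    rw [h2, abs_neg, abs_mul]
    nlinarith
  have hpt : ∀ n : ℤ, (1 + |a + b * (n : ℝ)|) ^ (-s) ≤
      c ^ (-s) * (1 + |((n - n₀ : ℤ) : ℝ)|) ^ (-s) := by
    intro n
    rw [← Real.mul_rpow hc0.le (by positivity)]
    refine Real.rpow_le_rpow_of_nonpos (by positivity) ?_ (by linarith)
    have c1 : c ≤ 1 := min_le_left _ _
    have c2 : c ≤ |b| / 2 := min_le_right _ _
    rcases eq_or_ne n n₀ with rfl | hne
    · simp only [sub_self, Int.cast_zero, abs_zero, add_zero, mul_one]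
      linarith [abs_nonneg (a + b * (n₀ : ℝ))]
    · have h1 : (1 : ℝ) ≤ |((n - n₀ : ℤ) : ℝ)| := by
        rw [← Int.cast_abs]
        exact_mod_cast Int.one_le_abs (sub_ne_zero.2 hne)
      have h2 : a + b * n = b * ((n - n₀ : ℤ) : ℝ) + (a + b * n₀) := by push_cast; ring
      have h3 := abs_sub_abs_le_abs_sub (b * ((n - n₀ : ℤ) : ℝ)) (-(a + b * n₀))
      rw [abs_neg, sub_neg_eq_add, ← h2, abs_mul] at h3
      nlinarith
  have hS' : Summable fun n : ℤ => c ^ (-s) * (1 + |((n - n₀ : ℤ) : ℝ)|) ^ (-s) :=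
    ((Equiv.subRight n₀).summable_iff.2 hS).mul_left _
  have h0 := Summable.of_nonneg_of_le (fun n => by positivity) hpt hS'
  refine ⟨h0, (h0.tsum_le_tsum hpt hS').trans_eq ?_⟩
  rw [tsum_mul_left]
  congr 1
  exact (Equiv.subRight n₀).tsum_eq fun n : ℤ => (1 + |(n : ℝ)|) ^ (-s)

theorem summable_prod_affine_rpow {a b s : ℝ} (hb : b ≠ 0) (hs : 1 < s) :
    Summable fun p : ℤ × ℤ => (1 + |(p.1 : ℝ)|) ^ (-s) *
      (1 + |a * (p.1 : ℝ) + b * (p.2 : ℝ)|) ^ (-s) := by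
  obtain ⟨C, hC⟩ := exists_summable_affine_rpow hb hs
  have h0 : 0 ≤ fun p : ℤ × ℤ => (1 + |(p.1 : ℝ)|) ^ (-s) *
      (1 + |a * (p.1 : ℝ) + b * (p.2 : ℝ)|) ^ (-s) := fun p => by
    simp only [Pi.zero_apply]; positivity
  have h1 : ∀ n : ℤ, Summable fun k : ℤ => (1 + |(n : ℝ)|) ^ (-s) *
      (1 + |a * (n : ℝ) + b * (k : ℝ)|) ^ (-s) := fun n =>
    Summable.mul_left _ (hC (a * n)).1
  have h2 : ∀ n : ℤ, ∑' k : ℤ, (1 + |(n : ℝ)|) ^ (-s) *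
      (1 + |a * (n : ℝ) + b * (k : ℝ)|) ^ (-s) ≤ (1 + |(n : ℝ)|) ^ (-s) * C := fun n => by
    rw [tsum_mul_left]
    exact mul_le_mul_of_nonneg_left (hC (a * n)).2 (by positivity)
  rw [summable_prod_of_nonneg h0]
  exact ⟨h1, Summable.of_nonneg_of_le (fun n => tsum_nonneg fun k => h0 (n, k)) h2
    ((summable_one_add_abs_int_rpow hs).mul_right C)⟩

theorem summable_freqSize_dirSize {τ : Fin 2 → ℝ} (hτ : τ ≠ 0) {s : ℝ} (hs : 1 < s) :
    Summable fun m : Fin 2 → ℤ => freqSize m ^ (-s) * dirSize τ m ^ (-s) := by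
  have hτ' : τ 1 ≠ 0 ∨ τ 0 ≠ 0 := by
    by_contra! h
    exact hτ (funext fun i => by fin_cases i <;> simp [h])
  rcases hτ' with h | h
  · rw [← (finTwoArrowEquiv ℤ).symm.summable_iff]
    refine Summable.of_nonneg_of_le (fun p => ?_) (fun p => ?_)
      (summable_prod_affine_rpow (a := τ 0) h hs)
    · have := freqSize_pos ((finTwoArrowEquiv ℤ).symm p)
      have := dirSize_pos τ ((finTwoArrowEquiv ℤ).symm p)
      simp only [Function.comp]; positivity
    · simp only [Function.comp, freqSize, dirSize, finTwoArrowEquiv_symm_apply,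
        Matrix.cons_val_zero, Matrix.cons_val_one]
      gcongr ?_ * _
      exact Real.rpow_le_rpow_of_nonpos (by positivity) (by linarith [abs_nonneg (p.2 : ℝ)])
        (by linarith)
  · rw [← ((Equiv.prodComm ℤ ℤ).trans (finTwoArrowEquiv ℤ).symm).summable_iff]
    refine Summable.of_nonneg_of_le (fun p => ?_) (fun p => ?_)
      (summable_prod_affine_rpow (a := τ 1) h hs)
    · have := freqSize_pos (((Equiv.prodComm ℤ ℤ).trans (finTwoArrowEquiv ℤ).symm) p)
      have := dirSize_pos τ (((Equiv.prodComm ℤ ℤ).trans (finTwoArrowEquiv ℤ).symm) p)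
      simp only [Function.comp]; positivity
    · simp only [Function.comp, freqSize, dirSize, finTwoArrowEquiv_symm_apply, Equiv.trans_apply,
        Equiv.prodComm_apply, Prod.fst_swap, Prod.snd_swap,
        Matrix.cons_val_zero, Matrix.cons_val_one]
      rw [add_comm (τ 0 * _)]
      gcongr ?_ * _
      exact Real.rpow_le_rpow_of_nonpos (by positivity) (by linarith [abs_nonneg (p.2 : ℝ)])
        (by linarith)

/-- The number of ways to write the sum and the sum of squares of two frequencies. -/
theorem card_resonant_le {ε : ℝ} (hε : 0 < ε) :
    ∃ C : ℝ, 1 ≤ C ∧ ∀ (m n : Fin 2 → ℤ) (F : Finset (Fin 2 → ℤ)),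
      (∀ k ∈ F, freqSq k + freqSq (m + n - k) = freqSq m + freqSq n) →
      (F.card : ℝ) ≤ C * (freqSize m * freqSize n) ^ ε := by
  classical
  obtain ⟨C, hC, h⟩ := card_sq_add_sq_eq_le (half_pos hε)
  refine ⟨C, hC, fun m n F hF => ?_⟩
  let φ : (Fin 2 → ℤ) → ℤ × ℤ := fun k => (2 * k 0 - (m 0 + n 0), 2 * k 1 - (m 1 + n 1))
  have hφ : Function.Injective φ := by
    intro k l hkl
    simp only [φ, Prod.mk.injEq] at hkl
    funext i
    fin_cases i
    · simp only [Fin.zero_eta]; omega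
    · simp only [Fin.mk_one]; omega
  set N : ℤ := (m 0 - n 0) ^ 2 + (m 1 - n 1) ^ 2 with hN
  have hφN : ∀ p ∈ F.image φ, p.1 ^ 2 + p.2 ^ 2 = N := by
    intro p hp
    obtain ⟨k, hk, rfl⟩ := Finset.mem_image.1 hp
    have := hF k hk
    simp only [freqSq, Pi.sub_apply, Pi.add_apply] at this
    simp only [φ, hN]
    linear_combination 2 * this
  rw [← Finset.card_image_of_injective F hφ]
  have h1m := one_le_freqSize m
  have h1n := one_le_freqSize n
  have hone : 1 ≤ (freqSize m * freqSize n) ^ ε :=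
    Real.one_le_rpow (by nlinarith) hε.le
  rcases le_or_gt 1 N with hN1 | hN1
  · refine (h N hN1 _ hφN).trans ?_
    gcongr
    have hle : (N : ℝ) ≤ (freqSize m * freqSize n) ^ 2 := by
      have a0 := abs_sub (m 0 : ℝ) (n 0)
      have a1 := abs_sub (m 1 : ℝ) (n 1)
      have b : |(m 0 : ℝ) - n 0| + |(m 1 : ℝ) - n 1| ≤ freqSize m * freqSize n := by
        have : freqSize m + freqSize n - 2 ≤ freqSize m * freqSize n := by nlinarith
        have e : freqSize m + freqSize n - 2 =
          |(m 0 : ℝ)| + |(n 0 : ℝ)| + (|(m 1 : ℝ)| + |(n 1 : ℝ)|) := by unfold freqSize; ring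
        linarith
      have e : (N : ℝ) = |(m 0 : ℝ) - n 0| ^ 2 + |(m 1 : ℝ) - n 1| ^ 2 := by
        rw [sq_abs, sq_abs, hN]; push_cast; ring
      rw [e]
      nlinarith [abs_nonneg ((m 0 : ℝ) - n 0), abs_nonneg ((m 1 : ℝ) - n 1)]
    calc (N : ℝ) ^ (ε / 2) ≤ ((freqSize m * freqSize n) ^ 2) ^ (ε / 2) := by
          have : (0 : ℝ) ≤ N := by exact_mod_cast (zero_le_one.trans hN1)
          gcongr
      _ = _ := by
          rw [← Real.rpow_natCast, ← Real.rpow_mul (by positivity)]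
          congr 1; push_cast; ring
  · have hcard : (F.image φ).card ≤ 1 := by
      refine Finset.card_le_one.2 fun p hp r hr => ?_
      have key : ∀ p ∈ F.image φ, p = (0, 0) := fun p hp => by
        have h1 := hφN p hp
        have h2 : p.1 ^ 2 = 0 := by nlinarith [sq_nonneg p.1, sq_nonneg p.2]
        have h3 : p.2 ^ 2 = 0 := by nlinarith [sq_nonneg p.1, sq_nonneg p.2]
        exact Prod.ext (by simpa using h2) (by simpa using h3)
      rw [key p hp, key r hr]
    calc ((F.image φ).card : ℝ) ≤ 1 := by exact_mod_cast hcard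
      _ ≤ _ := by nlinarith

/-! ### Space-time estimates for trigonometric polynomials -/

section

open scoped ComplexConjugate Pointwise

theorem integral_norm_sq_sum_le {Ω ι κ : Type*} [MeasurableSpace Ω] [DecidableEq κ]
    (ν : Measure Ω) [IsFiniteMeasure ν] (hν : ν.real Set.univ ≤ 1) (φ : ι → Ω → ℂ) (Q : ι → κ)
    (hφm : ∀ i, AEStronglyMeasurable (φ i) ν) (hφ1 : ∀ i ω, ‖φ i ω‖ = 1)
    (hφ : ∀ i j, Q i ≠ Q j → ∫ ω, φ i ω * conj (φ j ω) ∂ν = 0) (I : Finset ι) (z : ι → ℂ) :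
    ∫ ω, ‖∑ i ∈ I, z i * φ i ω‖ ^ 2 ∂ν ≤
      ∑ i ∈ I, ‖z i‖ ^ 2 * ((I.filter fun j => Q j = Q i).card : ℝ) := by
  have hint : ∀ i j, Integrable (fun ω => φ i ω * conj (φ j ω)) ν := fun i j => by
    refine Integrable.of_bound ((hφm i).mul (RCLike.continuous_conj.comp_aestronglyMeasurable
      (hφm j))) 1 (ae_of_all _ fun ω => ?_)
    simp [hφ1]
  have hle : ∀ i j, ‖∫ ω, φ i ω * conj (φ j ω) ∂ν‖ ≤ if Q j = Q i then 1 else 0 := by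
    intro i j
    split_ifs with h
    · refine (norm_integral_le_of_norm_le_const (C := 1) (ae_of_all _ fun ω => ?_)).trans ?_
      · simp [hφ1]
      · simpa using hν
    · rw [hφ i j (Ne.symm h), norm_zero]
  have hexp : ∀ ω, ((‖∑ i ∈ I, z i * φ i ω‖ ^ 2 : ℝ) : ℂ) =
      ∑ i ∈ I, ∑ j ∈ I, (z i * conj (z j)) * (φ i ω * conj (φ j ω)) := by
    intro ω
    rw [← Complex.normSq_eq_norm_sq, ← Complex.mul_conj, map_sum, Finset.sum_mul_sum]
    refine Finset.sum_congr rfl fun i _ => Finset.sum_congr rfl fun j _ => ?_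
    rw [map_mul]; ring
  have hI : ((∫ ω, ‖∑ i ∈ I, z i * φ i ω‖ ^ 2 ∂ν : ℝ) : ℂ) =
      ∑ i ∈ I, ∑ j ∈ I, (z i * conj (z j)) * ∫ ω, φ i ω * conj (φ j ω) ∂ν := by
    rw [← integral_complex_ofReal]
    simp only [hexp]
    rw [integral_finsetSum _ fun i _ => integrable_finsetSum _ fun j _ => (hint i j).const_mul _]
    refine Finset.sum_congr rfl fun i _ => ?_
    rw [integral_finsetSum _ fun j _ => (hint i j).const_mul _]
    exact Finset.sum_congr rfl fun j _ => integral_const_mul _ _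
  have h0 : 0 ≤ ∫ ω, ‖∑ i ∈ I, z i * φ i ω‖ ^ 2 ∂ν := integral_nonneg fun ω => by positivity
  have hsym : ∑ i ∈ I, ∑ j ∈ I, (if Q j = Q i then ‖z j‖ ^ 2 else 0) =
      ∑ i ∈ I, ∑ j ∈ I, (if Q j = Q i then ‖z i‖ ^ 2 else 0) := by
    rw [Finset.sum_comm]
    refine Finset.sum_congr rfl fun i _ => Finset.sum_congr rfl fun j _ => ?_
    simp only [eq_comm]
  calc ∫ ω, ‖∑ i ∈ I, z i * φ i ω‖ ^ 2 ∂ν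
      = ‖((∫ ω, ‖∑ i ∈ I, z i * φ i ω‖ ^ 2 ∂ν : ℝ) : ℂ)‖ := by
        rw [Complex.norm_real, Real.norm_of_nonneg h0]
    _ ≤ ∑ i ∈ I, ∑ j ∈ I, ‖(z i * conj (z j)) * ∫ ω, φ i ω * conj (φ j ω) ∂ν‖ := by
        rw [hI]
        exact (norm_sum_le _ _).trans (Finset.sum_le_sum fun i _ => norm_sum_le _ _)
    _ ≤ ∑ i ∈ I, ∑ j ∈ I, ((if Q j = Q i then ‖z i‖ ^ 2 else 0) / 2 +
          (if Q j = Q i then ‖z j‖ ^ 2 else 0) / 2) := by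
        refine Finset.sum_le_sum fun i _ => Finset.sum_le_sum fun j _ => ?_
        have := hle i j
        rw [norm_mul, norm_mul, RCLike.norm_conj]
        split_ifs at this ⊢
        · nlinarith [sq_nonneg (‖z i‖ - ‖z j‖), mul_nonneg (norm_nonneg (z i)) (norm_nonneg (z j))]
        · nlinarith [mul_nonneg (norm_nonneg (z i)) (norm_nonneg (z j))]
    _ = ∑ i ∈ I, ∑ j ∈ I, (if Q j = Q i then ‖z i‖ ^ 2 else 0) := by
        simp only [Finset.sum_add_distrib, ← Finset.sum_div]
        rw [hsym]; ring
    _ = _ := by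
        refine Finset.sum_congr rfl fun i _ => ?_
        rw [← Finset.sum_filter, Finset.sum_const, nsmul_eq_mul, mul_comm]

theorem schrodingerMultiplier_eq (t : ℝ) (m : Fin 2 → ℤ) :
    schrodingerMultiplier t m =
      Complex.exp (((-(4 * Real.pi ^ 2 * t * (freqSq m : ℝ)) : ℝ) : ℂ) * Complex.I) := by
  simp [schrodingerMultiplier, freqSq, Fin.sum_univ_two]

/-- Lebesgue measure on one time period of the Schrödinger evolution. -/
noncomputable def periodMeasure (a : ℝ) : Measure ℝ :=
  volume.restrict (Set.Ioc a (a + 1 / (2 * Real.pi)))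

instance (a : ℝ) : IsFiniteMeasure (periodMeasure a) := by
  unfold periodMeasure; infer_instance

theorem periodMeasure_real_univ_le (a : ℝ) : (periodMeasure a).real Set.univ ≤ 1 := by
  have h : 1 / (2 * Real.pi) ≤ 1 := by
    rw [div_le_one (by positivity)]; linarith [Real.pi_gt_three]
  simpa [periodMeasure, Real.volume_real_Ioc_of_le, Real.pi_pos.le] using h

theorem ae_of_ae_periodMeasure {p : ℝ → Prop} (h : ∀ a, ∀ᵐ t ∂periodMeasure a, p t) :
    ∀ᵐ t : ℝ, p t := by
  have hp : 0 < 1 / (2 * Real.pi) := by positivity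
  have hu := iUnion_Ioc_zsmul hp
  rw [← Measure.restrict_univ (μ := (volume : Measure ℝ)), ← hu, ae_restrict_iUnion_iff]
  intro n
  have := h (n • (1 / (2 * Real.pi)))
  rwa [periodMeasure, ← add_one_zsmul] at this

theorem continuous_schrodingerMultiplier (m : Fin 2 → ℤ) :
    Continuous fun t => schrodingerMultiplier t m := by
  unfold schrodingerMultiplier; fun_prop

theorem integral_periodMeasure_exp (a : ℝ) {q : ℤ} (hq : q ≠ 0) :
    ∫ t, Complex.exp (((-(4 * Real.pi ^ 2 * t * (q : ℝ)) : ℝ) : ℂ) * Complex.I)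
      ∂periodMeasure a = 0 := by
  have hp : 0 ≤ 1 / (2 * Real.pi) := by positivity
  have hπ : (Real.pi : ℂ) ≠ 0 := by exact_mod_cast Real.pi_ne_zero
  have hc : (-(4 * Real.pi ^ 2 * q) * Complex.I : ℂ) ≠ 0 := by
    have : (q : ℂ) ≠ 0 := by exact_mod_cast hq
    simp [hπ, this]
  rw [periodMeasure, ← intervalIntegral.integral_of_le (by linarith)]
  have : ∀ t : ℝ, Complex.exp (((-(4 * Real.pi ^ 2 * t * (q : ℝ)) : ℝ) : ℂ) * Complex.I) =
      Complex.exp ((-(4 * Real.pi ^ 2 * q) * Complex.I : ℂ) * t) := by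
    intro t; congr 1; push_cast; ring
  simp only [this]
  rw [integral_exp_mul_complex hc]
  have e : Complex.exp ((-(4 * Real.pi ^ 2 * q) * Complex.I : ℂ) *
      ((a + 1 / (2 * Real.pi) : ℝ) : ℂ)) =
      Complex.exp ((-(4 * Real.pi ^ 2 * q) * Complex.I : ℂ) * a) := by
    rw [Complex.exp_eq_exp_iff_exists_int]
    refine ⟨-q, ?_⟩
    push_cast
    field_simp
    ring
  rw [e, sub_self, zero_div]

open UnitAddTorus in
theorem mFourier_mul_conj (m n : Fin 2 → ℤ) (x : Torus2) :
    mFourier m x * conj (mFourier n x) = mFourier (m - n) x := by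
  rw [← mFourier_neg, ← mFourier_add, sub_eq_add_neg]

open UnitAddTorus in
theorem norm_mFourier_apply (m : Fin 2 → ℤ) (x : Torus2) : ‖mFourier m x‖ = 1 := by
  simp only [mFourier, fourier_apply, ContinuousMap.coe_mk, norm_prod, Circle.norm_coe,
    Finset.prod_const_one]

open UnitAddTorus in
theorem integral_mFourier {m : Fin 2 → ℤ} (hm : m ≠ 0) :
    ∫ x, mFourier m x ∂torusMeasure = 0 := by
  have h := (orthonormal_iff_ite.1 (orthonormal_mFourier (d := Fin 2))) 0 m
  rw [if_neg hm.symm, ContinuousMap.inner_toLp] at h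
  simpa [mFourier_zero] using! h

/-- The trigonometric polynomial with frequencies in `F` and coefficients `c`. -/
noncomputable def trigPoly (F : Finset (Fin 2 → ℤ)) (c : (Fin 2 → ℤ) → ℂ) : C(Torus2, ℂ) :=
  ∑ m ∈ F, c m • UnitAddTorus.mFourier m

theorem trigPoly_apply (F : Finset (Fin 2 → ℤ)) (c : (Fin 2 → ℤ) → ℂ) (x : Torus2) :
    trigPoly F c x = ∑ m ∈ F, c m * UnitAddTorus.mFourier m x := by
  simp [trigPoly]

/-- The coefficients of the square of a trigonometric polynomial. -/
noncomputable def sqCoeff (F : Finset (Fin 2 → ℤ)) (c : (Fin 2 → ℤ) → ℂ) (A : Fin 2 → ℤ) : ℂ :=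
  ∑ p ∈ (F ×ˢ F).filter (fun p => p.1 + p.2 = A), c p.1 * c p.2

theorem trigPoly_sq (F : Finset (Fin 2 → ℤ)) (c : (Fin 2 → ℤ) → ℂ) (x : Torus2) :
    trigPoly F c x ^ 2 = ∑ A ∈ F + F, sqCoeff F c A * UnitAddTorus.mFourier A x := by
  have hmaps : ∀ p ∈ F ×ˢ F, p.1 + p.2 ∈ F + F := fun p hp =>
    Finset.add_mem_add (Finset.mem_product.1 hp).1 (Finset.mem_product.1 hp).2
  rw [sq, trigPoly_apply, Finset.sum_mul_sum, ← Finset.sum_product',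
    ← Finset.sum_fiberwise_of_maps_to hmaps]
  refine Finset.sum_congr rfl fun A _ => ?_
  rw [sqCoeff, Finset.sum_mul]
  refine Finset.sum_congr rfl fun p hp => ?_
  rw [← (Finset.mem_filter.1 hp).2, UnitAddTorus.mFourier_add]
  ring

theorem integral_norm_trigPoly_pow_four_le (F : Finset (Fin 2 → ℤ)) (c : (Fin 2 → ℤ) → ℂ) :
    ∫ x, ‖trigPoly F c x‖ ^ 4 ∂torusMeasure ≤ ∑ A ∈ F + F, ‖sqCoeff F c A‖ ^ 2 := by
  have h := integral_norm_sq_sum_le torusMeasure (by simp)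
    (fun (A : Fin 2 → ℤ) (x : Torus2) => UnitAddTorus.mFourier A x) id
    (fun A => (UnitAddTorus.mFourier A).continuous.aestronglyMeasurable)
    (fun A x => norm_mFourier_apply A x)
    (fun A B hAB => by
      simp only [mFourier_mul_conj]
      exact integral_mFourier (sub_ne_zero.2 hAB)) (F + F) (sqCoeff F c)
  have e : ∀ x, ‖trigPoly F c x‖ ^ 4 =
      ‖∑ A ∈ F + F, sqCoeff F c A * UnitAddTorus.mFourier A x‖ ^ 2 := fun x => by
    rw [← trigPoly_sq, norm_pow]; ring
  simp only [e]
  refine h.trans_eq (Finset.sum_congr rfl fun A hA => ?_)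
  have : (F + F).filter (fun j => id j = id A) = {A} := by
    ext B; simp only [id, Finset.mem_filter, Finset.mem_singleton]
    exact ⟨fun hB => hB.2, fun hB => ⟨hB.symm ▸ hA, hB⟩⟩
  rw [this]; simp

theorem norm_trigPoly_pow_four_le (F : Finset (Fin 2 → ℤ)) (c : (Fin 2 → ℤ) → ℂ)
    (w : (Fin 2 → ℤ) → ℝ) (hw : ∀ A, 0 < w A) :
    ‖trigPoly F c‖ ^ 4 ≤ (∑ A ∈ F + F, (w A)⁻¹) * ∑ A ∈ F + F, w A * ‖sqCoeff F c A‖ ^ 2 := by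
  have h1 : ‖trigPoly F c‖ ^ 2 ≤ ∑ A ∈ F + F, ‖sqCoeff F c A‖ := by
    have h0 : 0 ≤ ∑ A ∈ F + F, ‖sqCoeff F c A‖ := Finset.sum_nonneg fun _ _ => norm_nonneg _
    rw [← Real.le_sqrt (norm_nonneg _) h0, ContinuousMap.norm_le _ (Real.sqrt_nonneg _)]
    intro x
    rw [Real.le_sqrt (norm_nonneg _) h0, ← norm_pow, trigPoly_sq]
    refine (norm_sum_le _ _).trans_eq (Finset.sum_congr rfl fun A _ => ?_)
    rw [norm_mul, norm_mFourier_apply, mul_one]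
  have h2 : (∑ A ∈ F + F, ‖sqCoeff F c A‖) ^ 2 ≤
      (∑ A ∈ F + F, (w A)⁻¹) * ∑ A ∈ F + F, w A * ‖sqCoeff F c A‖ ^ 2 :=
    Finset.sum_sq_le_sum_mul_sum_of_sq_le_mul _ (fun A _ => (inv_pos.2 (hw A)).le)
      (fun A _ => mul_nonneg (hw A).le (sq_nonneg _)) (fun A _ => by
        rw [inv_mul_cancel_left₀ (hw A).ne'])
  calc ‖trigPoly F c‖ ^ 4 = (‖trigPoly F c‖ ^ 2) ^ 2 := by ring
    _ ≤ (∑ A ∈ F + F, ‖sqCoeff F c A‖) ^ 2 := by gcongr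
    _ ≤ _ := h2

/-- The coefficients of the evolution at time `t`. -/
noncomputable def evolveCoeff (t : ℝ) (c : (Fin 2 → ℤ) → ℂ) (m : Fin 2 → ℤ) : ℂ :=
  schrodingerMultiplier t m * c m

theorem norm_evolveCoeff (t : ℝ) (c : (Fin 2 → ℤ) → ℂ) (m : Fin 2 → ℤ) :
    ‖evolveCoeff t c m‖ = ‖c m‖ := by
  rw [evolveCoeff, norm_mul, norm_schrodingerMultiplier, one_mul]

theorem continuous_sqCoeff_evolveCoeff (F : Finset (Fin 2 → ℤ)) (c : (Fin 2 → ℤ) → ℂ)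
    (A : Fin 2 → ℤ) : Continuous fun t => sqCoeff F (evolveCoeff t c) A := by
  unfold sqCoeff evolveCoeff
  have := continuous_schrodingerMultiplier
  fun_prop

theorem integrable_periodMeasure {f : ℝ → ℝ} (hf : Continuous f) (a : ℝ) :
    Integrable f (periodMeasure a) :=
  (hf.continuousOn.integrableOn_Icc).mono_set Set.Ioc_subset_Icc_self

theorem integral_sum_sqCoeff_le {ε : ℝ} (hε : 0 < ε) : ∃ C : ℝ, 1 ≤ C ∧
    ∀ (a : ℝ) (F : Finset (Fin 2 → ℤ)) (c : (Fin 2 → ℤ) → ℂ) (w v : (Fin 2 → ℤ) → ℝ),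
      (∀ A, 0 ≤ w A) → (∀ m ∈ F, ∀ n ∈ F, w (m + n) ≤ v m * v n) →
      ∫ t, ∑ A ∈ F + F, w A * ‖sqCoeff F (evolveCoeff t c) A‖ ^ 2 ∂periodMeasure a ≤
        C * (∑ m ∈ F, ‖c m‖ ^ 2 * v m * freqSize m ^ ε) ^ 2 := by
  classical
  obtain ⟨C, hC, hres⟩ := card_resonant_le hε
  refine ⟨C, hC, fun a F c w v hw hv => ?_⟩
  have hcont : ∀ A, Continuous fun t => w A * ‖sqCoeff F (evolveCoeff t c) A‖ ^ 2 := fun A =>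
    ((continuous_sqCoeff_evolveCoeff F c A).norm.pow 2).const_mul _
  rw [integral_finsetSum _ fun A _ => integrable_periodMeasure (hcont A) a]
  have hA : ∀ A ∈ F + F, ∫ t, w A * ‖sqCoeff F (evolveCoeff t c) A‖ ^ 2 ∂periodMeasure a ≤
      ∑ p ∈ (F ×ˢ F).filter (fun p => p.1 + p.2 = A),
        C * ((‖c p.1‖ ^ 2 * v p.1 * freqSize p.1 ^ ε) *
          (‖c p.2‖ ^ 2 * v p.2 * freqSize p.2 ^ ε)) := by
    intro A _
    rw [integral_const_mul]
    have h := integral_norm_sq_sum_le (periodMeasure a) (periodMeasure_real_univ_le a)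
      (fun (p : (Fin 2 → ℤ) × (Fin 2 → ℤ)) t =>
        schrodingerMultiplier t p.1 * schrodingerMultiplier t p.2)
      (fun p => freqSq p.1 + freqSq p.2)
      (fun p => ((continuous_schrodingerMultiplier p.1).mul
        (continuous_schrodingerMultiplier p.2)).aestronglyMeasurable)
      (fun p t => by simp only [norm_mul, norm_schrodingerMultiplier, one_mul])
      (fun p r hpr => by
        rw [← integral_periodMeasure_exp a (sub_ne_zero.2 hpr)]
        congr 1
        funext t
        simp only [schrodingerMultiplier_eq, map_mul, ← Complex.exp_conj, Complex.conj_ofReal,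
          Complex.conj_I]
        simp only [← Complex.exp_add]
        congr 1; push_cast; ring)
      ((F ×ˢ F).filter (fun p => p.1 + p.2 = A)) (fun p => c p.1 * c p.2)
    have e : ∀ t, ‖sqCoeff F (evolveCoeff t c) A‖ ^ 2 =
        ‖∑ p ∈ (F ×ˢ F).filter (fun p => p.1 + p.2 = A), c p.1 * c p.2 *
          (schrodingerMultiplier t p.1 * schrodingerMultiplier t p.2)‖ ^ 2 := fun t => by
      unfold sqCoeff evolveCoeff
      congr 2
      exact Finset.sum_congr rfl fun p _ => by ring
    simp only [e]
    refine (mul_le_mul_of_nonneg_left h (hw A)).trans ?_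
    rw [Finset.mul_sum]
    refine Finset.sum_le_sum fun p hp => ?_
    obtain ⟨hpF, hpA⟩ := Finset.mem_filter.1 hp
    obtain ⟨hp1, hp2⟩ := Finset.mem_product.1 hpF
    have hcard : ((((F ×ˢ F).filter (fun p => p.1 + p.2 = A)).filter
        (fun r => freqSq r.1 + freqSq r.2 = freqSq p.1 + freqSq p.2)).card : ℝ) ≤
        C * (freqSize p.1 * freqSize p.2) ^ ε := by
      rw [← Finset.card_image_of_injOn (f := Prod.fst)]
      · refine hres p.1 p.2 _ fun k hk => ?_
        obtain ⟨r, hr, rfl⟩ := Finset.mem_image.1 hk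
        obtain ⟨hr1, hr2⟩ := Finset.mem_filter.1 hr
        have : p.1 + p.2 - r.1 = r.2 := by
          rw [hpA, ← (Finset.mem_filter.1 hr1).2, add_sub_cancel_left]
        rw [this, hr2]
      · intro r hr s hs hrs
        have h1 := (Finset.mem_filter.1 (Finset.mem_filter.1 hr).1).2
        have h2 := (Finset.mem_filter.1 (Finset.mem_filter.1 hs).1).2
        rw [← h2, hrs] at h1
        exact Prod.ext hrs (add_left_cancel h1)
    have hwv := hv p.1 hp1 p.2 hp2
    rw [hpA] at hwv
    rw [Real.mul_rpow (freqSize_pos _).le (freqSize_pos _).le] at hcard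
    have hf1 : 0 ≤ freqSize p.1 ^ ε := Real.rpow_nonneg (freqSize_pos _).le _
    have hf2 : 0 ≤ freqSize p.2 ^ ε := Real.rpow_nonneg (freqSize_pos _).le _
    rw [norm_mul]
    calc w A * ((‖c p.1‖ * ‖c p.2‖) ^ 2 * _) ≤
        (v p.1 * v p.2) * ((‖c p.1‖ * ‖c p.2‖) ^ 2 *
          (C * (freqSize p.1 ^ ε * freqSize p.2 ^ ε))) := by
          have := (hw A).trans hwv
          gcongr
      _ = _ := by ring
  have hmaps : ∀ p ∈ F ×ˢ F, p.1 + p.2 ∈ F + F := fun p hp =>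
    Finset.add_mem_add (Finset.mem_product.1 hp).1 (Finset.mem_product.1 hp).2
  refine (Finset.sum_le_sum hA).trans_eq ?_
  rw [Finset.sum_fiberwise_of_maps_to hmaps (fun p => C * ((‖c p.1‖ ^ 2 * v p.1 *
    freqSize p.1 ^ ε) * (‖c p.2‖ ^ 2 * v p.2 * freqSize p.2 ^ ε))), ← Finset.mul_sum, sq,
    Finset.sum_mul_sum, ← Finset.sum_product']

theorem lintegral_trigPoly_pow_four_le {ε : ℝ} (hε : 0 < ε) : ∃ C : ℝ, 1 ≤ C ∧
    ∀ (a : ℝ) (F : Finset (Fin 2 → ℤ)) (c : (Fin 2 → ℤ) → ℂ),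
      ∫⁻ t, ∫⁻ x, ‖trigPoly F (evolveCoeff t c) x‖ₑ ^ 4 ∂torusMeasure ∂periodMeasure a ≤
        ENNReal.ofReal (C * (∑ m ∈ F, ‖c m‖ ^ 2 * freqSize m ^ ε) ^ 2) := by
  obtain ⟨C, hC, h⟩ := integral_sum_sqCoeff_le hε
  refine ⟨C, hC, fun a F c => ?_⟩
  have h1 := h a F c (fun _ => 1) (fun _ => 1) (fun _ => zero_le_one) (fun _ _ _ _ => by simp)
  simp only [one_mul, mul_one] at h1
  refine le_trans ?_ (ENNReal.ofReal_le_ofReal h1)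
  rw [ofReal_integral_eq_lintegral_ofReal]
  · refine lintegral_mono fun t => ?_
    refine le_trans (le_of_eq ?_) (ENNReal.ofReal_le_ofReal
      (integral_norm_trigPoly_pow_four_le F (evolveCoeff t c)))
    rw [ofReal_integral_eq_lintegral_ofReal]
    · refine lintegral_congr fun x => ?_
      rw [ENNReal.ofReal_pow (norm_nonneg _), ofReal_norm]
    · exact ((trigPoly F _).continuous.norm.pow 4).integrable_of_hasCompactSupport
        (HasCompactSupport.of_compactSpace _)
    · exact ae_of_all _ fun x => by positivity
  · exact integrable_periodMeasure (continuous_finsetSum _ fun A _ =>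
      (continuous_sqCoeff_evolveCoeff F c A).norm.pow 2) a
  · exact ae_of_all _ fun t => Finset.sum_nonneg fun _ _ => by positivity

theorem lintegral_norm_trigPoly_pow_four_le {ε : ℝ} (hε : 0 < ε) : ∃ C : ℝ, 1 ≤ C ∧
    ∀ (a : ℝ) (F : Finset (Fin 2 → ℤ)) (c : (Fin 2 → ℤ) → ℂ) (w v : (Fin 2 → ℤ) → ℝ),
      (∀ A, 0 < w A) → (∀ m ∈ F, ∀ n ∈ F, w (m + n) ≤ v m * v n) →
      ∫⁻ t, ‖trigPoly F (evolveCoeff t c)‖ₑ ^ 4 ∂periodMeasure a ≤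
        ENNReal.ofReal (C * ((∑ A ∈ F + F, (w A)⁻¹) *
          (∑ m ∈ F, ‖c m‖ ^ 2 * v m * freqSize m ^ ε) ^ 2)) := by
  obtain ⟨C, hC, h⟩ := integral_sum_sqCoeff_le hε
  refine ⟨C, hC, fun a F c w v hw hv => ?_⟩
  have hW : 0 ≤ ∑ A ∈ F + F, (w A)⁻¹ := Finset.sum_nonneg fun A _ => (inv_pos.2 (hw A)).le
  have h1 := mul_le_mul_of_nonneg_left (h a F c w v (fun A => (hw A).le) hv) hW
  rw [mul_left_comm, ← integral_const_mul] at h1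
  refine le_trans ?_ (ENNReal.ofReal_le_ofReal h1)
  rw [ofReal_integral_eq_lintegral_ofReal]
  · refine lintegral_mono fun t => ?_
    rw [← ofReal_norm, ← ENNReal.ofReal_pow (norm_nonneg _)]
    exact ENNReal.ofReal_le_ofReal (norm_trigPoly_pow_four_le F _ w hw)
  · exact integrable_periodMeasure ((continuous_finsetSum _ fun A _ =>
      ((continuous_sqCoeff_evolveCoeff F c A).norm.pow 2).const_mul _).const_mul _) a
  · exact ae_of_all _ fun t => mul_nonneg hW (Finset.sum_nonneg fun A _ =>
      mul_nonneg (hw A).le (sq_nonneg _))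

end

/-! ### Dyadic blocks of frequencies -/

theorem exists_coe_eq_abs_eq_norm (x : UnitAddCircle) :
    ∃ r : ℝ, (r : UnitAddCircle) = x ∧ |r| = ‖x‖ := by
  induction x using QuotientAddGroup.induction_on with
  | H z =>
    refine ⟨z - round z, ?_, (UnitAddCircle.norm_eq (x := z)).symm⟩
    rw [AddCircle.coe_sub]
    have : ((round z : ℝ) : UnitAddCircle) = 0 := by
      rw [AddCircle.coe_eq_zero_iff]
      exact ⟨round z, by simp⟩
    rw [this, sub_zero]

theorem norm_fourier_sub_one_le (n : ℤ) (x : UnitAddCircle) :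
    ‖(fourier n x : ℂ) - 1‖ ≤ 2 * Real.pi * |(n : ℝ)| * ‖x‖ := by
  obtain ⟨r, rfl, hr⟩ := exists_coe_eq_abs_eq_norm x
  rw [fourier_coe_apply, ← hr]
  have h := Real.norm_exp_I_mul_ofReal_sub_one_le (x := 2 * Real.pi * n * r)
  have e : Complex.I * ((2 * Real.pi * n * r : ℝ) : ℂ) =
    2 * Real.pi * Complex.I * n * r / ((1 : ℝ) : ℂ) := by push_cast; ring
  rw [e] at h
  refine h.trans_eq ?_
  rw [Real.norm_eq_abs, abs_mul, abs_mul, abs_of_pos (by positivity : 0 < 2 * Real.pi)]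

theorem mFourier_add_apply (m : Fin 2 → ℤ) (x h : Torus2) :
    UnitAddTorus.mFourier m (x + h) = UnitAddTorus.mFourier m x * UnitAddTorus.mFourier m h := by
  simp only [UnitAddTorus.mFourier, ContinuousMap.coe_mk, Pi.add_apply, ← Finset.prod_mul_distrib]
  refine Finset.prod_congr rfl fun i _ => ?_
  simp [fourier_apply, smul_add, AddCircle.toCircle_add]

theorem norm_mFourier_sub_one_le (m : Fin 2 → ℤ) (h : Torus2) :
    ‖UnitAddTorus.mFourier m h - 1‖ ≤ 2 * Real.pi * (freqSize m * ‖h‖) := by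
  have e : UnitAddTorus.mFourier m h = fourier (m 0) (h 0) * fourier (m 1) (h 1) := by
    simp [UnitAddTorus.mFourier, Fin.prod_univ_two]
  have e2 : (fourier (m 0) (h 0) * fourier (m 1) (h 1) - 1 : ℂ) =
      fourier (m 0) (h 0) * (fourier (m 1) (h 1) - 1) + (fourier (m 0) (h 0) - 1) := by ring
  rw [e, e2]
  refine (norm_add_le _ _).trans ?_
  have n1 : ‖(fourier (m 0) (h 0) : ℂ)‖ = 1 := by
    rw [fourier_apply, Circle.norm_coe]
  rw [norm_mul, n1, one_mul]
  have h0 := norm_fourier_sub_one_le (m 0) (h 0)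
  have h1 := norm_fourier_sub_one_le (m 1) (h 1)
  have b0 := norm_le_pi_norm h 0
  have b1 := norm_le_pi_norm h 1
  have c0 : |(m 0 : ℝ)| * ‖h 0‖ ≤ |(m 0 : ℝ)| * ‖h‖ := by gcongr
  have c1 : |(m 1 : ℝ)| * ‖h 1‖ ≤ |(m 1 : ℝ)| * ‖h‖ := by gcongr
  have hs : |(m 0 : ℝ)| * ‖h 0‖ + |(m 1 : ℝ)| * ‖h 1‖ ≤ freqSize m * ‖h‖ := by
    unfold freqSize; nlinarith [norm_nonneg h]
  have := Real.pi_pos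
  nlinarith

theorem norm_mFourier_sub_one_le_rpow (m : Fin 2 → ℤ) (h : Torus2) {θ : ℝ} (hθ0 : 0 ≤ θ)
    (hθ1 : θ ≤ 1) :
    ‖UnitAddTorus.mFourier m h - 1‖ ≤ 2 * Real.pi * (freqSize m * ‖h‖) ^ θ := by
  have hz : 0 ≤ freqSize m * ‖h‖ := mul_nonneg (freqSize_pos m).le (norm_nonneg h)
  have hπ := Real.pi_gt_three
  rcases le_total (freqSize m * ‖h‖) 1 with h1 | h1
  · refine (norm_mFourier_sub_one_le m h).trans ?_
    have := Real.rpow_le_rpow_of_exponent_ge' hz h1 hθ0 hθ1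
    rw [Real.rpow_one] at this
    gcongr
  · have h2 := Real.one_le_rpow h1 hθ0
    have h3 : ‖UnitAddTorus.mFourier m h - 1‖ ≤ 2 := by
      refine (norm_sub_le _ _).trans ?_
      rw [norm_mFourier_apply, norm_one]; norm_num
    nlinarith

theorem finite_freqSize_lt (X : ℝ) : {m : Fin 2 → ℤ | freqSize m < X}.Finite := by
  refine (Set.finite_Icc (fun _ : Fin 2 => -⌈X⌉) (fun _ => ⌈X⌉)).subset fun m hm => ?_
  have hm' : 1 + |(m 0 : ℝ)| + |(m 1 : ℝ)| < X := hm
  have key : ∀ i, |m i| ≤ ⌈X⌉ := by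
    intro i
    have h : |(m i : ℝ)| ≤ X := by
      fin_cases i
      · exact (by linarith [abs_nonneg (m 1 : ℝ)] : |(m 0 : ℝ)| ≤ X)
      · exact (by linarith [abs_nonneg (m 0 : ℝ)] : |(m 1 : ℝ)| ≤ X)
    have := h.trans (Int.le_ceil X)
    exact_mod_cast this
  exact ⟨fun i => (abs_le.1 (key i)).1, fun i => (abs_le.1 (key i)).2⟩

/-- The frequencies of size less than `2 ^ n`. -/
noncomputable def freqBall (n : ℕ) : Finset (Fin 2 → ℤ) := (finite_freqSize_lt (2 ^ n)).toFinset

theorem mem_freqBall {n : ℕ} {m : Fin 2 → ℤ} : m ∈ freqBall n ↔ freqSize m < 2 ^ n := by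
  simp [freqBall]

theorem freqBall_mono {k n : ℕ} (h : k ≤ n) : freqBall k ⊆ freqBall n := fun m hm => by
  rw [mem_freqBall] at hm ⊢
  exact hm.trans_le (pow_le_pow_right₀ one_le_two h)

/-- The frequencies of size between `2 ^ n` and `2 ^ (n + 1)`. -/
noncomputable def freqBlock (n : ℕ) : Finset (Fin 2 → ℤ) := freqBall (n + 1) \ freqBall n

theorem mem_freqBlock {n : ℕ} {m : Fin 2 → ℤ} :
    m ∈ freqBlock n ↔ 2 ^ n ≤ freqSize m ∧ freqSize m < 2 ^ (n + 1) := by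
  rw [freqBlock, Finset.mem_sdiff, mem_freqBall, mem_freqBall, not_lt, and_comm]

theorem freqBall_zero : freqBall 0 = ∅ := by
  ext m
  simp [mem_freqBall, one_le_freqSize]

theorem trigPoly_freqBall (n : ℕ) (c : (Fin 2 → ℤ) → ℂ) :
    trigPoly (freqBall n) c = ∑ k ∈ Finset.range n, trigPoly (freqBlock k) c := by
  induction n with
  | zero => simp [freqBall_zero, trigPoly]
  | succ n ih =>
    rw [Finset.sum_range_succ, ← ih, trigPoly, trigPoly, trigPoly, freqBlock,
      ← Finset.sum_sdiff (freqBall_mono n.le_succ)]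
    exact add_comm _ _

theorem card_freqBall_le (n : ℕ) : ((freqBall n).card : ℝ) ≤ 16 * 4 ^ n := by
  have h : freqBall n ⊆ Finset.Icc (fun _ : Fin 2 => -((2 : ℤ) ^ n)) (fun _ => (2 : ℤ) ^ n) := by
    intro m hm
    have hm' : 1 + |(m 0 : ℝ)| + |(m 1 : ℝ)| < 2 ^ n := mem_freqBall.1 hm
    have key : ∀ i, |m i| ≤ (2 : ℤ) ^ n := by
      intro i
      have h : |(m i : ℝ)| ≤ 2 ^ n := by
        fin_cases i
        · exact (by linarith [abs_nonneg (m 1 : ℝ)] : |(m 0 : ℝ)| ≤ 2 ^ n)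
        · exact (by linarith [abs_nonneg (m 0 : ℝ)] : |(m 1 : ℝ)| ≤ 2 ^ n)
      exact_mod_cast h
    exact Finset.mem_Icc.2
      ⟨fun i => (abs_le.1 (key i)).1, fun i => (abs_le.1 (key i)).2⟩
  have h2 := Finset.card_le_card h
  rw [Pi.card_Icc] at h2
  simp only [Int.card_Icc, Fin.prod_univ_two] at h2
  have h3 : ((2 : ℤ) ^ n + 1 - -(2 : ℤ) ^ n).toNat = 2 * 2 ^ n + 1 := by
    have : (2 : ℤ) ^ n + 1 - -(2 : ℤ) ^ n = ((2 * 2 ^ n + 1 : ℕ) : ℤ) := by push_cast; ring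
    rw [this, Int.toNat_natCast]
  rw [h3] at h2
  have h4 : ((freqBall n).card : ℝ) ≤ (2 * 2 ^ n + 1) * (2 * 2 ^ n + 1) := by exact_mod_cast h2
  have h5 : (1 : ℝ) ≤ 2 ^ n := one_le_pow₀ one_le_two
  have h6 : (4 : ℝ) ^ n = 2 ^ n * 2 ^ n := by rw [← mul_pow]; norm_num
  rw [h6]; nlinarith

/-- The coefficients decay like those of a distribution carried by a segment of direction
orthogonal to the level lines of `dirSize τ`. -/
def DirDecay (τ : Fin 2 → ℝ) (B : ℝ) (c : (Fin 2 → ℤ) → ℂ) : Prop :=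
  ∀ m, ‖c m‖ ≤ B * (freqSize m ^ (-1 : ℝ) * dirSize τ m ^ (-1 : ℝ))

theorem DirDecay.norm_sq_le {τ : Fin 2 → ℝ} {B : ℝ} {c : (Fin 2 → ℤ) → ℂ} (h : DirDecay τ B c)
    (m : Fin 2 → ℤ) : ‖c m‖ ^ 2 ≤ B ^ 2 * (freqSize m ^ (-2 : ℝ) * dirSize τ m ^ (-2 : ℝ)) := by
  have h1 := pow_le_pow_left₀ (norm_nonneg _) (h m) 2
  refine h1.trans_eq ?_
  rw [mul_pow, mul_pow, ← Real.rpow_mul_natCast (freqSize_pos m).le,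
    ← Real.rpow_mul_natCast (dirSize_pos τ m).le]
  norm_num

open scoped Pointwise in
theorem lintegral_norm_block_le {τ : Fin 2 → ℝ} (hτ : τ ≠ 0) {B : ℝ} {c : (Fin 2 → ℤ) → ℂ}
    (hc : DirDecay τ B c) : ∃ C : ℝ, 0 ≤ C ∧ ∀ a n,
      ∫⁻ t, ‖trigPoly (freqBlock n) (evolveCoeff t c)‖ₑ ^ 4 ∂periodMeasure a ≤
        ENNReal.ofReal (C * (2 : ℝ) ^ (-(1 / 2) * n : ℝ)) := by
  set η : ℝ := 1 / 18 with hη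
  obtain ⟨C, hC, h⟩ := lintegral_norm_trigPoly_pow_four_le (by norm_num [hη] : 0 < η)
  have hS := summable_freqSize_dirSize hτ (by norm_num [hη] : 1 < 1 + η)
  set W := ∑' m : Fin 2 → ℤ, freqSize m ^ (-(1 + η)) * dirSize τ m ^ (-(1 + η)) with hW
  have hpos : ∀ m : Fin 2 → ℤ, 0 ≤ freqSize m ^ (-(1 + η)) * dirSize τ m ^ (-(1 + η)) :=
    fun m => mul_nonneg (Real.rpow_nonneg (freqSize_pos m).le _)
      (Real.rpow_nonneg (dirSize_pos τ m).le _)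
  have hW0 : 0 ≤ W := tsum_nonneg hpos
  set T : ℝ := 1 + |τ 0| + |τ 1| with hT
  have hT0 : 0 ≤ T := by positivity
  set D : ℝ := B ^ 2 * (2 ^ (1 + η) * T ^ (2 * η)) with hD
  have hD0 : 0 ≤ D := by positivity
  refine ⟨C * (W * (D * W) ^ 2), by positivity, fun a n => ?_⟩
  refine (h a (freqBlock n) c (fun A => freqSize A ^ (1 + η) * dirSize τ A ^ (1 + η))
    (fun m => (2 * freqSize m ^ (1 / 2 : ℝ) * dirSize τ m) ^ (1 + η)) ?_ ?_).trans
    (ENNReal.ofReal_le_ofReal ?_)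
  · intro A
    have := freqSize_pos A
    have := dirSize_pos τ A
    positivity
  · intro m hm k hk
    rw [mem_freqBlock] at hm hk
    have p1 := freqSize_pos m
    have p2 := freqSize_pos k
    have p3 := freqSize_pos (m + k)
    have q1 := dirSize_pos τ m
    have q2 := dirSize_pos τ k
    have q3 := dirSize_pos τ (m + k)
    rw [← Real.mul_rpow p3.le q3.le, ← Real.mul_rpow (by positivity) (by positivity)]
    refine Real.rpow_le_rpow (by positivity) ?_ (by norm_num [hη])
    have h1 : freqSize (m + k) ≤ 4 * (freqSize m ^ (1 / 2 : ℝ) * freqSize k ^ (1 / 2 : ℝ)) := by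
      have e : ∀ x : ℝ, 2 ^ n ≤ x → (2 ^ n : ℝ) ^ (1 / 2 : ℝ) ≤ x ^ (1 / 2 : ℝ) := fun x hx =>
        Real.rpow_le_rpow (by positivity) hx (by norm_num)
      have e2 : (2 ^ n : ℝ) ^ (1 / 2 : ℝ) * (2 ^ n : ℝ) ^ (1 / 2 : ℝ) = 2 ^ n := by
        rw [← Real.sqrt_eq_rpow, Real.mul_self_sqrt (by positivity)]
      have e3 := mul_le_mul (e _ hm.1) (e _ hk.1) (by positivity) (by positivity)
      rw [e2] at e3
      have e4 := freqSize_add_le m k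
      have e5 : (2 : ℝ) ^ (n + 1) = 2 * 2 ^ n := by ring
      linarith [hm.2, hk.2]
    calc freqSize (m + k) * dirSize τ (m + k)
        ≤ (4 * (freqSize m ^ (1 / 2 : ℝ) * freqSize k ^ (1 / 2 : ℝ))) *
          (dirSize τ m * dirSize τ k) :=
          mul_le_mul h1 (dirSize_add_le τ m k) q3.le (by positivity)
      _ = _ := by ring
  · have hsum1 : ∑ A ∈ freqBlock n + freqBlock n,
        (freqSize A ^ (1 + η) * dirSize τ A ^ (1 + η))⁻¹ ≤ W := by
      refine le_trans (le_of_eq (Finset.sum_congr rfl fun A _ => ?_))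
        (hS.sum_le_tsum _ fun A _ => hpos A)
      rw [mul_inv, Real.rpow_neg (freqSize_pos A).le, Real.rpow_neg (dirSize_pos τ A).le]
    have hsum2 : ∑ m ∈ freqBlock n, ‖c m‖ ^ 2 *
        (2 * freqSize m ^ (1 / 2 : ℝ) * dirSize τ m) ^ (1 + η) * freqSize m ^ η ≤
        D * W * (2 : ℝ) ^ (-(1 / 4) * n : ℝ) := by
      have hterm : ∀ m ∈ freqBlock n, ‖c m‖ ^ 2 *
          (2 * freqSize m ^ (1 / 2 : ℝ) * dirSize τ m) ^ (1 + η) * freqSize m ^ η ≤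
          D * (2 : ℝ) ^ (-(1 / 4) * n : ℝ) *
            (freqSize m ^ (-(1 + η)) * dirSize τ m ^ (-(1 + η))) := by
        intro m hm
        rw [mem_freqBlock] at hm
        have p1 := freqSize_pos m
        have q1 := dirSize_pos τ m
        have e1 : dirSize τ m ^ (2 * η) ≤ T ^ (2 * η) * freqSize m ^ (2 * η) := by
          rw [← Real.mul_rpow hT0 p1.le]
          exact Real.rpow_le_rpow q1.le (dirSize_le τ m) (by norm_num [hη])
        have e2 : freqSize m ^ (-(1 / 4) : ℝ) ≤ (2 : ℝ) ^ (-(1 / 4) * n : ℝ) := by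
          rw [mul_comm, Real.rpow_mul two_pos.le, Real.rpow_natCast]
          exact Real.rpow_le_rpow_of_nonpos (by positivity) hm.1 (by norm_num)
        calc _ ≤ (B ^ 2 * (freqSize m ^ (-2 : ℝ) * dirSize τ m ^ (-2 : ℝ))) *
              (2 * freqSize m ^ (1 / 2 : ℝ) * dirSize τ m) ^ (1 + η) * freqSize m ^ η := by
              gcongr; exact hc.norm_sq_le m
          _ = B ^ 2 * 2 ^ (1 + η) * (freqSize m ^ (-2 : ℝ) * freqSize m ^ ((1 / 2) * (1 + η)) *
              freqSize m ^ η) * (dirSize τ m ^ (-2 : ℝ) * dirSize τ m ^ (1 + η)) := by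
              rw [Real.mul_rpow (by positivity) q1.le, Real.mul_rpow two_pos.le (by positivity),
                ← Real.rpow_mul p1.le]
              ring
          _ = B ^ 2 * 2 ^ (1 + η) * (freqSize m ^ (-(1 / 4) : ℝ) * freqSize m ^ (-(1 + η)) *
              freqSize m ^ (-(2 * η))) * (dirSize τ m ^ (-(1 + η)) * dirSize τ m ^ (2 * η)) := by
              congr 1
              · congr 1
                rw [← Real.rpow_add p1, ← Real.rpow_add p1, ← Real.rpow_add p1,
                  ← Real.rpow_add p1]
                congr 1; norm_num [hη]
              · rw [← Real.rpow_add q1, ← Real.rpow_add q1]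
                congr 1; ring
          _ ≤ B ^ 2 * 2 ^ (1 + η) * ((2 : ℝ) ^ (-(1 / 4) * n : ℝ) * freqSize m ^ (-(1 + η)) *
              freqSize m ^ (-(2 * η))) *
              (dirSize τ m ^ (-(1 + η)) * (T ^ (2 * η) * freqSize m ^ (2 * η))) := by
              gcongr
          _ = D * (2 : ℝ) ^ (-(1 / 4) * n : ℝ) *
            (freqSize m ^ (-(1 + η)) * dirSize τ m ^ (-(1 + η))) *
              (freqSize m ^ (-(2 * η)) * freqSize m ^ (2 * η)) := by
              rw [hD]; ring
          _ = _ := by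
              rw [← Real.rpow_add p1, neg_add_cancel, Real.rpow_zero, mul_one]
      refine (Finset.sum_le_sum hterm).trans ?_
      rw [← Finset.mul_sum]
      calc _ ≤ D * (2 : ℝ) ^ (-(1 / 4) * n : ℝ) * W := by
            gcongr
            exact hS.sum_le_tsum _ fun A _ => hpos A
        _ = _ := by ring
    have hsum0 : 0 ≤ ∑ m ∈ freqBlock n, ‖c m‖ ^ 2 *
        (2 * freqSize m ^ (1 / 2 : ℝ) * dirSize τ m) ^ (1 + η) * freqSize m ^ η := by
      refine Finset.sum_nonneg fun m _ => ?_
      have p1 := freqSize_pos m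
      have q1 := dirSize_pos τ m
      positivity
    calc _ ≤ C * (W * (D * W * (2 : ℝ) ^ (-(1 / 4) * n : ℝ)) ^ 2) := by
          gcongr
      _ = C * (W * (D * W) ^ 2) * ((2 : ℝ) ^ (-(1 / 4) * n : ℝ)) ^ 2 := by ring
      _ = _ := by
          rw [← Real.rpow_mul_natCast two_pos.le]
          congr 2; push_cast; ring

theorem trigPoly_add_sub (F : Finset (Fin 2 → ℤ)) (c : (Fin 2 → ℤ) → ℂ) (t : ℝ) (x h : Torus2) :
    trigPoly F (evolveCoeff t c) (x + h) - trigPoly F (evolveCoeff t c) x =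
      trigPoly F (evolveCoeff t fun m => c m * (UnitAddTorus.mFourier m h - 1)) x := by
  simp only [trigPoly_apply, evolveCoeff, mFourier_add_apply, ← Finset.sum_sub_distrib]
  exact Finset.sum_congr rfl fun m _ => by ring

theorem lintegral_sub_pow_four_le {τ : Fin 2 → ℝ} (hτ : τ ≠ 0) {B : ℝ} {c : (Fin 2 → ℤ) → ℂ}
    (hc : DirDecay τ B c) {ε : ℝ} (hε : 0 < ε) (hε' : ε ≤ 1 / 2) : ∃ C : ℝ, 0 ≤ C ∧
      ∀ (a : ℝ) (F : Finset (Fin 2 → ℤ)) (h : Torus2),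
      ∫⁻ t, ∫⁻ x, ‖trigPoly F (evolveCoeff t c) (x + h) - trigPoly F (evolveCoeff t c) x‖ₑ ^ 4
        ∂torusMeasure ∂periodMeasure a ≤ ENNReal.ofReal (C * ‖h‖ ^ (2 - 4 * ε)) := by
  obtain ⟨C, hC, hL⟩ := lintegral_trigPoly_pow_four_le hε
  have hS := summable_freqSize_dirSize hτ (by linarith : 1 < 1 + ε)
  set W := ∑' m : Fin 2 → ℤ, freqSize m ^ (-(1 + ε)) * dirSize τ m ^ (-(1 + ε)) with hW
  have hpos : ∀ m : Fin 2 → ℤ, 0 ≤ freqSize m ^ (-(1 + ε)) * dirSize τ m ^ (-(1 + ε)) :=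
    fun m => mul_nonneg (Real.rpow_nonneg (freqSize_pos m).le _)
      (Real.rpow_nonneg (dirSize_pos τ m).le _)
  have hW0 : 0 ≤ W := tsum_nonneg hpos
  refine ⟨C * (B ^ 2 * (2 * Real.pi) ^ 2 * W) ^ 2, by positivity, fun a F h => ?_⟩
  simp only [trigPoly_add_sub]
  refine (hL a F _).trans (ENNReal.ofReal_le_ofReal ?_)
  have hsum : ∑ m ∈ F, ‖c m * (UnitAddTorus.mFourier m h - 1)‖ ^ 2 * freqSize m ^ ε ≤
      B ^ 2 * (2 * Real.pi) ^ 2 * ‖h‖ ^ (1 - 2 * ε) * W := by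
    have hterm : ∀ m ∈ F, ‖c m * (UnitAddTorus.mFourier m h - 1)‖ ^ 2 * freqSize m ^ ε ≤
        B ^ 2 * (2 * Real.pi) ^ 2 * ‖h‖ ^ (1 - 2 * ε) *
          (freqSize m ^ (-(1 + ε)) * dirSize τ m ^ (-(1 + ε))) := by
      intro m _
      have p1 := freqSize_pos m
      have q1 := dirSize_pos τ m
      have e1 : ‖UnitAddTorus.mFourier m h - 1‖ ^ 2 ≤
          (2 * Real.pi) ^ 2 * (freqSize m ^ (1 - 2 * ε) * ‖h‖ ^ (1 - 2 * ε)) := by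
        have := pow_le_pow_left₀ (norm_nonneg _) (norm_mFourier_sub_one_le_rpow m h
          (by linarith : 0 ≤ 1 / 2 - ε) (by linarith)) 2
        refine this.trans_eq ?_
        rw [mul_pow, ← Real.rpow_mul_natCast (by positivity), Real.mul_rpow p1.le (norm_nonneg h)]
        congr 3 <;> (push_cast; ring)
      have e2 : dirSize τ m ^ (-2 : ℝ) ≤ dirSize τ m ^ (-(1 + ε)) :=
        Real.rpow_le_rpow_of_exponent_le (one_le_dirSize τ m) (by linarith)
      rw [norm_mul, mul_pow]
      calc _ ≤ (B ^ 2 * (freqSize m ^ (-2 : ℝ) * dirSize τ m ^ (-(1 + ε)))) *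
            ((2 * Real.pi) ^ 2 * (freqSize m ^ (1 - 2 * ε) * ‖h‖ ^ (1 - 2 * ε))) *
              freqSize m ^ ε := by
            gcongr
            exact (hc.norm_sq_le m).trans (by gcongr)
        _ = B ^ 2 * (2 * Real.pi) ^ 2 * ‖h‖ ^ (1 - 2 * ε) * ((freqSize m ^ (-2 : ℝ) *
            freqSize m ^ (1 - 2 * ε) * freqSize m ^ ε) * dirSize τ m ^ (-(1 + ε))) := by ring
        _ = _ := by
            rw [← Real.rpow_add p1, ← Real.rpow_add p1]
            congr 3; ring_nf
    refine (Finset.sum_le_sum hterm).trans ?_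
    rw [← Finset.mul_sum]
    gcongr
    exact hS.sum_le_tsum _ fun A _ => hpos A
  have hsum0 : 0 ≤ ∑ m ∈ F, ‖c m * (UnitAddTorus.mFourier m h - 1)‖ ^ 2 * freqSize m ^ ε :=
    Finset.sum_nonneg fun m _ => mul_nonneg (sq_nonneg _) (Real.rpow_nonneg (freqSize_pos m).le _)
  calc _ ≤ C * (B ^ 2 * (2 * Real.pi) ^ 2 * ‖h‖ ^ (1 - 2 * ε) * W) ^ 2 := by gcongr
    _ = C * (B ^ 2 * (2 * Real.pi) ^ 2 * W) ^ 2 * (‖h‖ ^ (1 - 2 * ε)) ^ 2 := by ring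
    _ = _ := by
        rw [← Real.rpow_mul_natCast (norm_nonneg h)]
        congr 2; push_cast; ring

/-! ### Regularity of the evolution for almost every time -/

/-- The translation by `2 ^ (-k)` in the `i`-th coordinate direction. -/
noncomputable def dyadicShift (k : ℕ) (i : Fin 2) : Torus2 :=
  Pi.single i (((1 / 2 : ℝ) ^ k : ℝ) : UnitAddCircle)

theorem norm_dyadicShift_le (k : ℕ) (i : Fin 2) : ‖dyadicShift k i‖ ≤ (1 / 2) ^ k := by
  rw [dyadicShift, Pi.norm_single]
  rw [UnitAddCircle.norm_eq]
  refine (round_le _ 0).trans_eq ?_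
  rw [Int.cast_zero, sub_zero, abs_of_nonneg (by positivity)]

/-- Hölder regularity of some positive order together with regularity of order `1/2 - ε` in the
sense of `L⁴`, for all `ε > 0`. -/
structure AlmostHalfRegular {E : Type*} [NormedAddCommGroup E] (v : Torus2 → E) : Prop where
  holder : ∃ C ρ : ℝ, 0 ≤ C ∧ 0 < ρ ∧ ρ < 1 ∧
    ∀ (n : ℕ) (x y : Torus2), dist x y ≤ (1 / 16) ^ n → ‖v x - v y‖ ≤ C * ρ ^ n
  modulus : ∀ ε : ℝ, 0 < ε → ∃ C : ℝ, 0 ≤ C ∧ ∀ (k : ℕ) (i : Fin 2),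
    ∫⁻ x, ‖v (x + dyadicShift k i) - v x‖ₑ ^ 4 ∂torusMeasure ≤
      ENNReal.ofReal (C * ((2 : ℝ) ^ (-(2 - ε))) ^ k)

theorem ae_exists_le_geometric {Ω : Type*} [MeasurableSpace Ω] {ν : Measure Ω}
    {f : ℕ → Ω → ℝ≥0∞} (hf : ∀ n, Measurable (f n)) {C q r : ℝ} (hq : 0 < q)
    (hqr : q < r) (h : ∀ n, ∫⁻ ω, f n ω ∂ν ≤ ENNReal.ofReal (C * q ^ n)) :
    ∀ᵐ ω ∂ν, ∃ D : ℝ, 0 ≤ D ∧ ∀ n, f n ω ≤ ENNReal.ofReal (D * r ^ n) := by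
  have hr : 0 < r := hq.trans hqr
  have hlt : q / r < 1 := (div_lt_one hr).2 hqr
  have hfin : ∫⁻ ω, ∑' n, ENNReal.ofReal ((r ^ n)⁻¹) * f n ω ∂ν ≠ ∞ := by
    rw [lintegral_tsum fun n => ((hf n).const_mul _).aemeasurable]
    have hle : ∀ n, ∫⁻ ω, ENNReal.ofReal ((r ^ n)⁻¹) * f n ω ∂ν ≤
        ENNReal.ofReal (C * (q / r) ^ n) := fun n => by
      rw [lintegral_const_mul _ (hf n)]
      refine (mul_le_mul_right (h n) _).trans_eq ?_
      rw [← ENNReal.ofReal_mul (by positivity)]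
      congr 1; rw [div_pow]; field_simp
    refine ne_top_of_le_ne_top ?_ (ENNReal.tsum_le_tsum hle)
    exact ((summable_geometric_of_lt_one (by positivity) hlt).mul_left C).tsum_ofReal_ne_top
  filter_upwards [ae_lt_top (by fun_prop) hfin] with ω hω
  refine ⟨(∑' n, ENNReal.ofReal ((r ^ n)⁻¹) * f n ω).toReal, ENNReal.toReal_nonneg, fun n => ?_⟩
  rw [ENNReal.ofReal_mul ENNReal.toReal_nonneg, ENNReal.ofReal_toReal hω.ne]
  calc f n ω = ENNReal.ofReal ((r ^ n)⁻¹) * f n ω * ENNReal.ofReal (r ^ n) := by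
        rw [mul_right_comm, ← ENNReal.ofReal_mul (by positivity),
          inv_mul_cancel₀ (by positivity), ENNReal.ofReal_one, one_mul]
    _ ≤ _ := mul_le_mul_left (ENNReal.le_tsum (f := fun n => ENNReal.ofReal ((r ^ n)⁻¹) * f n ω) n) _

/-- The Fourier coefficients of a function on the torus. -/
noncomputable def torusCoeff (f : Torus2 → ℂ) (m : Fin 2 → ℤ) : ℂ :=
  ∫ x, UnitAddTorus.mFourier (-m) x * f x ∂torusMeasure

theorem integrable_torus {E : Type*} [NormedAddCommGroup E] {f : Torus2 → E}
    (hf : Continuous f) : Integrable f torusMeasure :=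
  hf.integrable_of_hasCompactSupport (HasCompactSupport.of_compactSpace _)

theorem torusCoeff_sum {ι : Type*} (s : Finset ι) (f : ι → C(Torus2, ℂ)) (m : Fin 2 → ℤ) :
    torusCoeff (fun x => ∑ i ∈ s, f i x) m = ∑ i ∈ s, torusCoeff (f i) m := by
  simp only [torusCoeff, Finset.mul_sum]
  exact integral_finsetSum _ fun i _ => integrable_torus (by fun_prop)

theorem torusCoeff_trigPoly {F : Finset (Fin 2 → ℤ)} (c : (Fin 2 → ℤ) → ℂ) {m : Fin 2 → ℤ}
    (hm : m ∈ F) : torusCoeff (trigPoly F c) m = c m := by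
  have e : ∀ k, torusCoeff (fun x => c k * UnitAddTorus.mFourier k x) m =
      if k = m then c m else 0 := by
    intro k
    have h1 : ∀ x, UnitAddTorus.mFourier (-m) x * (c k * UnitAddTorus.mFourier k x) =
        c k * UnitAddTorus.mFourier (k - m) x := fun x => by
      rw [sub_eq_add_neg, UnitAddTorus.mFourier_add]; ring
    simp only [torusCoeff, h1, integral_const_mul]
    split_ifs with h
    · subst h
      simp [UnitAddTorus.mFourier_zero]
    · rw [integral_mFourier (sub_ne_zero.2 h), mul_zero]
  have h2 := torusCoeff_sum F (fun k => c k • UnitAddTorus.mFourier k) m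
  simp only [ContinuousMap.coe_smul, Pi.smul_def, smul_eq_mul, e] at h2
  have h3 : (trigPoly F c : Torus2 → ℂ) = fun x => ∑ k ∈ F, c k * UnitAddTorus.mFourier k x :=
    funext fun x => trigPoly_apply F c x
  rw [h3, h2, Finset.sum_ite_eq' F m, if_pos hm]

theorem norm_torusCoeff_sub_le (f g : C(Torus2, ℂ)) (m : Fin 2 → ℤ) :
    ‖torusCoeff f m - torusCoeff g m‖ ≤ ‖f - g‖ := by
  rw [torusCoeff, torusCoeff, ← integral_sub (integrable_torus (by fun_prop))
    (integrable_torus (by fun_prop))]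
  refine (norm_integral_le_of_norm_le_const (C := ‖f - g‖) (ae_of_all _ fun x => ?_)).trans ?_
  · rw [← mul_sub, norm_mul, norm_mFourier_apply, one_mul]
    exact (f - g).norm_coe_le_norm x
  · simp

theorem continuous_trigPoly_evolveCoeff (F : Finset (Fin 2 → ℤ)) (c : (Fin 2 → ℤ) → ℂ) :
    Continuous fun t => trigPoly F (evolveCoeff t c) := by
  unfold trigPoly evolveCoeff
  have := continuous_schrodingerMultiplier
  fun_prop

theorem measurable_lintegral_trigPoly_sub (F : Finset (Fin 2 → ℤ)) (c : (Fin 2 → ℤ) → ℂ)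
    (h : Torus2) : Measurable fun t => ∫⁻ x, ‖trigPoly F (evolveCoeff t c) (x + h) -
      trigPoly F (evolveCoeff t c) x‖ₑ ^ 4 ∂torusMeasure := by
  have hc : Continuous fun p : ℝ × Torus2 => trigPoly F (evolveCoeff p.1 c) (p.2 + h) -
      trigPoly F (evolveCoeff p.1 c) p.2 := by
    simp only [trigPoly_apply, evolveCoeff]
    have := continuous_schrodingerMultiplier
    fun_prop
  exact Measurable.lintegral_prod_right' (ν := torusMeasure)
    (hc.enorm.measurable.pow_const 4)

theorem DirDecay.norm_le {τ : Fin 2 → ℝ} {B : ℝ} {c : (Fin 2 → ℤ) → ℂ} (h : DirDecay τ B c)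
    (m : Fin 2 → ℤ) : ‖c m‖ ≤ |B| := by
  refine (h m).trans ?_
  have h1 : freqSize m ^ (-1 : ℝ) ≤ 1 :=
    Real.rpow_le_one_of_one_le_of_nonpos (one_le_freqSize m) (by norm_num)
  have h2 : dirSize τ m ^ (-1 : ℝ) ≤ 1 :=
    Real.rpow_le_one_of_one_le_of_nonpos (one_le_dirSize τ m) (by norm_num)
  have h3 := Real.rpow_nonneg (freqSize_pos m).le (-1)
  have h4 := Real.rpow_nonneg (dirSize_pos τ m).le (-1)
  have h5 : freqSize m ^ (-1 : ℝ) * dirSize τ m ^ (-1 : ℝ) ≤ 1 := mul_le_one₀ h1 h4 h2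
  calc B * (freqSize m ^ (-1 : ℝ) * dirSize τ m ^ (-1 : ℝ))
      ≤ |B| * (freqSize m ^ (-1 : ℝ) * dirSize τ m ^ (-1 : ℝ)) := by
        gcongr; exact le_abs_self B
    _ ≤ |B| * 1 := by gcongr
    _ = |B| := mul_one _

theorem norm_trigPoly_freqBall_sub_le {B : ℝ} {c : (Fin 2 → ℤ) → ℂ} (hc : ∀ m, ‖c m‖ ≤ B)
    (n : ℕ) {x y : Torus2} (hxy : dist x y ≤ (1 / 16) ^ n) :
    ‖trigPoly (freqBall n) c x - trigPoly (freqBall n) c y‖ ≤ 32 * Real.pi * B * (1 / 2) ^ n := by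
  have hB : 0 ≤ B := (norm_nonneg _).trans (hc 0)
  rw [trigPoly_apply, trigPoly_apply, ← Finset.sum_sub_distrib]
  refine (norm_sum_le _ _).trans ?_
  have hterm : ∀ m ∈ freqBall n, ‖c m * UnitAddTorus.mFourier m x -
      c m * UnitAddTorus.mFourier m y‖ ≤ B * (2 * Real.pi * (2 ^ n * (1 / 16) ^ n)) := by
    intro m hm
    have e : UnitAddTorus.mFourier m x =
        UnitAddTorus.mFourier m y * UnitAddTorus.mFourier m (x - y) := by
      rw [← mFourier_add_apply, add_sub_cancel]
    rw [e, ← mul_sub, ← mul_sub_one, norm_mul, norm_mul, norm_mFourier_apply, one_mul]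
    have h1 := norm_mFourier_sub_one_le m (x - y)
    rw [dist_eq_norm] at hxy
    have h2 := (mem_freqBall.1 hm).le
    have := freqSize_pos m
    have := Real.pi_pos
    refine mul_le_mul (hc m) (h1.trans ?_) (norm_nonneg _) hB
    gcongr
  refine (Finset.sum_le_card_nsmul _ _ _ hterm).trans ?_
  rw [nsmul_eq_mul]
  have := Real.pi_pos
  calc _ ≤ (16 * 4 ^ n) * (B * (2 * Real.pi * (2 ^ n * (1 / 16) ^ n))) := by
        gcongr; exact card_freqBall_le n
    _ = 32 * Real.pi * B * (4 ^ n * 2 ^ n * (1 / 16) ^ n) := by ring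
    _ = _ := by rw [← mul_pow, ← mul_pow]; norm_num

/-- Convergence of the dyadic partial sums gives a limit with the right coefficients. -/
theorem exists_limit_of_norm_block_le {B : ℝ} {c : (Fin 2 → ℤ) → ℂ} (hc : ∀ m, ‖c m‖ ≤ B)
    {D ρ : ℝ} (hD : 0 ≤ D) (hρ : 1 / 2 ≤ ρ) (hρ1 : ρ < 1)
    (h : ∀ n, ‖trigPoly (freqBlock n) c‖ ≤ D * ρ ^ n) :
    ∃ v : C(Torus2, ℂ), (∀ m, torusCoeff v m = c m) ∧
      Tendsto (fun n => trigPoly (freqBall n) c) atTop (𝓝 v) ∧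
      ∃ C : ℝ, 0 ≤ C ∧ ∀ (n : ℕ) (x y : Torus2), dist x y ≤ (1 / 16) ^ n →
        ‖v x - v y‖ ≤ C * ρ ^ n := by
  have hρ0 : 0 < ρ := by linarith
  have hB : 0 ≤ B := (norm_nonneg _).trans (hc 0)
  have hgeo : Summable fun n : ℕ => D * ρ ^ n :=
    (summable_geometric_of_lt_one hρ0.le hρ1).mul_left D
  have hs : Summable fun n => trigPoly (freqBlock n) c := Summable.of_norm_bounded hgeo h
  set v := ∑' n, trigPoly (freqBlock n) c with hv
  have htend : Tendsto (fun n => trigPoly (freqBall n) c) atTop (𝓝 v) := by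
    simp only [trigPoly_freqBall]
    exact hs.hasSum.tendsto_sum_nat
  have htail : ∀ n, ‖v - trigPoly (freqBall n) c‖ ≤ D / (1 - ρ) * ρ ^ n := by
    intro n
    rw [trigPoly_freqBall, hv, ← hs.sum_add_tsum_nat_add n, add_sub_cancel_left]
    have h1 : HasSum (fun k : ℕ => D * ρ ^ (k + n)) (D / (1 - ρ) * ρ ^ n) := by
      have := ((hasSum_geometric_of_lt_one hρ0.le hρ1).mul_left (D * ρ ^ n))
      have e1 : (fun k : ℕ => D * ρ ^ (k + n)) = fun k => D * ρ ^ n * ρ ^ k := by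
        funext k; rw [pow_add]; ring
      have e2 : D / (1 - ρ) * ρ ^ n = D * ρ ^ n * (1 - ρ)⁻¹ := by rw [div_eq_mul_inv]; ring
      rw [e1, e2]
      exact this
    exact tsum_of_norm_bounded h1 fun k => h (k + n)
  refine ⟨v, fun m => ?_, htend, 32 * Real.pi * B + 2 * (D / (1 - ρ)), ?_, fun n x y hxy => ?_⟩
  · have h1 : Tendsto (fun n => torusCoeff (trigPoly (freqBall n) c) m) atTop
        (𝓝 (torusCoeff v m)) := by
      rw [tendsto_iff_norm_sub_tendsto_zero]
      refine squeeze_zero (fun _ => norm_nonneg _) (fun n => norm_torusCoeff_sub_le _ _ m) ?_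
      exact tendsto_iff_norm_sub_tendsto_zero.1 htend
    obtain ⟨N, hN⟩ := pow_unbounded_of_one_lt (freqSize m) one_lt_two
    have h2 : ∀ᶠ n in atTop, torusCoeff (trigPoly (freqBall n) c) m = c m := by
      filter_upwards [eventually_ge_atTop N] with n hn
      exact torusCoeff_trigPoly c (freqBall_mono hn (mem_freqBall.2 hN))
    exact tendsto_nhds_unique (h1.congr' h2) tendsto_const_nhds |>.symm ▸ rfl
  · have : 0 ≤ D / (1 - ρ) := div_nonneg hD (by linarith)
    have := Real.pi_pos
    positivity
  · have h1 := norm_trigPoly_freqBall_sub_le hc n hxy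
    have h2 := ((v - trigPoly (freqBall n) c).norm_coe_le_norm x).trans (htail n)
    have h3 := ((v - trigPoly (freqBall n) c).norm_coe_le_norm y).trans (htail n)
    have h4 : v x - v y = (v - trigPoly (freqBall n) c) x - (v - trigPoly (freqBall n) c) y +
        (trigPoly (freqBall n) c x - trigPoly (freqBall n) c y) := by
      simp only [ContinuousMap.sub_apply]; ring
    rw [h4]
    refine (norm_add_le _ _).trans ?_
    have h5 := norm_sub_le ((v - trigPoly (freqBall n) c) x) ((v - trigPoly (freqBall n) c) y)
    have h6 : (1 / 2 : ℝ) ^ n ≤ ρ ^ n := pow_le_pow_left₀ (by norm_num) hρ n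
    have h7 : 32 * Real.pi * B * (1 / 2) ^ n ≤ 32 * Real.pi * B * ρ ^ n := by
      have := Real.pi_pos
      gcongr
    linarith

theorem lintegral_sub_le_liminf {V : ℕ → C(Torus2, ℂ)} {v : C(Torus2, ℂ)}
    (hV : Tendsto V atTop (𝓝 v)) (h : Torus2) :
    ∫⁻ x, ‖v (x + h) - v x‖ₑ ^ 4 ∂torusMeasure ≤
      liminf (fun n => ∫⁻ x, ‖V n (x + h) - V n x‖ₑ ^ 4 ∂torusMeasure) atTop := by
  have hp : ∀ x, Tendsto (fun n => V n x) atTop (𝓝 (v x)) := fun x =>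
    ((continuous_eval_const (F := C(Torus2, ℂ)) x).tendsto v).comp hV
  have hlim : ∀ x, ‖v (x + h) - v x‖ₑ ^ 4 =
      liminf (fun n => ‖V n (x + h) - V n x‖ₑ ^ 4) atTop := fun x =>
    (ENNReal.Tendsto.pow ((hp (x + h)).sub (hp x)).enorm).liminf_eq.symm
  simp only [hlim]
  exact lintegral_liminf_le fun n => by fun_prop

/-- Coefficients that decay as those of a segment: for almost every time the evolution is
continuous, with regularity of order almost `1/2`. -/
theorem ae_exists_regular_evolution {τ : Fin 2 → ℝ} (hτ : τ ≠ 0) {B : ℝ} {c : (Fin 2 → ℤ) → ℂ}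
    (hc : DirDecay τ B c) :
    ∀ᵐ t : ℝ, ∃ v : C(Torus2, ℂ), (∀ m, torusCoeff v m = evolveCoeff t c m) ∧
      AlmostHalfRegular v := by
  refine ae_of_ae_periodMeasure fun a => ?_
  obtain ⟨C, hC0, hC⟩ := lintegral_norm_block_le hτ hc
  set ρ : ℝ := 2 ^ (-(1 / 16) : ℝ) with hρ
  have hρ0 : 0 < ρ := by positivity
  have hρ1 : ρ < 1 := Real.rpow_lt_one_of_one_lt_of_neg one_lt_two (by norm_num)
  have hρ2 : 1 / 2 ≤ ρ := by
    have : (1 / 2 : ℝ) = 2 ^ (-1 : ℝ) := by rw [Real.rpow_neg_one]; norm_num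
    rw [this]
    exact Real.rpow_le_rpow_of_exponent_le one_le_two (by norm_num)
  have hA : ∀ᵐ t ∂periodMeasure a, ∃ D : ℝ, 0 ≤ D ∧
      ∀ n, ‖trigPoly (freqBlock n) (evolveCoeff t c)‖ₑ ^ 4 ≤ ENNReal.ofReal (D * (ρ ^ 4) ^ n) := by
    refine ae_exists_le_geometric (C := C) (q := 2 ^ (-(1 / 2) : ℝ))
      (fun n => (continuous_trigPoly_evolveCoeff _ c).enorm.measurable.pow_const 4)
      (by positivity) ?_ fun n => ?_
    · rw [hρ, ← Real.rpow_mul_natCast two_pos.le]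
      exact Real.rpow_lt_rpow_of_exponent_lt one_lt_two (by norm_num)
    · refine (hC a n).trans_eq ?_
      rw [Real.rpow_mul two_pos.le, Real.rpow_natCast]
  have hM : ∀ᵐ t ∂periodMeasure a, ∀ (j : ℕ) (i : Fin 2), ∃ D : ℝ, 0 ≤ D ∧
      ∀ k, liminf (fun n => ∫⁻ x, ‖trigPoly (freqBall n) (evolveCoeff t c) (x + dyadicShift k i) -
        trigPoly (freqBall n) (evolveCoeff t c) x‖ₑ ^ 4 ∂torusMeasure) atTop ≤
          ENNReal.ofReal (D * ((2 : ℝ) ^ (-(2 - 5 / (j + 2 : ℝ)))) ^ k) := by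
    rw [ae_all_iff]
    intro j
    rw [ae_all_iff]
    intro i
    have hj : (0 : ℝ) < j + 2 := by positivity
    obtain ⟨K, hK0, hK⟩ := lintegral_sub_pow_four_le hτ hc (ε := 1 / (j + 2 : ℝ)) (by positivity)
      (one_div_le_one_div_of_le two_pos (by linarith [(Nat.cast_nonneg j : (0 : ℝ) ≤ j)]))
    refine ae_exists_le_geometric (C := K) (q := 2 ^ (-(2 - 4 * (1 / (j + 2 : ℝ)))))
      (fun k => Measurable.liminf fun n => measurable_lintegral_trigPoly_sub _ c _)
      (by positivity) ?_ fun k => ?_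
    · refine Real.rpow_lt_rpow_of_exponent_lt one_lt_two ?_
      have : 0 < 1 / (j + 2 : ℝ) := by positivity
      have e : 5 / (j + 2 : ℝ) = 5 * (1 / (j + 2 : ℝ)) := by ring
      rw [e]; linarith
    · refine (lintegral_liminf_le fun n => measurable_lintegral_trigPoly_sub _ c _).trans ?_
      have hle : ∀ n, ∫⁻ t, ∫⁻ x, ‖trigPoly (freqBall n) (evolveCoeff t c) (x + dyadicShift k i) -
          trigPoly (freqBall n) (evolveCoeff t c) x‖ₑ ^ 4 ∂torusMeasure ∂periodMeasure a ≤
          ENNReal.ofReal (K * ((2 : ℝ) ^ (-(2 - 4 * (1 / (j + 2 : ℝ))))) ^ k) := by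
        intro n
        refine (hK a (freqBall n) (dyadicShift k i)).trans (ENNReal.ofReal_le_ofReal ?_)
        gcongr
        have h2 : 0 ≤ 2 - 4 * (1 / (j + 2 : ℝ)) := by
          have : 1 / (j + 2 : ℝ) ≤ 1 / 2 :=
            one_div_le_one_div_of_le two_pos (by linarith [(Nat.cast_nonneg j : (0 : ℝ) ≤ j)])
          linarith
        refine (Real.rpow_le_rpow (norm_nonneg _) (norm_dyadicShift_le k i) h2).trans_eq ?_
        rw [← Real.rpow_natCast, ← Real.rpow_mul (by norm_num), ← Real.rpow_natCast,
          ← Real.rpow_mul two_pos.le, one_div, Real.inv_rpow two_pos.le, ← Real.rpow_neg two_pos.le]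
        congr 1; ring
      calc liminf (fun n => ∫⁻ t, ∫⁻ x, ‖trigPoly (freqBall n) (evolveCoeff t c)
            (x + dyadicShift k i) - trigPoly (freqBall n) (evolveCoeff t c) x‖ₑ ^ 4
            ∂torusMeasure ∂periodMeasure a) atTop
          ≤ liminf (fun _ : ℕ => ENNReal.ofReal
              (K * ((2 : ℝ) ^ (-(2 - 4 * (1 / (j + 2 : ℝ))))) ^ k)) atTop :=
            liminf_le_liminf (Eventually.of_forall hle)
        _ = _ := liminf_const _
  filter_upwards [hA, hM] with t ⟨D, hD0, hD⟩ hMt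
  have hnorm : ∀ n, ‖trigPoly (freqBlock n) (evolveCoeff t c)‖ ≤ max 1 D * ρ ^ n := by
    intro n
    have h1 := hD n
    rw [← ofReal_norm, ← ENNReal.ofReal_pow (norm_nonneg _),
      ENNReal.ofReal_le_ofReal_iff (by positivity)] at h1
    refine (pow_le_pow_iff_left₀ (norm_nonneg _) (by positivity) four_ne_zero).1 (h1.trans ?_)
    rw [mul_pow, ← pow_mul, ← pow_mul, mul_comm 4 n]
    gcongr
    calc D ≤ max 1 D := le_max_right _ _
      _ ≤ (max 1 D) ^ 4 := le_self_pow₀ (le_max_left _ _) four_ne_zero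
  obtain ⟨v, hv, htend, E, hE0, hE⟩ := exists_limit_of_norm_block_le
    (fun m => (norm_evolveCoeff t c m).trans_le (hc.norm_le m)) (by positivity) hρ2 hρ1 hnorm
  refine ⟨v, hv, ⟨E, ρ, hE0, hρ0, hρ1, hE⟩, fun ε hε => ?_⟩
  obtain ⟨j, hj⟩ := exists_nat_gt (5 / ε)
  have hj2 : 5 / (j + 2 : ℝ) ≤ ε := by
    have : 0 < 5 / ε := by positivity
    rw [div_le_iff₀ (by positivity)]
    rw [div_lt_iff₀ hε] at hj
    nlinarith
  choose K hK0 hK using hMt j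
  refine ⟨K 0 + K 1, add_nonneg (hK0 0) (hK0 1), fun k i => ?_⟩
  refine (lintegral_sub_le_liminf htend _).trans ((hK i k).trans (ENNReal.ofReal_le_ofReal ?_))
  have hKi : K i ≤ K 0 + K 1 := by
    fin_cases i
    · exact le_add_of_nonneg_right (hK0 1)
    · exact le_add_of_nonneg_left (hK0 0)
  have := hK0 i
  refine mul_le_mul hKi ?_ (by positivity) (add_nonneg (hK0 0) (hK0 1))
  exact pow_le_pow_left₀ (by positivity)
    (Real.rpow_le_rpow_of_exponent_le one_le_two (by linarith)) k

/-! ### Box dimension through dyadic scales -/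

theorem upperBoxDim_le_of_dyadic {X : Type*} [PseudoEMetricSpace X] {E : Set X} {s : ℝ}
    (hs : 0 ≤ s) (h : ∀ δ : ℝ, 0 < δ → ∃ C : ℝ, 0 < C ∧ ∀ n : ℕ,
      ((Metric.externalCoveringNumber ((1 / 2 : ℝ≥0) ^ n) E : ℕ∞) : ℝ≥0∞) ≤
        ENNReal.ofReal (C * (2 : ℝ) ^ ((s + δ) * n))) :
    upperBoxDim E ≤ (s : EReal) := by
  rw [← EReal.le_of_forall_lt_iff_le]
  intro z hz
  have hz' : s < z := by exact_mod_cast hz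
  obtain ⟨δ, hδ, hδz⟩ : ∃ δ : ℝ, 0 < δ ∧ s + 2 * δ = z := ⟨(z - s) / 2, by linarith, by ring⟩
  obtain ⟨C, hC, hN⟩ := h δ hδ
  set M : ℝ := max 1 ((Real.log C + (s + δ) * Real.log 4) / δ) with hM
  have hη : 0 < Real.exp (-M) := Real.exp_pos _
  refine limsup_le_of_le (by isBoundedDefault) ?_
  have hev : ∀ᶠ ε : ℝ≥0 in 𝓝[>] 0, 0 < ε ∧ (ε : ℝ) < Real.exp (-M) := by
    refine eventually_nhdsWithin_iff.2 ?_
    have h1 : ∀ᶠ ε : ℝ≥0 in 𝓝 0, (ε : ℝ) < Real.exp (-M) :=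
      (NNReal.continuous_coe.tendsto (0 : ℝ≥0)).eventually_lt_const (by simpa using hη)
    filter_upwards [h1] with ε h1 h2 using ⟨h2, h1⟩
  filter_upwards [hev] with ε ⟨hε, hεM⟩
  have hε' : 0 < (ε : ℝ) := hε
  have hℓ : M < Real.log (1 / (ε : ℝ)) := by
    rw [one_div, Real.log_inv]
    have := Real.log_lt_log hε' hεM
    rw [Real.log_exp] at this
    linarith
  have hM1 : 1 ≤ M := le_max_left _ _
  have hM2 : Real.log C + (s + δ) * Real.log 4 ≤ δ * M := by
    have := le_max_right 1 ((Real.log C + (s + δ) * Real.log 4) / δ)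
    rw [← hM, div_le_iff₀ hδ] at this
    linarith
  have hε1 : (ε : ℝ) < 1 := hεM.trans_le (by rw [← Real.exp_zero]; gcongr; linarith)
  obtain ⟨n, hn1, hn2⟩ := exists_nat_pow_near_of_lt_one (x := (ε : ℝ) / 2) (y := 1 / 2)
    (by positivity) (by linarith) (by norm_num) (by norm_num)
  have hle : (1 / 2 : ℝ≥0) ^ (n + 1) ≤ ε / 2 := by
    rw [← NNReal.coe_le_coe]; push_cast; exact hn1.le
  have hnl : ((n + 1 : ℕ) : ℝ) * Real.log 2 ≤ Real.log 4 + Real.log (1 / (ε : ℝ)) := by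
    have h1 : (2 : ℝ) ^ (n + 1) ≤ 4 * (1 / (ε : ℝ)) := by
      rw [one_div, pow_succ, ← div_eq_mul_inv, le_div_iff₀ hε']
      have h2 : (1 / 2 : ℝ) ^ n * 2 ^ n = 1 := by rw [← mul_pow]; norm_num
      have h3 : (0 : ℝ) < 2 ^ n := by positivity
      nlinarith
    have h2 := Real.log_le_log (by positivity) h1
    rwa [Real.log_pow, Real.log_mul (by norm_num) (by positivity)] at h2
  have hcov : ((Metric.externalCoveringNumber (ε / 2) E : ℕ∞) : ℝ≥0∞) ≤
      ENNReal.ofReal (C * (2 : ℝ) ^ ((s + δ) * ((n + 1 : ℕ) : ℝ))) :=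
    le_trans (by exact_mod_cast Metric.externalCoveringNumber_anti hle) (hN (n + 1))
  have hlog := ENNReal.log_monotone hcov
  rw [ENNReal.log_ofReal_of_pos (by positivity), Real.log_mul hC.ne' (by positivity),
    Real.log_rpow two_pos] at hlog
  have hpos : (0 : ℝ) < Real.log (1 / (ε : ℝ)) := by linarith
  rw [EReal.div_le_iff_le_mul (by exact_mod_cast hpos) (EReal.coe_ne_top _)]
  refine hlog.trans ?_
  rw [← EReal.coe_mul]
  refine EReal.coe_le_coe_iff.2 ?_
  have h5 : 0 ≤ s + δ := by linarith
  have h6 := mul_le_mul_of_nonneg_left hnl h5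
  have h7 : δ * M ≤ δ * Real.log (1 / (ε : ℝ)) := by gcongr
  rw [← hδz]
  nlinarith

theorem exists_covering_le_of_upperBoxDim_lt {X : Type*} [PseudoEMetricSpace X] {E : Set X} {z : ℝ}
    (hz : 0 ≤ z) (h : upperBoxDim E < (z : EReal)) : ∃ n₀ : ℕ, ∀ n ≥ n₀,
      ((Metric.externalCoveringNumber ((1 / 2 : ℝ≥0) ^ n) E : ℕ∞) : ℝ≥0∞) ≤
        ENNReal.ofReal (((2 : ℝ) ^ z) ^ n) := by
  have hev := eventually_lt_of_limsup_lt h (by isBoundedDefault)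
  have ht : Tendsto (fun n : ℕ => 2 * (1 / 2 : ℝ≥0) ^ n) atTop (𝓝[>] 0) := by
    refine tendsto_nhdsWithin_iff.2 ⟨?_, Eventually.of_forall fun n => ?_⟩
    · have h0 : (1 / 2 : ℝ≥0) < 1 := by rw [← NNReal.coe_lt_coe]; norm_num
      have := (NNReal.tendsto_pow_atTop_nhds_zero_of_lt_one h0).const_mul 2
      rwa [mul_zero] at this
    · exact Set.mem_Ioi.2 (by positivity)
  obtain ⟨n₀, hn₀⟩ := eventually_atTop.1 (ht.eventually hev)
  refine ⟨max n₀ 2, fun n hn => ?_⟩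
  have h1 := hn₀ n (le_of_max_le_left hn)
  have hn2 : 2 ≤ n := le_of_max_le_right hn
  have hn2' : (2 : ℝ) ≤ n := by exact_mod_cast hn2
  have e1 : 2 * (1 / 2 : ℝ≥0) ^ n / 2 = (1 / 2) ^ n := by
    rw [mul_div_right_comm, div_self two_ne_zero, one_mul]
  have e2 : Real.log (1 / ((2 * (1 / 2 : ℝ≥0) ^ n : ℝ≥0) : ℝ)) = (n - 1) * Real.log 2 := by
    push_cast
    rw [one_div, Real.log_inv, Real.log_mul two_ne_zero (by positivity), Real.log_pow, one_div,
      Real.log_inv]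
    ring
  have hl2 : 0 < Real.log 2 := Real.log_pos one_lt_two
  have hpos : 0 < ((n : ℝ) - 1) * Real.log 2 := mul_pos (by linarith) hl2
  rw [e1, e2, EReal.div_lt_iff (by exact_mod_cast hpos) (EReal.coe_ne_top _), ← EReal.coe_mul] at h1
  have h2 : (((z * (((n : ℝ) - 1) * Real.log 2) : ℝ)) : EReal) ≤
      ENNReal.log (ENNReal.ofReal (((2 : ℝ) ^ z) ^ n)) := by
    rw [ENNReal.log_ofReal_of_pos (by positivity), Real.log_pow, Real.log_rpow two_pos]
    refine EReal.coe_le_coe_iff.2 ?_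
    nlinarith [mul_nonneg hz hl2.le]
  exact ENNReal.log_le_log_iff.1 (h1.le.trans h2)

theorem externalCoveringNumber_graph_le {X ι : Type*} [PseudoMetricSpace X] (g : X → ℝ)
    (I : Finset ι) (p : ι → X) (R : ι → ℝ) {r : ℝ≥0} (hr : 0 < r)
    (h : ∀ x, ∃ c ∈ I, dist x (p c) ≤ r ∧ |g x - g (p c)| ≤ R c) :
    ((Metric.externalCoveringNumber r (Set.range fun x => (x, g x)) : ℕ∞) : ℝ≥0∞) ≤
      ∑ c ∈ I, ((⌊R c / r⌋₊ + 1 : ℕ) : ℝ≥0∞) := by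
  classical
  have hr' : (0 : ℝ) < r := hr
  let C : Finset (X × ℝ) := (I.sigma fun c => Finset.range (⌊R c / r⌋₊ + 1)).image
    fun q => (p q.1, g (p q.1) - R q.1 + (2 * q.2 + 1) * r)
  have hC : Metric.IsCover r (Set.range fun x => (x, g x)) (C : Set (X × ℝ)) := by
    rw [Metric.isCover_iff_subset_iUnion_closedBall]
    rintro _ ⟨x, rfl⟩
    obtain ⟨c, hc, hd, hg⟩ := h x
    rw [abs_le] at hg
    have hR : 0 ≤ R c := by linarith
    set s : ℕ := ⌊(g x - g (p c) + R c) / (2 * r)⌋₊ with hs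
    have hz : 0 ≤ (g x - g (p c) + R c) / (2 * r) := div_nonneg (by linarith) (by positivity)
    have hs1 : (s : ℝ) ≤ (g x - g (p c) + R c) / (2 * r) := Nat.floor_le hz
    have hs2 : (g x - g (p c) + R c) / (2 * r) < s + 1 := Nat.lt_floor_add_one _
    rw [le_div_iff₀ (by positivity)] at hs1
    rw [div_lt_iff₀ (by positivity)] at hs2
    have hsR : s < ⌊R c / r⌋₊ + 1 := by
      refine Nat.lt_succ_of_le (Nat.floor_mono ?_)
      rw [div_le_div_iff₀ (by positivity) hr']
      nlinarith
    refine Set.mem_iUnion₂.2 ⟨(p c, g (p c) - R c + (2 * s + 1) * r), ?_, ?_⟩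
    · refine Finset.mem_coe.2 (Finset.mem_image.2 ⟨⟨c, s⟩, ?_, rfl⟩)
      exact Finset.mem_sigma.2 ⟨hc, Finset.mem_range.2 hsR⟩
    · rw [Metric.mem_closedBall, Prod.dist_eq]
      refine max_le hd ?_
      rw [Real.dist_eq, abs_le]
      constructor <;> nlinarith
  have h1 := hC.externalCoveringNumber_le_encard
  rw [Set.encard_coe_eq_coe_finsetCard] at h1
  have h2 : C.card ≤ ∑ c ∈ I, (⌊R c / r⌋₊ + 1) := by
    refine Finset.card_image_le.trans_eq ?_
    rw [Finset.card_sigma]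
    simp
  calc ((Metric.externalCoveringNumber r (Set.range fun x => (x, g x)) : ℕ∞) : ℝ≥0∞)
      ≤ ((C.card : ℕ∞) : ℝ≥0∞) := by exact_mod_cast h1
    _ = ((C.card : ℕ) : ℝ≥0∞) := by simp
    _ ≤ ((∑ c ∈ I, (⌊R c / r⌋₊ + 1) : ℕ) : ℝ≥0∞) := by exact_mod_cast h2
    _ = _ := by push_cast; rfl

/-! ### The upper bound for the dimension of graphs -/

/-- The point `2 ^ (-k) a` of the torus. -/
noncomputable def gridPt (k : ℕ) (a : Fin 2 → ℕ) : Torus2 :=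
  fun i => (((a i : ℝ) * (1 / 2) ^ k : ℝ) : UnitAddCircle)

/-- The indices of the dyadic grid of mesh `2 ^ (-k)`. -/
def gridIdx (k : ℕ) : Finset (Fin 2 → ℕ) := Fintype.piFinset fun _ => Finset.range (2 ^ k)

theorem card_gridIdx (k : ℕ) : (gridIdx k).card = 4 ^ k := by
  simp [gridIdx, ← pow_mul, mul_comm k 2]
  rw [pow_mul]; norm_num

theorem mem_gridIdx {k : ℕ} {a : Fin 2 → ℕ} : a ∈ gridIdx k ↔ ∀ i, a i < 2 ^ k := by
  simp [gridIdx]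

theorem gridPt_succ (k : ℕ) (a : Fin 2 → ℕ) : gridPt (k + 1) (fun i => 2 * a i) = gridPt k a := by
  funext i
  simp only [gridPt]
  congr 1
  push_cast; ring

theorem gridPt_add_dyadicShift (k : ℕ) (a : Fin 2 → ℕ) (i : Fin 2) :
    gridPt k a + dyadicShift k i = gridPt k (Function.update a i (a i + 1)) := by
  funext j
  by_cases hj : j = i
  · subst hj
    simp only [gridPt, dyadicShift, Pi.add_apply, Pi.single_eq_same, Function.update_self,
      ← AddCircle.coe_add]
    congr 1
    push_cast; ring
  · simp [gridPt, dyadicShift, hj]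

theorem exists_torus_lift (x : Torus2) :
    ∃ y : Fin 2 → ℝ, (∀ i, 0 ≤ y i ∧ y i < 1) ∧ ∀ i, (y i : UnitAddCircle) = x i := by
  refine ⟨fun i => (AddCircle.equivIco 1 0 (x i) : ℝ), fun i => ?_, fun i => ?_⟩
  · have := (AddCircle.equivIco 1 0 (x i)).2
    simpa using this
  · exact (AddCircle.equivIco 1 0).symm_apply_apply (x i)

theorem dist_gridPt_floor_le {x : Torus2} {y : Fin 2 → ℝ} (hy : ∀ i, 0 ≤ y i ∧ y i < 1)
    (hx : ∀ i, (y i : UnitAddCircle) = x i) (k : ℕ) :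
    dist x (gridPt k fun i => ⌊y i * 2 ^ k⌋₊) ≤ (1 / 2) ^ k := by
  rw [dist_pi_le_iff (by positivity)]
  intro i
  rw [← hx i, gridPt, dist_eq_norm, ← AddCircle.coe_sub, UnitAddCircle.norm_eq]
  refine (round_le _ 0).trans ?_
  rw [Int.cast_zero, sub_zero]
  have h0 : 0 ≤ y i * 2 ^ k := mul_nonneg (hy i).1 (by positivity)
  have h1 := Nat.floor_le h0
  have h2 := Nat.lt_floor_add_one (y i * 2 ^ k)
  have h3 : (2 : ℝ) ^ k * (1 / 2) ^ k = 1 := by rw [← mul_pow]; norm_num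
  have h4 : (0 : ℝ) < (1 / 2) ^ k := by positivity
  have h5 : y i = y i * 2 ^ k * (1 / 2) ^ k := by rw [mul_assoc, h3, mul_one]
  rw [abs_le]
  constructor <;> nlinarith

theorem floor_mul_two_pow_lt {y : ℝ} (hy : 0 ≤ y ∧ y < 1) (k : ℕ) : ⌊y * 2 ^ k⌋₊ < 2 ^ k := by
  rw [Nat.floor_lt (mul_nonneg hy.1 (by positivity))]
  push_cast
  have : (0 : ℝ) < 2 ^ k := by positivity
  nlinarith [hy.2]

theorem floor_mul_two_pow_div (y : ℝ) (n j : ℕ) :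
    ⌊y * 2 ^ (n + j)⌋₊ / 2 ^ j = ⌊y * 2 ^ n⌋₊ := by
  rw [← Nat.floor_div_natCast]
  congr 1
  push_cast
  rw [pow_add, ← mul_assoc, mul_div_assoc, div_self (by positivity), mul_one]

/-- The increment of `f` at a point of the dyadic grid. -/
noncomputable def gridDiff (f : Torus2 → ℝ) (k : ℕ) (a : Fin 2 → ℕ) (i : Fin 2) : ℝ :=
  |f (gridPt k a + dyadicShift k i) - f (gridPt k a)|

theorem abs_sub_gridPt_le (f : Torus2 → ℝ) (k : ℕ) {M : ℝ} (hM : 0 ≤ M) (b : Fin 2 → ℕ)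
    (h0 : gridDiff f (k + 1) (fun i => 2 * (b i / 2)) 0 ≤ M)
    (h1 : gridDiff f (k + 1) ![b 0, 2 * (b 1 / 2)] 1 ≤ M) :
    |f (gridPt (k + 1) b) - f (gridPt k fun i => b i / 2)| ≤ 2 * M := by
  rw [← gridPt_succ k fun i => b i / 2]
  unfold gridDiff at h0 h1
  rw [gridPt_add_dyadicShift] at h0 h1
  have e0 : (Function.update (fun i => 2 * (b i / 2)) 0 (2 * (b 0 / 2) + 1) : Fin 2 → ℕ) =
      ![2 * (b 0 / 2) + 1, 2 * (b 1 / 2)] := by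
    funext i; fin_cases i <;> simp
  have e1 : (Function.update ![b 0, 2 * (b 1 / 2)] 1 (2 * (b 1 / 2) + 1) : Fin 2 → ℕ) =
      ![b 0, 2 * (b 1 / 2) + 1] := by
    funext i; fin_cases i <;> simp
  simp only [Matrix.cons_val_one, Matrix.cons_val_fin_one] at h1
  rw [e0] at h0
  rw [e1] at h1
  have e2 : (fun i => 2 * (b i / 2) : Fin 2 → ℕ) = ![2 * (b 0 / 2), 2 * (b 1 / 2)] := by
    funext i; fin_cases i <;> simp
  have e3 : b = ![b 0, b 1] := by funext i; fin_cases i <;> simp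
  have s0 : |f (gridPt (k + 1) ![b 0, 2 * (b 1 / 2)]) -
      f (gridPt (k + 1) ![2 * (b 0 / 2), 2 * (b 1 / 2)])| ≤ M := by
    rcases Nat.mod_two_eq_zero_or_one (b 0) with h | h
    · have : b 0 = 2 * (b 0 / 2) := by omega
      rw [← this]; simpa using hM
    · have : b 0 = 2 * (b 0 / 2) + 1 := by omega
      rw [← e2]
      conv_lhs => rw [this]
      exact h0
  have s1 : |f (gridPt (k + 1) ![b 0, b 1]) -
      f (gridPt (k + 1) ![b 0, 2 * (b 1 / 2)])| ≤ M := by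
    rcases Nat.mod_two_eq_zero_or_one (b 1) with h | h
    · have : b 1 = 2 * (b 1 / 2) := by omega
      rw [← this]; simpa using hM
    · have : b 1 = 2 * (b 1 / 2) + 1 := by omega
      rw [← this] at h1
      exact h1
  rw [e2]
  conv_lhs => rw [e3]
  refine (abs_sub_le _ (f (gridPt (k + 1) ![b 0, 2 * (b 1 / 2)])) _).trans ?_
  simp only [Matrix.cons_val_zero, Matrix.cons_val_one, Matrix.cons_val_fin_one] at s0 s1 ⊢
  linarith

/-- The indices of the grid of mesh `2 ^ (-k)` in the cell `c` of the grid of mesh `2 ^ (-n)`. -/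
def cellIdx (n k : ℕ) (c : Fin 2 → ℕ) : Finset (Fin 2 → ℕ) :=
  (gridIdx k).filter fun a => (fun i => a i / 2 ^ (k - n)) = c

/-- The sum of the fourth powers of the increments over a cell. -/
noncomputable def cellSum (f : Torus2 → ℝ) (n k : ℕ) (c : Fin 2 → ℕ) : ℝ :=
  ∑ a ∈ cellIdx n k c, ∑ i, gridDiff f k a i ^ 4

theorem cellSum_nonneg (f : Torus2 → ℝ) (n k : ℕ) (c : Fin 2 → ℕ) : 0 ≤ cellSum f n k c :=
  Finset.sum_nonneg fun _ _ => Finset.sum_nonneg fun _ _ => by positivity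

theorem gridDiff_le_cellSum (f : Torus2 → ℝ) {n k : ℕ} {c a : Fin 2 → ℕ} (ha : a ∈ cellIdx n k c)
    (i : Fin 2) : gridDiff f k a i ≤ cellSum f n k c ^ (1 / 4 : ℝ) := by
  have h1 : gridDiff f k a i ^ 4 ≤ cellSum f n k c :=
    (Finset.single_le_sum (f := fun i => gridDiff f k a i ^ 4) (fun _ _ => by positivity)
      (Finset.mem_univ i)).trans
      (Finset.single_le_sum (f := fun a => ∑ i, gridDiff f k a i ^ 4)
        (fun _ _ => Finset.sum_nonneg fun _ _ => by positivity) ha)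
  have h0 : 0 ≤ gridDiff f k a i := abs_nonneg _
  have h2 : (gridDiff f k a i ^ 4) ^ (1 / 4 : ℝ) = gridDiff f k a i := by
    rw [← Real.rpow_natCast, ← Real.rpow_mul h0]
    norm_num
  rw [← h2]
  exact Real.rpow_le_rpow (by positivity) h1 (by norm_num)

theorem sum_cellSum (f : Torus2 → ℝ) {n k : ℕ} (h : n ≤ k) :
    ∑ c ∈ gridIdx n, cellSum f n k c = ∑ a ∈ gridIdx k, ∑ i, gridDiff f k a i ^ 4 := by
  refine Finset.sum_fiberwise_of_maps_to (fun a ha => ?_) _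
  rw [mem_gridIdx] at ha ⊢
  intro i
  rw [Nat.div_lt_iff_lt_mul (by positivity), ← pow_add, Nat.add_sub_cancel' h]
  exact ha i

theorem abs_chain_le (f : Torus2 → ℝ) {y : Fin 2 → ℝ} (hy : ∀ i, 0 ≤ y i ∧ y i < 1) (n j : ℕ) :
    |f (gridPt (n + j) fun i => ⌊y i * 2 ^ (n + j)⌋₊) - f (gridPt n fun i => ⌊y i * 2 ^ n⌋₊)| ≤
      ∑ l ∈ Finset.range j,
        2 * cellSum f n (n + l + 1) (fun i => ⌊y i * 2 ^ n⌋₊) ^ (1 / 4 : ℝ) := by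
  induction j with
  | zero => simp
  | succ j ih =>
    rw [Finset.sum_range_succ]
    set c : Fin 2 → ℕ := fun i => ⌊y i * 2 ^ n⌋₊ with hc
    set b : Fin 2 → ℕ := fun i => ⌊y i * 2 ^ (n + j + 1)⌋₊ with hb
    have hb2 : ∀ i, b i / 2 = ⌊y i * 2 ^ (n + j)⌋₊ := fun i => by
      have := floor_mul_two_pow_div (y i) (n + j) 1
      rwa [pow_one] at this
    have hbc : ∀ i, b i / 2 / 2 ^ j = c i := fun i => by
      rw [hb2]; exact floor_mul_two_pow_div (y i) n j
    have hlt : ∀ i, b i < 2 ^ (n + j + 1) := fun i => floor_mul_two_pow_lt (hy i) _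
    have hsub : n + j + 1 - n = j + 1 := by omega
    have key : ∀ a : Fin 2 → ℕ, (∀ i, a i = b i ∨ a i = 2 * (b i / 2)) →
        a ∈ cellIdx n (n + j + 1) c := by
      intro a ha
      refine Finset.mem_filter.2 ⟨mem_gridIdx.2 fun i => ?_, funext fun i => ?_⟩
      · have := hlt i
        rcases ha i with h | h <;> omega
      · rw [hsub, pow_succ', ← Nat.div_div_eq_div_mul, ← hbc i]
        rcases ha i with h | h
        · rw [h]
        · rw [h, Nat.mul_div_cancel_left _ two_pos]
    have hM : 0 ≤ cellSum f n (n + j + 1) c ^ (1 / 4 : ℝ) :=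
      Real.rpow_nonneg (cellSum_nonneg _ _ _ _) _
    have hstep := abs_sub_gridPt_le f (n + j) hM b
      (gridDiff_le_cellSum f (key _ fun i => Or.inr rfl) 0)
      (gridDiff_le_cellSum f (key _ fun i => by fin_cases i <;> simp) 1)
    have e : (fun i => b i / 2) = fun i => ⌊y i * 2 ^ (n + j)⌋₊ := funext hb2
    rw [e] at hstep
    refine (abs_sub_le _ (f (gridPt (n + j) fun i => ⌊y i * 2 ^ (n + j)⌋₊)) _).trans ?_
    rw [add_comm]
    exact add_le_add ih hstep

theorem sum_rpow_quarter_le {ι : Type*} (I : Finset ι) {z : ι → ℝ} (hz : ∀ c, 0 ≤ z c) {n : ℕ}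
    (hI : I.card = 4 ^ n) {D : ℝ} (hD : 0 ≤ D) (h : ∑ c ∈ I, z c ≤ D ^ 4) :
    ∑ c ∈ I, z c ^ (1 / 4 : ℝ) ≤ D * ((2 : ℝ) ^ (3 / 2 : ℝ)) ^ n := by
  have h1 := pow_sum_div_card_le_sum_pow (s := I) (f := fun c => z c ^ (1 / 4 : ℝ))
    (fun c _ => Real.rpow_nonneg (hz c) _) 3
  have h2 : ∀ c, (z c ^ (1 / 4 : ℝ)) ^ (3 + 1) = z c := fun c => by
    rw [← Real.rpow_mul_natCast (hz c)]; norm_num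
  simp only [h2] at h1
  rw [hI, div_le_iff₀ (by positivity)] at h1
  refine (pow_le_pow_iff_left₀ (Finset.sum_nonneg fun c _ => Real.rpow_nonneg (hz c) _)
    (by positivity) four_ne_zero).1 (h1.trans ?_)
  have h3 : (((2 : ℝ) ^ (3 / 2 : ℝ)) ^ n) ^ 4 = ((4 ^ n : ℕ) : ℝ) ^ 3 := by
    have h4 : ((2 : ℝ) ^ (3 / 2 : ℝ)) ^ 4 = 4 ^ 3 := by
      rw [← Real.rpow_mul_natCast two_pos.le]; norm_num
    push_cast
    rw [← pow_mul, mul_comm n, pow_mul, h4, ← pow_mul, ← pow_mul, mul_comm]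
  rw [mul_pow, h3]
  gcongr

theorem exists_translate_sum_le {g : Torus2 → ℝ} (hg : Continuous g) (h : AlmostHalfRegular g)
    {ε : ℝ} (hε : 0 < ε) : ∃ (x₀ : Torus2) (D : ℝ), 0 ≤ D ∧ ∀ k : ℕ,
      ∑ a ∈ gridIdx k, ∑ i, gridDiff (fun x => g (x₀ + x)) k a i ^ 4 ≤
        D * ((2 : ℝ) ^ (2 * ε)) ^ k := by
  obtain ⟨C, hC0, hC⟩ := h.modulus ε hε
  have hae : ∀ᵐ x ∂torusMeasure, ∃ D : ℝ, 0 ≤ D ∧ ∀ k,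
      ∑ a ∈ gridIdx k, ∑ i, ‖g (x + gridPt k a + dyadicShift k i) - g (x + gridPt k a)‖ₑ ^ 4 ≤
        ENNReal.ofReal (D * ((2 : ℝ) ^ (2 * ε)) ^ k) := by
    refine ae_exists_le_geometric (C := 2 * C) (q := 2 ^ ε) (fun k => ?_) (by positivity)
      (Real.rpow_lt_rpow_of_exponent_lt one_lt_two (by linarith)) fun k => ?_
    · fun_prop
    · have hmeas : ∀ a i, Measurable fun x =>
          ‖g (x + gridPt k a + dyadicShift k i) - g (x + gridPt k a)‖ₑ ^ 4 := by
        intro a i; fun_prop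
      rw [lintegral_finsetSum _ fun a _ => Finset.measurable_sum _ fun i _ => hmeas a i]
      simp only [lintegral_finsetSum _ fun i _ => hmeas _ i]
      have hint : ∀ a i, ∫⁻ x, ‖g (x + gridPt k a + dyadicShift k i) - g (x + gridPt k a)‖ₑ ^ 4
          ∂torusMeasure ≤ ENNReal.ofReal (C * ((2 : ℝ) ^ (-(2 - ε))) ^ k) := fun a i => by
        rw [lintegral_add_right_eq_self
          (fun x => ‖g (x + dyadicShift k i) - g x‖ₑ ^ 4) (gridPt k a)]
        exact hC k i
      refine (Finset.sum_le_sum fun a _ => Finset.sum_le_sum fun i _ => hint a i).trans_eq ?_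
      rw [Finset.sum_const, Finset.sum_const, card_gridIdx, Finset.card_univ, Fintype.card_fin,
        nsmul_eq_mul, nsmul_eq_mul, ← ENNReal.ofReal_natCast, ← ENNReal.ofReal_natCast,
        ← ENNReal.ofReal_mul (by positivity), ← ENNReal.ofReal_mul (by positivity)]
      congr 1
      push_cast
      have : (2 : ℝ) ^ (-(2 - ε)) = 4⁻¹ * 2 ^ ε := by
        rw [neg_sub, sub_eq_neg_add, Real.rpow_add two_pos, Real.rpow_neg two_pos.le]
        norm_num
      rw [this, mul_pow, inv_pow]
      field_simp
  obtain ⟨x₀, D, hD0, hD⟩ := hae.exists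
  refine ⟨x₀, D, hD0, fun k => ?_⟩
  have h1 := hD k
  have h2 : ∀ a i, ‖g (x₀ + gridPt k a + dyadicShift k i) - g (x₀ + gridPt k a)‖ₑ ^ 4 =
      ENNReal.ofReal (gridDiff (fun x => g (x₀ + x)) k a i ^ 4) := fun a i => by
    rw [gridDiff, ENNReal.ofReal_pow (abs_nonneg _), ← Real.norm_eq_abs, ofReal_norm, add_assoc]
  simp only [h2] at h1
  have h3 : ∀ a i, 0 ≤ gridDiff (fun x => g (x₀ + x)) k a i ^ 4 := fun a i =>
    pow_nonneg (abs_nonneg _) 4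
  rwa [← Finset.sum_congr rfl fun a _ => ENNReal.ofReal_sum_of_nonneg fun i _ => h3 a i,
    ← ENNReal.ofReal_sum_of_nonneg fun a _ => Finset.sum_nonneg fun i _ => h3 a i,
    ENNReal.ofReal_le_ofReal_iff (by positivity)] at h1

theorem upperBoxDim_torusGraph_le {g : Torus2 → ℝ} (hg : Continuous g) (h : AlmostHalfRegular g) :
    upperBoxDim (torusGraph g) ≤ ((5 / 2 : ℝ) : EReal) := by
  refine upperBoxDim_le_of_dyadic (by norm_num) fun δ hδ => ?_
  obtain ⟨H, ρ, hH0, hρ0, hρ1, hH⟩ := h.holder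
  obtain ⟨L₀, hL₀⟩ := exists_pow_lt_of_lt_one (by norm_num : (0 : ℝ) < 1 / 2) hρ1
  set L := L₀ + 1 with hL
  have hLρ : ρ ^ L ≤ 1 / 2 := by
    refine le_trans ?_ hL₀.le
    exact pow_le_pow_of_le_one hρ0.le hρ1.le (by omega)
  have hLpos : (0 : ℝ) < L := by positivity
  obtain ⟨x₀, D, hD0, hD⟩ := exists_translate_sum_le hg h (ε := δ / (4 * L)) (by positivity)
  obtain ⟨A, hA1, hA⟩ := exists_add_one_le_mul_rpow (half_pos hδ)
  set f : Torus2 → ℝ := fun x => g (x₀ + x) with hf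
  set μ : ℝ := 2 ^ (δ / (8 * L)) with hμ
  have hμ1 : 1 ≤ μ := Real.one_le_rpow one_le_two (by positivity)
  have hμ4 : (2 : ℝ) ^ (2 * (δ / (4 * L))) = μ ^ 4 := by
    rw [hμ, ← Real.rpow_mul_natCast two_pos.le]
    congr 1; push_cast; field_simp; norm_num
  set D₀ : ℝ := max 1 D with hD₀
  have hD₀0 : 0 ≤ D₀ := by positivity
  have hD₀D : D ≤ D₀ ^ 4 := (le_max_right 1 D).trans (le_self_pow₀ (le_max_left _ _) four_ne_zero)
  have hsum : ∀ n k, n ≤ k → ∑ c ∈ gridIdx n, cellSum f n k c ^ (1 / 4 : ℝ) ≤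
      D₀ * μ ^ k * ((2 : ℝ) ^ (3 / 2 : ℝ)) ^ n := by
    intro n k hnk
    refine sum_rpow_quarter_le _ (fun c => cellSum_nonneg f n k c) (card_gridIdx n)
      (by positivity) ?_
    rw [sum_cellSum f hnk]
    refine (hD k).trans ?_
    rw [hμ4, mul_pow, ← pow_mul, ← pow_mul, mul_comm 4 k]
    gcongr
  have hμL : μ ^ (4 * L) = 2 ^ (δ / 2) := by
    rw [hμ, ← Real.rpow_mul_natCast two_pos.le]
    congr 1; push_cast; field_simp; norm_num
  refine ⟨(8 * L * D₀ + H + 1) * A, by positivity, fun n => ?_⟩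
  set R : (Fin 2 → ℕ) → ℝ := fun c => (∑ l ∈ Finset.range (4 * L * n - n),
    2 * cellSum f n (n + l + 1) c ^ (1 / 4 : ℝ)) + H * ρ ^ (L * n) with hR
  have hR0 : ∀ c, 0 ≤ R c := fun c => add_nonneg (Finset.sum_nonneg fun l _ =>
    mul_nonneg two_pos.le (Real.rpow_nonneg (cellSum_nonneg _ _ _ _) _)) (by positivity)
  have hnK : n + (4 * L * n - n) = 4 * (L * n) := by
    have : n ≤ 4 * L * n := Nat.le_mul_of_pos_left n (by omega)
    rw [Nat.add_sub_cancel' this, mul_assoc]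
  have hcov := externalCoveringNumber_graph_le g (gridIdx n) (fun c => x₀ + gridPt n c) R
    (r := (1 / 2) ^ n) (by positivity) (by
      intro x
      obtain ⟨y, hy, hyx⟩ := exists_torus_lift (x - x₀)
      refine ⟨fun i => ⌊y i * 2 ^ n⌋₊, mem_gridIdx.2 fun i => floor_mul_two_pow_lt (hy i) n,
        ?_, ?_⟩
      · have := dist_gridPt_floor_le hy hyx n
        rw [dist_eq_norm, sub_sub, ← dist_eq_norm] at this
        push_cast
        exact this
      · have h1 := abs_chain_le f hy n (4 * L * n - n)
        rw [hnK] at h1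
        have h2 := dist_gridPt_floor_le hy hyx (4 * (L * n))
        rw [dist_eq_norm, sub_sub, ← dist_eq_norm] at h2
        have h16 : (1 / 2 : ℝ) ^ (4 * (L * n)) = (1 / 16) ^ (L * n) := by
          rw [pow_mul]; norm_num
        have h3 := hH (L * n) _ _ (h2.trans_eq h16)
        rw [Real.norm_eq_abs] at h3
        refine (abs_sub_le _ (g (x₀ + gridPt (4 * (L * n)) fun i =>
          ⌊y i * 2 ^ (4 * (L * n))⌋₊)) _).trans ?_
        rw [add_comm]
        exact add_le_add h1 h3)
  refine hcov.trans ?_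
  rw [← Nat.cast_sum, ← ENNReal.ofReal_natCast]
  refine ENNReal.ofReal_le_ofReal ?_
  push_cast
  set U : ℝ := 2 ^ (δ / 2) with hU
  set T : ℝ := 2 ^ (3 / 2 : ℝ) with hT
  have hU1 : 1 ≤ U := Real.one_le_rpow one_le_two (by positivity)
  have hT2 : 2 ≤ T := by
    calc (2 : ℝ) = 2 ^ (1 : ℝ) := (Real.rpow_one 2).symm
      _ ≤ T := Real.rpow_le_rpow_of_exponent_le one_le_two (by norm_num)
  have hfloor : ∀ c ∈ gridIdx n, ((⌊R c / (1 / 2) ^ n⌋₊ : ℝ) + 1) ≤ R c * 2 ^ n + 1 := by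
    intro c _
    have h1 := Nat.floor_le (div_nonneg (hR0 c) (by positivity : (0 : ℝ) ≤ (1 / 2) ^ n))
    rw [one_div, inv_pow, div_inv_eq_mul] at h1
    rw [one_div, inv_pow, div_inv_eq_mul]
    linarith
  have hJ : ((4 * L * n - n : ℕ) : ℝ) ≤ 4 * L * (n + 1) := by
    have : 4 * L * n - n ≤ 4 * L * (n + 1) := by
      refine (Nat.sub_le _ _).trans (Nat.mul_le_mul_left _ n.le_succ)
    exact_mod_cast this
  have hterm : ∀ l ∈ Finset.range (4 * L * n - n),
      ∑ c ∈ gridIdx n, 2 * cellSum f n (n + l + 1) c ^ (1 / 4 : ℝ) ≤ 2 * (D₀ * U ^ n * T ^ n) := by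
    intro l hl
    rw [← Finset.mul_sum]
    have h1 := hsum n (n + l + 1) (by omega)
    have h2 : μ ^ (n + l + 1) ≤ U ^ n := by
      rw [← hμL, ← pow_mul]
      refine pow_le_pow_right₀ hμ1 ?_
      have := Finset.mem_range.1 hl
      have h3 : 4 * L * n = 4 * (L * n) := mul_assoc _ _ _
      omega
    have h3 : D₀ * μ ^ (n + l + 1) * T ^ n ≤ D₀ * U ^ n * T ^ n := by gcongr
    linarith
  have hRsum : ∑ c ∈ gridIdx n, R c ≤
      4 * L * (n + 1) * (2 * (D₀ * U ^ n * T ^ n)) + 4 ^ n * (H * (1 / 2) ^ n) := by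
    rw [hR, Finset.sum_add_distrib, Finset.sum_comm]
    refine add_le_add ?_ ?_
    · refine (Finset.sum_le_card_nsmul _ _ _ hterm).trans ?_
      rw [Finset.card_range, nsmul_eq_mul]
      gcongr
    · rw [Finset.sum_const, card_gridIdx, nsmul_eq_mul, pow_mul]
      push_cast
      gcongr
  have hnA : (n : ℝ) + 1 ≤ A * U ^ n := hA 2 le_rfl n
  have hT4 : (4 : ℝ) ^ n ≤ T ^ n * 2 ^ n := by
    rw [← mul_pow]; exact pow_le_pow_left₀ (by norm_num) (by linarith) n
  have hfin : (2 : ℝ) ^ ((5 / 2 + δ) * n) = U ^ n * U ^ n * (T ^ n * 2 ^ n) := by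
    rw [← mul_pow, ← mul_pow, ← mul_pow, Real.rpow_mul two_pos.le, Real.rpow_natCast, hU, hT,
      ← Real.rpow_add two_pos]
    have : (2 : ℝ) ^ (3 / 2 : ℝ) * 2 = 2 ^ (3 / 2 + 1 : ℝ) := by
      rw [Real.rpow_add two_pos, Real.rpow_one]
    rw [this, ← Real.rpow_add two_pos]
    congr 2; ring
  have hUn : 1 ≤ U ^ n := one_le_pow₀ hU1
  have hn1 : (1 : ℝ) ≤ n + 1 := by linarith [(Nat.cast_nonneg n : (0 : ℝ) ≤ n)]
  have hW : 0 ≤ U ^ n * (T ^ n * 2 ^ n) := by positivity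
  have h4W : (4 : ℝ) ^ n ≤ (n + 1) * (U ^ n * (T ^ n * 2 ^ n)) := by
    have h1 : T ^ n * 2 ^ n ≤ U ^ n * (T ^ n * 2 ^ n) := le_mul_of_one_le_left (by positivity) hUn
    exact hT4.trans (h1.trans (le_mul_of_one_le_left hW hn1))
  calc ∑ c ∈ gridIdx n, ((⌊R c / (1 / 2) ^ n⌋₊ : ℝ) + 1)
      ≤ ∑ c ∈ gridIdx n, (R c * 2 ^ n + 1) := Finset.sum_le_sum hfloor
    _ = (∑ c ∈ gridIdx n, R c) * 2 ^ n + 4 ^ n := by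
        rw [Finset.sum_add_distrib, ← Finset.sum_mul, Finset.sum_const, card_gridIdx]
        simp
    _ ≤ (4 * L * (n + 1) * (2 * (D₀ * U ^ n * T ^ n)) + 4 ^ n * (H * (1 / 2) ^ n)) * 2 ^ n +
        4 ^ n := by gcongr
    _ = 8 * L * D₀ * ((n + 1) * (U ^ n * (T ^ n * 2 ^ n))) +
        H * 4 ^ n * ((1 / 2) ^ n * 2 ^ n) + 4 ^ n := by ring
    _ = 8 * L * D₀ * ((n + 1) * (U ^ n * (T ^ n * 2 ^ n))) + H * 4 ^ n + 4 ^ n := by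
        rw [← mul_pow (1 / 2 : ℝ)]; norm_num
    _ ≤ 8 * L * D₀ * ((n + 1) * (U ^ n * (T ^ n * 2 ^ n))) +
        H * ((n + 1) * (U ^ n * (T ^ n * 2 ^ n))) + (n + 1) * (U ^ n * (T ^ n * 2 ^ n)) := by
        gcongr
    _ = (8 * L * D₀ + H + 1) * ((n + 1) * (U ^ n * (T ^ n * 2 ^ n))) := by ring
    _ ≤ (8 * L * D₀ + H + 1) * (A * U ^ n * (U ^ n * (T ^ n * 2 ^ n))) := by gcongr
    _ = _ := by rw [hfin]; ring

/-! ### The lower bound for the dimension of graphs -/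

theorem haarAddCircle_closedBall_le (x : UnitAddCircle) (r : ℝ) :
    (AddCircle.haarAddCircle : Measure UnitAddCircle) (Metric.closedBall x r) ≤
      ENNReal.ofReal (2 * r) := by
  have h := AddCircle.volume_closedBall (T := 1) (x := x) r
  rw [AddCircle.volume_eq_smul_haarAddCircle, ENNReal.ofReal_one, one_smul] at h
  rw [h]
  exact ENNReal.ofReal_le_ofReal (min_le_right _ _)

theorem torusMeasure_closedBall_le (x : Torus2) {r : ℝ} (hr : 0 ≤ r) :
    torusMeasure (Metric.closedBall x r) ≤ ENNReal.ofReal (2 * r) ^ 2 := by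
  rw [closedBall_pi x hr, Measure.pi_pi, Fin.prod_univ_two, sq]
  gcongr <;> exact haarAddCircle_closedBall_le _ _

theorem exists_isCover_encard_eq {X : Type*} [PseudoEMetricSpace X] (r : ℝ≥0) (E : Set X) :
    ∃ C : Set X, Metric.IsCover r E C ∧ C.encard = Metric.externalCoveringNumber r E := by
  have hne : {n : ℕ∞ | ∃ C : Set X, Metric.IsCover r E C ∧ C.encard = n}.Nonempty :=
    ⟨_, E, Metric.IsCover.rfl, rfl⟩
  obtain ⟨C, hC, h⟩ := csInf_mem hne
  refine ⟨C, hC, le_antisymm ?_ hC.externalCoveringNumber_le_encard⟩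
  rw [h]
  exact le_iInf₂ fun C' hC' => csInf_le' ⟨C', hC', rfl⟩

theorem enorm_sub_le_sum_of_isCover {g : Torus2 → ℝ} (hg : Continuous g) (k : ℕ) (i : Fin 2)
    (C : Finset (Torus2 × ℝ))
    (hC : Metric.IsCover ((1 / 2 : ℝ≥0) ^ k) (torusGraph g) (C : Set (Torus2 × ℝ))) (x : Torus2) :
    ‖g (x + dyadicShift k i) - g x‖ₑ ≤ ∑ z ∈ C,
      (Metric.closedBall z.1 (2 * (1 / 2) ^ k)).indicator
        (fun _ => ENNReal.ofReal (2 * (1 / 2) ^ k)) x := by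
  classical
  set r : ℝ := (1 / 2) ^ k with hr
  have hr0 : 0 < r := by positivity
  rw [Metric.isCover_iff_subset_iUnion_closedBall] at hC
  let γ : ℝ → Torus2 := fun θ => x + Pi.single i ((θ * r : ℝ) : UnitAddCircle)
  have hγ : Continuous γ := by
    refine continuous_const.add ((continuous_single i).comp ?_)
    exact (AddCircle.continuous_mk' 1).comp (by fun_prop)
  have hγ0 : γ 0 = x := by simp [γ]
  have hγ1 : γ 1 = x + dyadicShift k i := by simp [γ, dyadicShift, hr]
  have hdist : ∀ θ ∈ Set.uIcc (0 : ℝ) 1, dist (γ θ) x ≤ r := by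
    intro θ hθ
    rw [Set.uIcc_of_le zero_le_one] at hθ
    simp only [γ, dist_eq_norm, add_sub_cancel_left, Pi.norm_single]
    rw [UnitAddCircle.norm_eq]
    refine (round_le _ 0).trans ?_
    rw [Int.cast_zero, sub_zero, abs_of_nonneg (mul_nonneg hθ.1 hr0.le)]
    exact mul_le_of_le_one_left hr0.le hθ.2
  have hiv := intermediate_value_uIcc ((hg.comp hγ).continuousOn (s := Set.uIcc (0 : ℝ) 1))
  simp only [Function.comp_apply, hγ0, hγ1] at hiv
  have hsub : Set.uIcc (g x) (g (x + dyadicShift k i)) ⊆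
      ⋃ z ∈ C.filter (fun z => x ∈ Metric.closedBall z.1 (2 * r)), Metric.closedBall z.2 r := by
    intro s hs
    obtain ⟨θ, hθ, rfl⟩ := hiv hs
    obtain ⟨z, hz, hzm⟩ := Set.mem_iUnion₂.1 (hC ⟨γ θ, rfl⟩)
    rw [Metric.mem_closedBall, Prod.dist_eq] at hzm
    have hzr : (((1 / 2 : ℝ≥0) ^ k : ℝ≥0) : ℝ) = r := by rw [hr]; push_cast; rfl
    rw [hzr] at hzm
    refine Set.mem_iUnion₂.2 ⟨z, Finset.mem_filter.2 ⟨Finset.mem_coe.1 hz, ?_⟩, ?_⟩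
    · have h1 := dist_triangle_left x z.1 (γ θ)
      have h2 := hdist θ hθ
      have h3 := (le_max_left _ _).trans hzm
      simp only at h3
      rw [Metric.mem_closedBall]
      linarith
    · exact Metric.mem_closedBall.2 ((le_max_right _ _).trans hzm)
  calc ‖g (x + dyadicShift k i) - g x‖ₑ
      = volume (Set.uIcc (g x) (g (x + dyadicShift k i))) := by
        rw [Real.volume_interval, ← Real.norm_eq_abs, ofReal_norm]
    _ ≤ ∑ z ∈ C.filter (fun z => x ∈ Metric.closedBall z.1 (2 * r)),
          volume (Metric.closedBall z.2 r) :=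
        (measure_mono hsub).trans (measure_biUnion_finset_le _ _)
    _ = ∑ z ∈ C, (Metric.closedBall z.1 (2 * r)).indicator (fun _ => ENNReal.ofReal (2 * r)) x := by
        rw [Finset.sum_filter]
        refine Finset.sum_congr rfl fun z _ => ?_
        rw [Real.volume_closedBall, Set.indicator_apply]

theorem lintegral_sub_le_covering {g : Torus2 → ℝ} (hg : Continuous g) (k : ℕ) (i : Fin 2) :
    ∫⁻ x, ‖g (x + dyadicShift k i) - g x‖ₑ ∂torusMeasure ≤
      ((Metric.externalCoveringNumber ((1 / 2 : ℝ≥0) ^ k) (torusGraph g) : ℕ∞) : ℝ≥0∞) *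
        ENNReal.ofReal (32 * ((1 / 2) ^ k) ^ 3) := by
  obtain ⟨C, hC, hcard⟩ := exists_isCover_encard_eq ((1 / 2 : ℝ≥0) ^ k) (torusGraph g)
  rw [← hcard]
  have hr0 : (0 : ℝ) < (1 / 2) ^ k := by positivity
  rcases C.finite_or_infinite with hfin | hinf
  · lift C to Finset (Torus2 × ℝ) using hfin
    rw [Set.encard_coe_eq_coe_finsetCard]
    refine (lintegral_mono (enorm_sub_le_sum_of_isCover hg k i C hC)).trans ?_
    rw [lintegral_finsetSum _ fun z _ => measurable_const.indicator
      Metric.isClosed_closedBall.measurableSet]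
    have hz : ∀ z ∈ C, ∫⁻ x, (Metric.closedBall z.1 (2 * (1 / 2) ^ k)).indicator
        (fun _ => ENNReal.ofReal (2 * (1 / 2) ^ k)) x ∂torusMeasure ≤
        ENNReal.ofReal (32 * ((1 / 2) ^ k) ^ 3) := by
      intro z _
      rw [lintegral_indicator_const Metric.isClosed_closedBall.measurableSet]
      refine (mul_le_mul_right (torusMeasure_closedBall_le z.1 (by positivity)) _).trans_eq ?_
      rw [← ENNReal.ofReal_pow (by positivity), ← ENNReal.ofReal_mul (by positivity)]
      congr 1; ring
    refine (Finset.sum_le_card_nsmul _ _ _ hz).trans_eq ?_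
    rw [nsmul_eq_mul]; simp
  · rw [hinf.encard_eq]
    simp only [ENat.toENNReal_top]
    rw [ENNReal.top_mul (by simp)]
    exact le_top

theorem enorm_sq_le_interpolate (a : ℝ≥0∞) {s : ℝ} (hs : 0 < s) :
    a ^ 2 ≤ ENNReal.ofReal s * a + ENNReal.ofReal ((s ^ 2)⁻¹) * a ^ 4 := by
  rcases le_total a (ENNReal.ofReal s) with h | h
  · refine le_trans ?_ le_self_add
    rw [sq]; gcongr
  · refine le_trans ?_ le_add_self
    have h1 : 1 ≤ ENNReal.ofReal ((s ^ 2)⁻¹) * a ^ 2 := by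
      calc (1 : ℝ≥0∞) = ENNReal.ofReal ((s ^ 2)⁻¹) * ENNReal.ofReal s ^ 2 := by
            rw [← ENNReal.ofReal_pow hs.le, ← ENNReal.ofReal_mul (by positivity),
              inv_mul_cancel₀ (by positivity), ENNReal.ofReal_one]
        _ ≤ _ := by gcongr
    calc a ^ 2 = 1 * a ^ 2 := (one_mul _).symm
      _ ≤ ENNReal.ofReal ((s ^ 2)⁻¹) * a ^ 2 * a ^ 2 := by gcongr
      _ = _ := by ring

theorem le_max_upperBoxDim {u : Torus2 → ℂ} (hc : Continuous u) (hu : AlmostHalfRegular u)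
    {c : ℝ} (hc0 : 0 < c) {i : Fin 2} {k₀ : ℕ}
    (h : ∀ k ≥ k₀, ENNReal.ofReal (c * (1 / 2) ^ k) ≤
      ∫⁻ x, ‖u (x + dyadicShift k i) - u x‖ₑ ^ 2 ∂torusMeasure) :
    ((5 / 2 : ℝ) : EReal) ≤ max (upperBoxDim (torusGraph fun x => (u x).re))
      (upperBoxDim (torusGraph fun x => (u x).im)) := by
  by_contra! hlt
  obtain ⟨z₀, hz₀, hz₀'⟩ := EReal.lt_iff_exists_real_btwn.1 hlt
  obtain ⟨z, hz, hz2, hz0⟩ : ∃ z : ℝ, max (upperBoxDim (torusGraph fun x => (u x).re))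
      (upperBoxDim (torusGraph fun x => (u x).im)) < (z : EReal) ∧ z < 5 / 2 ∧ 0 ≤ z :=
    ⟨max z₀ 0, hz₀.trans_le (by exact_mod_cast le_max_left _ _),
      max_lt (by exact_mod_cast hz₀') (by norm_num), le_max_right _ _⟩
  obtain ⟨n₁, hn₁⟩ := exists_covering_le_of_upperBoxDim_lt hz0 ((le_max_left _ _).trans_lt hz)
  obtain ⟨n₂, hn₂⟩ := exists_covering_le_of_upperBoxDim_lt hz0 ((le_max_right _ _).trans_lt hz)
  set η : ℝ := 5 / 2 - z with hη
  have hη0 : 0 < η := by linarith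
  obtain ⟨C, hC0, hC⟩ := hu.modulus (η / 2) (by linarith)
  set θ : ℝ := 2 ^ (-(1 + η / 2)) with hθ
  set σ : ℝ := 2 ^ (-(1 / 2 - η / 2)) with hσ
  have hθ0 : 0 < θ := by positivity
  have hσ0 : 0 < σ := by positivity
  have key : ∀ k ≥ max k₀ (max n₁ n₂), c * (1 / 2) ^ k ≤ (64 + C) * θ ^ k := by
    intro k hk
    have hk0 : k₀ ≤ k := (le_max_left _ _).trans hk
    have hk1 : n₁ ≤ k := (le_max_left _ _).trans ((le_max_right _ _).trans hk)
    have hk2 : n₂ ≤ k := (le_max_right _ _).trans ((le_max_right _ _).trans hk)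
    have hcov : ∀ g : Torus2 → ℝ, Continuous g →
        ((Metric.externalCoveringNumber ((1 / 2 : ℝ≥0) ^ k) (torusGraph g) : ℕ∞) : ℝ≥0∞) ≤
          ENNReal.ofReal (((2 : ℝ) ^ z) ^ k) →
        ∫⁻ x, ‖g (x + dyadicShift k i) - g x‖ₑ ∂torusMeasure ≤
          ENNReal.ofReal (32 * ((2 : ℝ) ^ (-(1 / 2 + η))) ^ k) := by
      intro g hg hN
      refine (lintegral_sub_le_covering hg k i).trans ((mul_le_mul_left hN _).trans_eq ?_)
      rw [← ENNReal.ofReal_mul (by positivity)]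
      congr 1
      have : (2 : ℝ) ^ (-(1 / 2 + η)) = 2 ^ z * (1 / 2) ^ 3 := by
        rw [show -(1 / 2 + η) = z + -3 by rw [hη]; ring, Real.rpow_add two_pos]
        congr 1
        rw [Real.rpow_neg two_pos.le]; norm_num
      rw [this, mul_pow, ← pow_mul, ← pow_mul, mul_comm 3 k]
      ring
    have hre := hcov _ (Complex.continuous_re.comp hc) (hn₁ k hk1)
    have him := hcov _ (Complex.continuous_im.comp hc) (hn₂ k hk2)
    simp only [Function.comp_apply, ← Complex.sub_re, ← Complex.sub_im] at hre him
    have hL1 : ∫⁻ x, ‖u (x + dyadicShift k i) - u x‖ₑ ∂torusMeasure ≤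
        ENNReal.ofReal (64 * ((2 : ℝ) ^ (-(1 / 2 + η))) ^ k) := by
      calc ∫⁻ x, ‖u (x + dyadicShift k i) - u x‖ₑ ∂torusMeasure
          ≤ ∫⁻ x, (‖(u (x + dyadicShift k i) - u x).re‖ₑ +
              ‖(u (x + dyadicShift k i) - u x).im‖ₑ) ∂torusMeasure := by
            refine lintegral_mono fun x => ?_
            rw [← ofReal_norm, ← ofReal_norm, ← ofReal_norm,
              ← ENNReal.ofReal_add (norm_nonneg _) (norm_nonneg _)]
            exact ENNReal.ofReal_le_ofReal (Complex.norm_le_abs_re_add_abs_im _)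
        _ = _ := lintegral_add_left (by fun_prop) _
        _ ≤ _ := add_le_add hre him
        _ = _ := by
            rw [← ENNReal.ofReal_add (by positivity) (by positivity)]
            congr 1; ring
    have hs : 0 < σ ^ k := by positivity
    have hL2 := h k hk0
    have hfin : ENNReal.ofReal (c * (1 / 2) ^ k) ≤ ENNReal.ofReal ((64 + C) * θ ^ k) := by
      refine hL2.trans ?_
      calc ∫⁻ x, ‖u (x + dyadicShift k i) - u x‖ₑ ^ 2 ∂torusMeasure
          ≤ ∫⁻ x, (ENNReal.ofReal (σ ^ k) * ‖u (x + dyadicShift k i) - u x‖ₑ +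
              ENNReal.ofReal (((σ ^ k) ^ 2)⁻¹) * ‖u (x + dyadicShift k i) - u x‖ₑ ^ 4)
                ∂torusMeasure :=
            lintegral_mono fun x => enorm_sq_le_interpolate _ hs
        _ = ENNReal.ofReal (σ ^ k) * ∫⁻ x, ‖u (x + dyadicShift k i) - u x‖ₑ ∂torusMeasure +
            ENNReal.ofReal (((σ ^ k) ^ 2)⁻¹) *
              ∫⁻ x, ‖u (x + dyadicShift k i) - u x‖ₑ ^ 4 ∂torusMeasure := by
            rw [lintegral_add_left (by fun_prop), lintegral_const_mul _ (by fun_prop),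
              lintegral_const_mul _ (by fun_prop)]
        _ ≤ ENNReal.ofReal (σ ^ k) * ENNReal.ofReal (64 * ((2 : ℝ) ^ (-(1 / 2 + η))) ^ k) +
            ENNReal.ofReal (((σ ^ k) ^ 2)⁻¹) *
              ENNReal.ofReal (C * ((2 : ℝ) ^ (-(2 - η / 2))) ^ k) := by
            gcongr
            exact hC k i
        _ = _ := by
            rw [← ENNReal.ofReal_mul (by positivity), ← ENNReal.ofReal_mul (by positivity),
              ← ENNReal.ofReal_add (by positivity) (by positivity)]
            congr 1
            have e1 : σ * (2 : ℝ) ^ (-(1 / 2 + η)) = θ := by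
              rw [hσ, hθ, ← Real.rpow_add two_pos]; congr 1; ring
            have e2 : (σ ^ 2)⁻¹ * (2 : ℝ) ^ (-(2 - η / 2)) = θ := by
              rw [hσ, hθ, ← Real.rpow_mul_natCast two_pos.le, ← Real.rpow_neg two_pos.le,
                ← Real.rpow_add two_pos]
              congr 1; push_cast; ring
            calc σ ^ k * (64 * ((2 : ℝ) ^ (-(1 / 2 + η))) ^ k) +
                ((σ ^ k) ^ 2)⁻¹ * (C * ((2 : ℝ) ^ (-(2 - η / 2))) ^ k)
                = 64 * (σ * (2 : ℝ) ^ (-(1 / 2 + η))) ^ k +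
                  C * ((σ ^ 2)⁻¹ * (2 : ℝ) ^ (-(2 - η / 2))) ^ k := by
                  rw [mul_pow, mul_pow, inv_pow, ← pow_mul, ← pow_mul, mul_comm k 2]; ring
              _ = _ := by rw [e1, e2]; ring
    rwa [ENNReal.ofReal_le_ofReal_iff (by positivity)] at hfin
  set q : ℝ := 2 * θ with hq
  have hq0 : 0 ≤ q := by positivity
  have hq1 : q < 1 := by
    have : q = 2 ^ (-(η / 2)) := by
      rw [hq, hθ]
      nth_rewrite 1 [← Real.rpow_one 2]
      rw [← Real.rpow_add two_pos]; congr 1; ring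
    rw [this]
    exact Real.rpow_lt_one_of_one_lt_of_neg one_lt_two (by linarith)
  have hlim : Tendsto (fun k : ℕ => (64 + C) * q ^ k) atTop (𝓝 0) := by
    have := (tendsto_pow_atTop_nhds_zero_of_lt_one hq0 hq1).const_mul (64 + C)
    rwa [mul_zero] at this
  obtain ⟨k, hk, hk'⟩ := ((hlim.eventually_lt_const hc0).and
    (eventually_ge_atTop (max k₀ (max n₁ n₂)))).exists
  have h1 := key k hk'
  have h2 : (0 : ℝ) < 2 ^ k := by positivity
  have h3 : (1 / 2 : ℝ) ^ k * 2 ^ k = 1 := by rw [← mul_pow]; norm_num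
  have h4 : (64 + C) * q ^ k = (64 + C) * θ ^ k * 2 ^ k := by rw [hq, mul_pow]; ring
  have h5 : c * (1 / 2) ^ k * 2 ^ k ≤ (64 + C) * θ ^ k * 2 ^ k := by gcongr
  rw [mul_assoc, h3, mul_one] at h5
  linarith

/-! ### Translations and Fourier coefficients -/

theorem torusFourierBasis_repr (f : Lp ℂ 2 torusMeasure) (m : Fin 2 → ℤ) :
    torusFourierBasis.repr f m = torusCoeff f m :=
  UnitAddTorus.mFourierBasis_repr f m

theorem torusCoeff_congr_ae {f g : Torus2 → ℂ} (h : f =ᵐ[torusMeasure] g) (m : Fin 2 → ℤ) :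
    torusCoeff f m = torusCoeff g m :=
  integral_congr_ae (by filter_upwards [h] with x hx; rw [hx])

theorem hasSum_sq_torusCoeff {f : Torus2 → ℂ} (hf : MemLp f 2 torusMeasure) :
    HasSum (fun m => ‖torusCoeff f m‖ ^ 2) (∫ x, ‖f x‖ ^ 2 ∂torusMeasure) := by
  have h : HasSum (fun m => ‖torusCoeff (hf.toLp f) m‖ ^ 2)
      (∫ x, ‖hf.toLp f x‖ ^ 2 ∂torusMeasure) := UnitAddTorus.hasSum_sq_mFourierCoeff (hf.toLp f)
  have e : ∫ x, ‖hf.toLp f x‖ ^ 2 ∂torusMeasure = ∫ x, ‖f x‖ ^ 2 ∂torusMeasure :=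
    integral_congr_ae (by filter_upwards [hf.coeFn_toLp] with x hx; rw [hx])
  rw [e] at h
  simpa only [torusCoeff_congr_ae hf.coeFn_toLp] using h

theorem torusCoeff_translate (f : Torus2 → ℂ) (h : Torus2) (m : Fin 2 → ℤ) :
    torusCoeff (fun x => f (x + h)) m = UnitAddTorus.mFourier m h * torusCoeff f m := by
  rw [torusCoeff, torusCoeff, ← integral_const_mul,
    ← integral_add_right_eq_self (fun x => UnitAddTorus.mFourier m h *
      (UnitAddTorus.mFourier (-m) x * f x)) h]
  congr 1
  funext x
  have h1 : UnitAddTorus.mFourier m h * UnitAddTorus.mFourier (-m) h = 1 := by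
    rw [← UnitAddTorus.mFourier_add, add_neg_cancel, UnitAddTorus.mFourier_zero]; rfl
  rw [mFourier_add_apply]
  linear_combination (-(UnitAddTorus.mFourier (-m) x * f (x + h))) * h1

theorem memLp_translate {f : Torus2 → ℂ} (hf : MemLp f 2 torusMeasure) (h : Torus2) :
    MemLp (fun x => f (x + h)) 2 torusMeasure :=
  hf.comp_measurePreserving (measurePreserving_add_right torusMeasure h)

theorem torusCoeff_translate_sub {f : Torus2 → ℂ} (hf : MemLp f 2 torusMeasure) (h : Torus2)
    (m : Fin 2 → ℤ) : torusCoeff (fun x => f (x + h) - f x) m =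
      (UnitAddTorus.mFourier m h - 1) * torusCoeff f m := by
  have hb : ∀ {g : Torus2 → ℂ}, MemLp g 2 torusMeasure →
      Integrable (fun x => UnitAddTorus.mFourier (-m) x * g x) torusMeasure := fun hg =>
    (hg.integrable one_le_two).bdd_mul (c := 1)
      (UnitAddTorus.mFourier (-m)).continuous.aestronglyMeasurable
      (ae_of_all _ fun x => (norm_mFourier_apply _ x).le)
  rw [sub_one_mul, ← torusCoeff_translate, torusCoeff, torusCoeff, torusCoeff,
    ← integral_sub (hb (memLp_translate hf h)) (hb hf)]
  simp only [mul_sub]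

theorem lintegral_enorm_sq_eq {f : Torus2 → ℂ} (hf : MemLp f 2 torusMeasure) :
    ∫⁻ x, ‖f x‖ₑ ^ 2 ∂torusMeasure = ENNReal.ofReal (∫ x, ‖f x‖ ^ 2 ∂torusMeasure) := by
  rw [ofReal_integral_eq_lintegral_ofReal ((memLp_two_iff_integrable_sq_norm hf.1).1 hf)
    (ae_of_all _ fun x => by positivity)]
  refine lintegral_congr fun x => ?_
  rw [ENNReal.ofReal_pow (norm_nonneg _), ofReal_norm]

/-- The `L²` modulus of continuity depends only on the absolute values of the coefficients. -/
theorem lintegral_translate_sub_eq {f g : Torus2 → ℂ} (hf : MemLp f 2 torusMeasure)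
    (hg : MemLp g 2 torusMeasure) (hfg : ∀ m, ‖torusCoeff f m‖ = ‖torusCoeff g m‖) (h : Torus2) :
    ∫⁻ x, ‖f (x + h) - f x‖ₑ ^ 2 ∂torusMeasure = ∫⁻ x, ‖g (x + h) - g x‖ₑ ^ 2 ∂torusMeasure := by
  have hf' : MemLp (fun x => f (x + h) - f x) 2 torusMeasure := (memLp_translate hf h).sub hf
  have hg' : MemLp (fun x => g (x + h) - g x) 2 torusMeasure := (memLp_translate hg h).sub hg
  rw [lintegral_enorm_sq_eq hf', lintegral_enorm_sq_eq hg']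
  congr 1
  refine (hasSum_sq_torusCoeff hf').unique ?_
  have := hasSum_sq_torusCoeff hg'
  simpa only [torusCoeff_translate_sub hf, torusCoeff_translate_sub hg, norm_mul, hfg] using this

theorem two_nsmul_dyadicShift (k : ℕ) (i : Fin 2) :
    dyadicShift (k + 1) i + dyadicShift (k + 1) i = dyadicShift k i := by
  rw [dyadicShift, dyadicShift, ← Pi.single_add, ← AddCircle.coe_add]
  congr 2; ring

theorem gridPt_eq_nsmul (k : ℕ) (a : Fin 2 → ℕ) :
    gridPt k a = a 0 • dyadicShift k 0 + a 1 • dyadicShift k 1 := by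
  funext i
  have e : ∀ n : ℕ, (((n : ℝ) * (1 / 2) ^ k : ℝ) : UnitAddCircle) =
      n • (((1 / 2 : ℝ) ^ k : ℝ) : UnitAddCircle) := fun n => by
    rw [← AddCircle.coe_nsmul, nsmul_eq_mul]
  simp only [gridPt, dyadicShift, Pi.add_apply, Pi.smul_apply, e]
  fin_cases i <;> simp

theorem exists_dyadicShift_not_ae_eq {P : Set Torus2} (hP : IsClosed P)
    (hint : (interior P).Nonempty) (huniv : P ≠ Set.univ) : ∃ (k : ℕ) (i : Fin 2),
      ¬ ∀ᵐ x ∂torusMeasure, P.indicator (fun _ => (1 : ℂ)) (x + dyadicShift k i) =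
        P.indicator (fun _ => (1 : ℂ)) x := by
  by_contra! hinv
  set χ : Torus2 → ℂ := P.indicator fun _ => (1 : ℂ) with hχ
  have hadd : ∀ h₁ h₂ : Torus2, (∀ᵐ x ∂torusMeasure, χ (x + h₁) = χ x) →
      (∀ᵐ x ∂torusMeasure, χ (x + h₂) = χ x) → ∀ᵐ x ∂torusMeasure, χ (x + (h₁ + h₂)) = χ x := by
    intro h₁ h₂ H₁ H₂
    have H₃ := (measurePreserving_add_right torusMeasure h₁).quasiMeasurePreserving.ae H₂
    filter_upwards [H₁, H₃] with x hx₁ hx₃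
    rw [← add_assoc, hx₃, hx₁]
  have hsmul : ∀ (n : ℕ) (h : Torus2), (∀ᵐ x ∂torusMeasure, χ (x + h) = χ x) →
      ∀ᵐ x ∂torusMeasure, χ (x + n • h) = χ x := by
    intro n h H
    induction n with
    | zero => simp
    | succ n ih => rw [succ_nsmul]; exact hadd _ _ ih H
  have hgrid : ∀ k a, ∀ᵐ x ∂torusMeasure, χ (x + gridPt k a) = χ x := fun k a => by
    rw [gridPt_eq_nsmul]
    exact hadd _ _ (hsmul _ _ (hinv k 0)) (hsmul _ _ (hinv k 1))
  obtain ⟨p, hp⟩ := hint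
  obtain ⟨q, hq⟩ := (Set.ne_univ_iff_exists_notMem P).1 huniv
  obtain ⟨y, hy, hyx⟩ := exists_torus_lift (q - p)
  have hqo : Pᶜ ∈ 𝓝 q := hP.isOpen_compl.mem_nhds hq
  obtain ⟨ε, hε, hball⟩ := Metric.mem_nhds_iff.1 hqo
  obtain ⟨k, hk⟩ := exists_pow_lt_of_lt_one hε (by norm_num : (1 / 2 : ℝ) < 1)
  set d := gridPt k fun i => ⌊y i * 2 ^ k⌋₊ with hd
  have hpd : p + d ∈ Pᶜ := by
    refine hball ?_
    have := dist_gridPt_floor_le hy hyx k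
    rw [dist_eq_norm, sub_sub, ← dist_eq_norm, dist_comm] at this
    exact Metric.mem_ball.2 (this.trans_lt hk)
  set V : Set Torus2 := interior P ∩ (fun x => x + d) ⁻¹' Pᶜ with hV
  have hVo : IsOpen V := isOpen_interior.inter (hP.isOpen_compl.preimage (by fun_prop))
  have hVpos : 0 < torusMeasure V := hVo.measure_pos _ ⟨p, hp, hpd⟩
  have hV0 : torusMeasure V = 0 := by
    refine measure_mono_null (fun x hx => ?_) (ae_iff.1 (hgrid k fun i => ⌊y i * 2 ^ k⌋₊))
    have h1 : χ x = 1 := Set.indicator_of_mem (interior_subset hx.1) _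
    have h2 : χ (x + d) = 0 := Set.indicator_of_notMem hx.2 _
    simp only [Set.mem_ofPred_eq, ← hd, h1, h2]
    exact zero_ne_one
  exact hVpos.ne' hV0

theorem enorm_indicator_sub_sq (P : Set Torus2) (x y : Torus2) :
    ‖P.indicator (fun _ => (1 : ℂ)) x - P.indicator (fun _ => (1 : ℂ)) y‖ₑ ^ 2 =
      ‖P.indicator (fun _ => (1 : ℂ)) x - P.indicator (fun _ => (1 : ℂ)) y‖ₑ := by
  by_cases hx : x ∈ P <;> by_cases hy : y ∈ P <;> simp [hx, hy]

theorem exists_translate_lower_bound {P : Set Torus2} (hP : IsClosed P)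
    (hint : (interior P).Nonempty) (huniv : P ≠ Set.univ) :
    ∃ (c : ℝ) (i : Fin 2) (k₀ : ℕ), 0 < c ∧ ∀ k ≥ k₀, ENNReal.ofReal (c * (1 / 2) ^ k) ≤
      ∫⁻ x, ‖P.indicator (fun _ => (1 : ℂ)) (x + dyadicShift k i) -
        P.indicator (fun _ => (1 : ℂ)) x‖ₑ ^ 2 ∂torusMeasure := by
  obtain ⟨k₀, i, hne⟩ := exists_dyadicShift_not_ae_eq hP hint huniv
  set χ : Torus2 → ℂ := P.indicator fun _ => (1 : ℂ) with hχ
  have hχm : Measurable χ := measurable_const.indicator hP.measurableSet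
  simp only [hχ, enorm_indicator_sub_sq]
  simp only [← hχ]
  set D : ℕ → ℝ≥0∞ := fun k => ∫⁻ x, ‖χ (x + dyadicShift k i) - χ x‖ₑ ∂torusMeasure with hD
  have hmeas : ∀ h, Measurable fun x => ‖χ (x + h) - χ x‖ₑ := fun h => by fun_prop
  have hD0 : D k₀ ≠ 0 := by
    intro h0
    refine hne ?_
    filter_upwards [(lintegral_eq_zero_iff (hmeas _)).1 h0] with x hx
    simpa [sub_eq_zero] using hx
  have hDtop : D k₀ ≠ ∞ := by
    refine ne_top_of_le_ne_top (b := 2) (by norm_num)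
      ((lintegral_mono (g := fun _ => (2 : ℝ≥0∞)) fun x => ?_).trans_eq (by simp))
    have : ∀ y, ‖χ y‖ₑ ≤ 1 := fun y => by
      by_cases hy : y ∈ P <;> simp [hχ, hy]
    refine (enorm_sub_le).trans ((add_le_add (this _) (this _)).trans_eq one_add_one_eq_two)
  have hstep : ∀ k, D k ≤ 2 * D (k + 1) := by
    intro k
    calc D k ≤ ∫⁻ x, (‖χ (x + dyadicShift (k + 1) i + dyadicShift (k + 1) i) -
          χ (x + dyadicShift (k + 1) i)‖ₑ + ‖χ (x + dyadicShift (k + 1) i) - χ x‖ₑ)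
            ∂torusMeasure := by
          refine lintegral_mono fun x => ?_
          rw [← two_nsmul_dyadicShift, ← add_assoc]
          refine le_trans (le_of_eq ?_) (enorm_add_le _ _)
          congr 1; ring
      _ = D (k + 1) + D (k + 1) := by
          rw [lintegral_add_right _ (hmeas _)]
          congr 1
          exact lintegral_add_right_eq_self
            (fun x => ‖χ (x + dyadicShift (k + 1) i) - χ x‖ₑ) (dyadicShift (k + 1) i)
      _ = _ := (two_mul _).symm
  have hind : ∀ l, ENNReal.ofReal ((D k₀).toReal * (1 / 2) ^ l) ≤ D (k₀ + l) := by
    intro l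
    induction l with
    | zero => simp [ENNReal.ofReal_toReal hDtop]
    | succ l ih =>
      have h1 := ih.trans (hstep (k₀ + l))
      have h2 : ENNReal.ofReal ((D k₀).toReal * (1 / 2) ^ l) =
          2 * ENNReal.ofReal ((D k₀).toReal * (1 / 2) ^ (l + 1)) := by
        rw [← ENNReal.ofReal_ofNat, ← ENNReal.ofReal_mul two_pos.le]
        congr 1; ring
      rw [h2] at h1
      exact (ENNReal.mul_le_mul_iff_right two_ne_zero ENNReal.ofNat_ne_top).1 h1
  refine ⟨(D k₀).toReal * 2 ^ k₀, i, k₀, mul_pos (ENNReal.toReal_pos hD0 hDtop) (by positivity),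
    fun k hk => ?_⟩
  obtain ⟨l, rfl⟩ := Nat.exists_eq_add_of_le hk
  refine le_trans (le_of_eq ?_) (hind l)
  congr 1
  have : (2 : ℝ) ^ k₀ * (1 / 2) ^ k₀ = 1 := by rw [← mul_pow]; norm_num
  rw [pow_add]
  linear_combination ((D k₀).toReal * (1 / 2) ^ l) * this

/-! ### Fourier transforms of convex polygons -/

/-- The index `i` carries the right end point of the nonempty open interval
`{x | ∀ k, α k * x < t k}`, with ties broken by the order of the indices. -/
def IsActive {ι : Type*} [LinearOrder ι] (α t : ι → ℝ) (i : ι) : Prop :=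
  0 < α i ∧ ∀ k, (α k = 0 → 0 < t k) ∧ (α k < 0 → t k / α k < t i / α i) ∧
    (0 < α k → t i / α i ≤ t k / α k) ∧ (0 < α k → k < i → t i / α i < t k / α k)

theorem exists_isActive_iff {ι : Type*} [LinearOrder ι] [Fintype ι] {α : ι → ℝ} (t : ι → ℝ)
    (hpos : ∃ i, 0 < α i) (hneg : ∃ i, α i < 0) :
    ∃ i₀ j₀, 0 < α i₀ ∧ α j₀ < 0 ∧ (∀ k, 0 < α k → t i₀ / α i₀ ≤ t k / α k) ∧
      (∀ k, α k < 0 → t k / α k ≤ t j₀ / α j₀) ∧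
      (∀ i, IsActive α t i ↔ i = i₀ ∧ (∀ k, α k = 0 → 0 < t k) ∧ t j₀ / α j₀ < t i₀ / α i₀) := by
  obtain ⟨i₁, hi₁⟩ := hpos
  obtain ⟨j₁, hj₁⟩ := hneg
  obtain ⟨i₀, hi₀, hmin⟩ := Finset.exists_min_image (Finset.univ.filter fun k => 0 < α k)
    (fun k => toLex (t k / α k, k)) ⟨i₁, by simpa using hi₁⟩
  obtain ⟨j₀, hj₀, hmax⟩ := Finset.exists_max_image (Finset.univ.filter fun k => α k < 0)
    (fun k => t k / α k) ⟨j₁, by simpa using hj₁⟩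
  simp only [Finset.mem_filter, Finset.mem_univ, true_and] at hi₀ hmin hj₀ hmax
  simp only [Prod.Lex.le_iff, ofLex_toLex] at hmin
  have hmin' : ∀ k, 0 < α k → t i₀ / α i₀ ≤ t k / α k := fun k hk => by
    rcases hmin k hk with h | h
    · exact h.le
    · exact h.1.le
  refine ⟨i₀, j₀, hi₀, hj₀, hmin', hmax, fun i => ⟨fun h => ?_, ?_⟩⟩
  · obtain ⟨hi, hk⟩ := h
    have hii : i = i₀ := by
      by_contra hne
      have h1 := (hk i₀).2.2.1 hi₀
      have h2 := hmin' i hi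
      have heq := le_antisymm h2 h1
      rcases lt_or_gt_of_ne hne with hlt | hgt
      · rcases hmin i hi with h | h
        · exact h.ne heq
        · exact (h.2.trans_lt hlt).false
      · exact ((hk i₀).2.2.2 hi₀ hgt).ne heq.symm
    subst hii
    exact ⟨rfl, fun k => (hk k).1, (hk j₀).2.1 hj₀⟩
  · rintro ⟨rfl, hz, hlt⟩
    refine ⟨hi₀, fun k => ⟨hz k, fun hk => (hmax k hk).trans_lt hlt, hmin' k, fun hk hki => ?_⟩⟩
    rcases hmin k hk with h | h
    · exact h
    · exact absurd hki (not_lt.2 h.2)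

theorem integral_Ioo_exp {p : ℝ} (hp : p ≠ 0) {a b : ℝ} (hab : a ≤ b) :
    ∫ x in Set.Ioo a b, Complex.exp ((p * x : ℝ) * Complex.I) =
      (Complex.exp ((p * b : ℝ) * Complex.I) - Complex.exp ((p * a : ℝ) * Complex.I)) /
        (p * Complex.I) := by
  have hc : (p * Complex.I : ℂ) ≠ 0 := by simp [hp]
  rw [← integral_Ioc_eq_integral_Ioo, ← intervalIntegral.integral_of_le hab]
  have e : ∀ x : ℝ, Complex.exp ((p * x : ℝ) * Complex.I) = Complex.exp ((p * Complex.I) * x) :=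
    fun x => by congr 1; push_cast; ring
  simp only [e]
  exact integral_exp_mul_complex hc

open Classical in
theorem integral_section_eq {ι : Type*} [LinearOrder ι] [Fintype ι] {α : ι → ℝ} (t : ι → ℝ)
    (hpos : ∃ i, 0 < α i) (hneg : ∃ i, α i < 0) {p : ℝ} (hp : p ≠ 0) :
    ∫ x in {x : ℝ | ∀ k, α k * x < t k}, Complex.exp ((p * x : ℝ) * Complex.I) =
      (∑ i, ((if IsActive α t i then Complex.exp ((p * (t i / α i) : ℝ) * Complex.I) else 0) -
        (if IsActive (-α) t i then Complex.exp ((p * (t i / α i) : ℝ) * Complex.I) else 0))) /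
        (p * Complex.I) := by
  obtain ⟨i₀, j₀, hi₀, hj₀, hmin, hmax, hact⟩ := exists_isActive_iff t hpos hneg
  obtain ⟨j₁, i₁, hj₁, hi₁, hmin', hmax', hact'⟩ := exists_isActive_iff (α := -α) t
    (by simpa using hneg) (by simpa using hpos)
  simp only [Pi.neg_apply, Left.neg_pos_iff, Left.neg_neg_iff, neg_eq_zero, div_neg,
    neg_le_neg_iff, neg_lt_neg_iff] at hj₁ hi₁ hmin' hmax' hact'
  have hi : t i₁ / α i₁ = t i₀ / α i₀ := le_antisymm (hmax' _ hi₀) (hmin _ hi₁)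
  have hj : t j₁ / α j₁ = t j₀ / α j₀ := le_antisymm (hmax _ hj₁) (hmin' _ hj₀)
  simp only [hi, hj] at hact'
  simp only [hact, hact']
  by_cases hcond : (∀ k, α k = 0 → 0 < t k) ∧ t j₀ / α j₀ < t i₀ / α i₀
  · have hS : {x : ℝ | ∀ k, α k * x < t k} = Set.Ioo (t j₀ / α j₀) (t i₀ / α i₀) := by
      ext x
      refine ⟨fun hx => ⟨?_, ?_⟩, fun hx k => ?_⟩
      · rw [div_lt_iff_of_neg hj₀, mul_comm]; exact hx j₀
      · rw [lt_div_iff₀ hi₀, mul_comm]; exact hx i₀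
      · rcases lt_trichotomy (α k) 0 with h | h | h
        · rw [mul_comm, ← div_lt_iff_of_neg h]
          exact (hmax k h).trans_lt hx.1
        · rw [h, zero_mul]; exact hcond.1 k h
        · rw [mul_comm, ← lt_div_iff₀ h]
          exact hx.2.trans_le (hmin k h)
    rw [hS, integral_Ioo_exp hp hcond.2.le, Finset.sum_sub_distrib]
    congr 1
    have e1 : ∀ i, (i = i₀ ∧ (∀ k, α k = 0 → 0 < t k) ∧ t j₀ / α j₀ < t i₀ / α i₀) ↔ i = i₀ :=
      fun i => and_iff_left hcond
    have e2 : ∀ i, (i = j₁ ∧ (∀ k, α k = 0 → 0 < t k) ∧ t j₀ / α j₀ < t i₀ / α i₀) ↔ i = j₁ :=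
      fun i => and_iff_left hcond
    simp only [e1, e2, Finset.sum_ite_eq', Finset.mem_univ, if_true, hj]
  · have hS : {x : ℝ | ∀ k, α k * x < t k} = ∅ := by
      refine Set.eq_empty_of_forall_notMem fun x hx => hcond ⟨fun k hk => ?_, ?_⟩
      · simpa [hk] using hx k
      · have h1 : t j₀ / α j₀ < x := by rw [div_lt_iff_of_neg hj₀, mul_comm]; exact hx j₀
        have h2 : x < t i₀ / α i₀ := by rw [lt_div_iff₀ hi₀, mul_comm]; exact hx i₀
        exact h1.trans h2
    simp [hS, hcond]

theorem norm_integral_ordConnected_exp_le {W : Set ℝ} (hW : W.OrdConnected)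
    (hW1 : W ⊆ Set.Ioo 0 1) (c d : ℝ) :
    ‖∫ y in W, Complex.exp ((c * y + d : ℝ) * Complex.I)‖ ≤ 3 / (1 + |c|) := by
  rcases W.eq_empty_or_nonempty with rfl | hne
  · simp only [Measure.restrict_empty, integral_zero_measure, norm_zero]; positivity
  have hbb : BddBelow W := ⟨0, fun y hy => (hW1 hy).1.le⟩
  have hba : BddAbove W := ⟨1, fun y hy => (hW1 hy).2.le⟩
  have hle : sInf W ≤ sSup W := csInf_le_csSup hne hbb hba
  have hIoo : Set.Ioo (sInf W) (sSup W) ⊆ W := by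
    intro y hy
    obtain ⟨a, ha, hay⟩ := (csInf_lt_iff hbb hne).1 hy.1
    obtain ⟨b, hb, hyb⟩ := (lt_csSup_iff hba hne).1 hy.2
    exact hW.out ha hb ⟨hay.le, hyb.le⟩
  have hIcc : W ⊆ Set.Icc (sInf W) (sSup W) := fun y hy => ⟨csInf_le hbb hy, le_csSup hba hy⟩
  have hae : (W : Set ℝ) =ᵐ[volume] Set.Ioo (sInf W) (sSup W) :=
    (hIcc.eventuallyLE.trans Ioo_ae_eq_Icc.symm.le).antisymm hIoo.eventuallyLE
  have hlen : sSup W - sInf W ≤ 1 := by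
    have h1 : 0 ≤ sInf W := le_csInf hne fun y hy => (hW1 hy).1.le
    have h2 : sSup W ≤ 1 := csSup_le hne fun y hy => (hW1 hy).2.le
    linarith
  rw [setIntegral_congr_set hae]
  have hn : ∀ x : ℝ, ‖Complex.exp ((x : ℝ) * Complex.I)‖ = 1 := Complex.norm_exp_ofReal_mul_I
  rcases le_or_gt |c| 2 with hc | hc
  · have h1 : ‖∫ y in Set.Ioo (sInf W) (sSup W), Complex.exp ((c * y + d : ℝ) * Complex.I)‖ ≤
        1 * volume.real (Set.Ioo (sInf W) (sSup W)) :=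
      norm_setIntegral_le_of_norm_le_const measure_Ioo_lt_top fun y _ => (hn _).le
    rw [Real.volume_real_Ioo_of_le hle, one_mul] at h1
    refine h1.trans (hlen.trans ?_)
    rw [le_div_iff₀ (by positivity)]; linarith
  · have hc0 : c ≠ 0 := by rintro rfl; simp at hc; linarith
    have e : ∀ y : ℝ, Complex.exp ((c * y + d : ℝ) * Complex.I) =
        Complex.exp ((d : ℝ) * Complex.I) * Complex.exp ((c * y : ℝ) * Complex.I) := fun y => by
      rw [← Complex.exp_add]; congr 1; push_cast; ring
    simp only [e]
    rw [integral_const_mul, integral_Ioo_exp hc0 hle, norm_mul, hn, one_mul, norm_div, norm_mul,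
      Complex.norm_I, mul_one, Complex.norm_real, Real.norm_eq_abs]
    have h1 := norm_sub_le (Complex.exp ((c * sSup W : ℝ) * Complex.I))
      (Complex.exp ((c * sInf W : ℝ) * Complex.I))
    rw [hn, hn] at h1
    calc _ ≤ (1 + 1) / |c| := by gcongr
      _ ≤ 3 / (1 + |c|) := by
        rw [div_le_div_iff₀ (by linarith) (by positivity)]; linarith

theorem ordConnected_lt_affine (a b c d : ℝ) : {y : ℝ | a + b * y < c + d * y}.OrdConnected := by
  refine ⟨fun x hx z hz y hy => ?_⟩
  simp only [Set.mem_ofPred_eq] at hx hz ⊢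
  rcases le_total b d with h | h
  · nlinarith [hy.1]
  · nlinarith [hy.2]

theorem ordConnected_le_affine (a b c d : ℝ) : {y : ℝ | a + b * y ≤ c + d * y}.OrdConnected := by
  refine ⟨fun x hx z hz y hy => ?_⟩
  simp only [Set.mem_ofPred_eq] at hx hz ⊢
  rcases le_total b d with h | h
  · nlinarith [hy.1]
  · nlinarith [hy.2]

theorem ordConnected_imp {p : Prop} {W : Set ℝ} (h : W.OrdConnected) :
    {y : ℝ | p → y ∈ W}.OrdConnected := by
  by_cases hp : p
  · simpa [hp] using h
  · simpa [hp] using Set.ordConnected_univ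

theorem ordConnected_isActive {ι : Type*} [LinearOrder ι] (α β γ : ι → ℝ) (i : ι) :
    {y : ℝ | IsActive α (fun k => γ k - β k * y) i}.OrdConnected := by
  by_cases hi : 0 < α i
  swap
  · have : {y : ℝ | IsActive α (fun k => γ k - β k * y) i} = ∅ :=
      Set.eq_empty_of_forall_notMem fun y hy => hi hy.1
    rw [this]; exact Set.ordConnected_empty
  have e : {y : ℝ | IsActive α (fun k => γ k - β k * y) i} =
      ⋂ k, ({y | α k = 0 → y ∈ {y : ℝ | 0 + 0 * y < γ k + -β k * y}} ∩
        ({y | α k < 0 → y ∈ {y : ℝ | γ k / α k + -(β k / α k) * y < γ i / α i + -(β i / α i) * y}} ∩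
        ({y | 0 < α k → y ∈ {y : ℝ | γ i / α i + -(β i / α i) * y ≤ γ k / α k + -(β k / α k) * y}} ∩
        {y | 0 < α k ∧ k < i →
          y ∈ {y : ℝ | γ i / α i + -(β i / α i) * y < γ k / α k + -(β k / α k) * y}}))) := by
    have d : ∀ k y, (γ k - β k * y) / α k = γ k / α k + -(β k / α k) * y := fun k y => by ring
    ext y
    simp only [IsActive, d, Set.mem_ofPred_eq, Set.mem_iInter, Set.mem_inter_iff, hi, true_and,
      and_imp]
    refine forall_congr' fun k => ?_
    simp only [zero_mul, add_zero, neg_mul, ← sub_eq_add_neg]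
  rw [e]
  refine Set.ordConnected_iInter fun k => ?_
  exact (ordConnected_imp (ordConnected_lt_affine _ _ _ _)).inter
    ((ordConnected_imp (ordConnected_lt_affine _ _ _ _)).inter
      ((ordConnected_imp (ordConnected_le_affine _ _ _ _)).inter
        (ordConnected_imp (ordConnected_lt_affine _ _ _ _))))

/-- The open convex polygon cut out by the half planes `α k * x + β k * y < γ k`. -/
def convexCell {ι : Type*} (α β γ : ι → ℝ) : Set (ℝ × ℝ) :=
  {z | ∀ k, α k * z.1 + β k * z.2 < γ k}

theorem isOpen_convexCell {ι : Type*} [Finite ι] (α β γ : ι → ℝ) :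
    IsOpen (convexCell α β γ) := by
  have e : convexCell α β γ = ⋂ k, {z : ℝ × ℝ | α k * z.1 + β k * z.2 < γ k} := by
    ext; simp [convexCell]
  rw [e]
  exact isOpen_iInter_of_finite fun k => isOpen_lt (by fun_prop) (by fun_prop)

theorem integrable_indicator_exp {X : Type*} [MeasurableSpace X] {μ : Measure X} {W : Set X}
    (hW : MeasurableSet W) (hWμ : μ W ≠ ∞) {φ : X → ℝ} (hφ : Measurable φ) :
    Integrable (W.indicator fun x => Complex.exp ((φ x : ℝ) * Complex.I)) μ := by
  rw [integrable_indicator_iff hW]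
  have : IsFiniteMeasure (μ.restrict W) := ⟨by simpa using hWμ.lt_top⟩
  refine Integrable.of_bound (C := 1) ?_ (ae_of_all _ fun x => ?_)
  · exact (Complex.measurable_exp.comp
      ((Complex.measurable_ofReal.comp hφ).mul_const _)).aestronglyMeasurable
  · exact (Complex.norm_exp_ofReal_mul_I _).le

open Classical in
theorem norm_integral_convexCell_le {ι : Type*} [LinearOrder ι] [Fintype ι] {α β γ : ι → ℝ}
    (hpos : ∃ i, 0 < α i) (hneg : ∃ i, α i < 0)
    (hy : ∀ y, (∀ k, α k = 0 → 0 < γ k - β k * y) → y ∈ Set.Ioo (0 : ℝ) 1)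
    (hfin : volume (convexCell α β γ) ≠ ∞) {p q : ℝ} (hp : p ≠ 0) :
    ‖∫ z in convexCell α β γ, Complex.exp ((p * z.1 + q * z.2 : ℝ) * Complex.I)‖ ≤
      (∑ i, if α i = 0 then 0 else 6 / (1 + |q - p * β i / α i|)) / |p| := by
  set e : ℝ → ℂ := fun x => Complex.exp ((x : ℝ) * Complex.I) with he
  have eadd : ∀ x y, e (x + y) = e x * e y := fun x y => by
    simp only [he]; rw [← Complex.exp_add]; congr 1; push_cast; ring
  have hcell := (isOpen_convexCell α β γ).measurableSet
  set W : (ι → ℝ) → ι → Set ℝ := fun a i => {y : ℝ | IsActive a (fun k => γ k - β k * y) i} with hWd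
  have hWo : ∀ a i, (W a i).OrdConnected := fun a i => ordConnected_isActive a β γ i
  have hWs : ∀ a i, (∀ k, a k = 0 ↔ α k = 0) → W a i ⊆ Set.Ioo 0 1 := fun a i ha y hyW =>
    hy y fun k hk => (hyW.2 k).1 ((ha k).2 hk)
  set c : ι → ℝ := fun i => q - p * β i / α i with hc
  set d : ι → ℝ := fun i => p * γ i / α i with hd
  set F : (ι → ℝ) → ι → ℝ → ℂ := fun a i => (W a i).indicator fun y => e (c i * y + d i) with hF
  have hWint : ∀ a i, (∀ k, a k = 0 ↔ α k = 0) → Integrable (F a i) := fun a i ha =>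
    integrable_indicator_exp (hWo a i).measurableSet
      ((measure_mono (hWs a i ha)).trans_lt measure_Ioo_lt_top).ne (by fun_prop)
  have hsec : ∀ y, ∫ x, (convexCell α β γ).indicator (fun z => e (p * z.1 + q * z.2)) (x, y) =
      (∑ i, (F α i y - F (-α) i y)) / (p * Complex.I) := by
    intro y
    have h1 : ∀ x, (convexCell α β γ).indicator (fun z => e (p * z.1 + q * z.2)) (x, y) =
        {x : ℝ | ∀ k, α k * x < γ k - β k * y}.indicator (fun x => e (p * x) * e (q * y)) x := by
      intro x
      simp only [Set.indicator_apply, convexCell, Set.mem_ofPred_eq, lt_sub_iff_add_lt, eadd]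
    have hm : MeasurableSet {x : ℝ | ∀ k, α k * x < γ k - β k * y} := by
      have : {x : ℝ | ∀ k, α k * x < γ k - β k * y} = ⋂ k, {x : ℝ | α k * x < γ k - β k * y} := by
        ext; simp
      rw [this]
      exact MeasurableSet.iInter fun k => measurableSet_lt (by fun_prop) (by fun_prop)
    simp only [h1]
    rw [integral_indicator hm, integral_mul_const]
    have h2 := integral_section_eq (fun k => γ k - β k * y) hpos hneg hp
    rw [show ∫ x in {x : ℝ | ∀ k, α k * x < γ k - β k * y}, e (p * x) = _ from h2,
      div_mul_eq_mul_div, Finset.sum_mul]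
    congr 1
    refine Finset.sum_congr rfl fun i _ => ?_
    have h3 : e (p * ((γ i - β i * y) / α i)) * e (q * y) = e (c i * y + d i) := by
      rw [← eadd]; congr 1; simp only [hc, hd]; ring
    simp only [hF, Set.indicator_apply, hWd, Set.mem_ofPred_eq, sub_mul, ite_mul, zero_mul]
    rw [← h3]
  rw [← integral_indicator hcell, Measure.volume_eq_prod, integral_prod_symm _
    (integrable_indicator_exp hcell hfin (by fun_prop))]
  have hneg0 : ∀ k, (-α) k = 0 ↔ α k = 0 := fun k => by simp
  calc _ = ‖(∑ i, (∫ y, F α i y - F (-α) i y)) / (p * Complex.I)‖ := by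
        congr 1
        have hsum := integral_finsetSum (μ := volume) (f := fun i y => F α i y - F (-α) i y)
          Finset.univ fun i _ => (hWint α i fun _ => Iff.rfl).sub (hWint (-α) i hneg0)
        rw [← hsum, ← integral_div]
        exact integral_congr_ae (ae_of_all _ hsec)
    _ = ‖∑ i, (∫ y, F α i y - F (-α) i y)‖ / |p| := by
        rw [norm_div, norm_mul, Complex.norm_I, mul_one, Complex.norm_real, Real.norm_eq_abs]
    _ ≤ _ := by
        gcongr
        refine (norm_sum_le _ _).trans (Finset.sum_le_sum fun i _ => ?_)
        split_ifs with h0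
        · have : ∀ a : ι → ℝ, (∀ k, a k = 0 ↔ α k = 0) → W a i = ∅ := fun a ha =>
            Set.eq_empty_of_forall_notMem fun y hyW => hyW.1.ne' ((ha i).2 h0)
          simp only [hF, this α fun _ => Iff.rfl, this (-α) hneg0, Set.indicator_empty, sub_self,
            integral_zero, norm_zero, le_refl]
        · rw [integral_sub (hWint α i fun _ => Iff.rfl) (hWint (-α) i hneg0)]
          refine (norm_sub_le _ _).trans ?_
          have hb : ∀ a, (∀ k, a k = 0 ↔ α k = 0) → ‖∫ y, F a i y‖ ≤ 3 / (1 + |c i|) :=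
            fun a ha => by
              rw [hF, integral_indicator (hWo a i).measurableSet]
              exact norm_integral_ordConnected_exp_le (hWo a i) (hWs a i ha) _ _
          calc _ ≤ 3 / (1 + |c i|) + 3 / (1 + |c i|) :=
                add_le_add (hb _ fun _ => Iff.rfl) (hb _ hneg0)
            _ = _ := by ring

theorem norm_integral_convexCell_le_of_abs_le {ι : Type*} [LinearOrder ι] [Fintype ι]
    {α β γ : ι → ℝ} (hpos : ∃ i, 0 < α i) (hneg : ∃ i, α i < 0)
    (hy : ∀ y, (∀ k, α k = 0 → 0 < γ k - β k * y) → y ∈ Set.Ioo (0 : ℝ) 1)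
    (hfin : volume (convexCell α β γ) ≠ ∞) {a b : ℝ} (hab : |b| ≤ |a|) (ha : 1 ≤ |a|) :
    ‖∫ z in convexCell α β γ,
        Complex.exp ((-(2 * Real.pi * a) * z.1 + -(2 * Real.pi * b) * z.2 : ℝ) * Complex.I)‖ ≤
      ∑ i, 6 * (1 + |α i| + |β i|) * ((1 + |a| + |b|)⁻¹ * (1 + |α i * b - β i * a|)⁻¹) := by
  have ha0 : a ≠ 0 := by rintro rfl; norm_num at ha
  have hpi := Real.pi_gt_three
  refine (norm_integral_convexCell_le hpos hneg hy hfin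
    (p := -(2 * Real.pi * a)) (q := -(2 * Real.pi * b)) (by simp [ha0, Real.pi_ne_zero])).trans ?_
  rw [div_eq_mul_inv, Finset.sum_mul]
  refine Finset.sum_le_sum fun i _ => ?_
  split_ifs with h0
  · rw [zero_mul]; positivity
  · have h1 : |(-(2 * Real.pi * a))|⁻¹ ≤ (1 + |a| + |b|)⁻¹ := by
      gcongr
      rw [abs_neg, abs_mul, abs_of_pos (show 0 < 2 * Real.pi by positivity)]
      nlinarith
    have h2 : 6 / (1 + |-(2 * Real.pi * b) - -(2 * Real.pi * a) * β i / α i|) ≤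
        6 * (1 + |α i| + |β i|) * (1 + |α i * b - β i * a|)⁻¹ := by
      rw [← div_eq_mul_inv, div_le_div_iff₀ (by positivity) (by positivity)]
      have h3 : |α i| * |-(2 * Real.pi * b) - -(2 * Real.pi * a) * β i / α i| =
          2 * Real.pi * |α i * b - β i * a| := by
        rw [← abs_mul, ← abs_of_pos (show 0 < 2 * Real.pi by positivity), ← abs_mul,
          ← abs_neg, abs_of_pos (show 0 < 2 * Real.pi by positivity)]
        congr 1; field_simp; ring
      set s := |α i * b - β i * a|
      set r := |-(2 * Real.pi * b) - -(2 * Real.pi * a) * β i / α i|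
      have hs : 0 ≤ s := abs_nonneg _
      have hr : 0 ≤ r := abs_nonneg _
      have hA := abs_nonneg (α i)
      have hB := abs_nonneg (β i)
      nlinarith [mul_nonneg hB hr]
    calc _ ≤ (6 * (1 + |α i| + |β i|) * (1 + |α i * b - β i * a|)⁻¹) * (1 + |a| + |b|)⁻¹ := by
          gcongr
      _ = _ := by ring

theorem integral_convexCell_swap {ι : Type*} [Finite ι] (α β γ : ι → ℝ) (f : ℝ × ℝ → ℂ) :
    ∫ z in convexCell β α γ, f z.swap = ∫ z in convexCell α β γ, f z := by
  rw [← integral_indicator (isOpen_convexCell _ _ _).measurableSet,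
    ← integral_indicator (isOpen_convexCell _ _ _).measurableSet, Measure.volume_eq_prod,
    ← integral_prod_swap]
  congr 1 with z
  have e : z.swap ∈ convexCell β α γ ↔ z ∈ convexCell α β γ :=
    forall_congr' fun k => by simp only [Prod.fst_swap, Prod.snd_swap, add_comm]
  by_cases hz : z ∈ convexCell α β γ
  · rw [Set.indicator_of_mem hz, Set.indicator_of_mem (e.2 hz), Prod.swap_swap]
  · rw [Set.indicator_of_notMem hz, Set.indicator_of_notMem fun h => hz (e.1 h)]

/-- The Fourier transform of an open convex polygon contained in the unit square. -/
theorem norm_integral_convexCell_exp_le {ι : Type*} [LinearOrder ι] [Fintype ι]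
    {α β γ : ι → ℝ} (h1 : ∃ k, α k = -1 ∧ β k = 0 ∧ γ k = 0) (h2 : ∃ k, α k = 1 ∧ β k = 0 ∧ γ k = 1)
    (h3 : ∃ k, α k = 0 ∧ β k = -1 ∧ γ k = 0) (h4 : ∃ k, α k = 0 ∧ β k = 1 ∧ γ k = 1)
    (m : Fin 2 → ℤ) :
    ‖∫ z in convexCell α β γ, Complex.exp
        ((-(2 * Real.pi * m 0) * z.1 + -(2 * Real.pi * m 1) * z.2 : ℝ) * Complex.I)‖ ≤
      ∑ i, 6 * (1 + |α i| + |β i|) *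
        (freqSize m ^ (-1 : ℝ) * dirSize ![-β i, α i] m ^ (-1 : ℝ)) := by
  obtain ⟨k1, a1, b1, c1⟩ := h1
  obtain ⟨k2, a2, b2, c2⟩ := h2
  obtain ⟨k3, a3, b3, c3⟩ := h3
  obtain ⟨k4, a4, b4, c4⟩ := h4
  have hsub : convexCell α β γ ⊆ Set.Ioo 0 1 ×ˢ Set.Ioo 0 1 := by
    intro z hz
    have e1 := hz k1
    have e2 := hz k2
    have e3 := hz k3
    have e4 := hz k4
    simp only [a1, b1, c1, a2, b2, c2, a3, b3, c3, a4, b4, c4] at e1 e2 e3 e4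
    exact ⟨⟨by linarith, by linarith⟩, ⟨by linarith, by linarith⟩⟩
  have hvol : volume (convexCell α β γ) ≤ 1 := by
    refine (measure_mono hsub).trans ?_
    rw [Measure.volume_eq_prod, Measure.prod_prod]; simp
  have hvol' : volume (convexCell β α γ) ≠ ∞ := by
    have hsub' : convexCell β α γ ⊆ Set.Ioo 0 1 ×ˢ Set.Ioo 0 1 := fun z hz => by
      have := @hsub z.swap fun k => by simpa [add_comm] using hz k
      exact ⟨this.2, this.1⟩
    refine ((measure_mono hsub').trans_lt ?_).ne
    rw [Measure.volume_eq_prod, Measure.prod_prod]; simp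
  have hdir : ∀ i, dirSize ![-β i, α i] m = 1 + |α i * m 1 - β i * m 0| := fun i => by
    simp only [dirSize, Matrix.cons_val_zero, Matrix.cons_val_one]
    congr 2; ring
  simp only [Real.rpow_neg_one, hdir, freqSize]
  by_cases hm : m 0 = 0 ∧ m 1 = 0
  · have : ‖∫ z in convexCell α β γ, Complex.exp
        ((-(2 * Real.pi * m 0) * z.1 + -(2 * Real.pi * m 1) * z.2 : ℝ) * Complex.I)‖ ≤
        1 * volume.real (convexCell α β γ) :=
      norm_setIntegral_le_of_norm_le_const (hvol.trans_lt ENNReal.one_lt_top)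
        fun y _ => (Complex.norm_exp_ofReal_mul_I _).le
    refine this.trans ?_
    have hv : volume.real (convexCell α β γ) ≤ 1 := ENNReal.toReal_le_of_le_ofReal zero_le_one
      (by simpa using hvol)
    rw [one_mul]
    refine hv.trans ?_
    refine le_trans ?_ (Finset.single_le_sum (fun i _ => by positivity) (Finset.mem_univ k1))
    simp [hm.1, hm.2, a1, b1]; norm_num
  rcases le_total |(m 1 : ℝ)| |(m 0 : ℝ)| with hle | hle
  · have hm0 : m 0 ≠ 0 := fun h => hm ⟨h, by simpa [h] using hle⟩
    refine norm_integral_convexCell_le_of_abs_le ⟨k2, by simp [a2]⟩ ⟨k1, by simp [a1]⟩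
      (fun y h => ?_) (hvol.trans_lt ENNReal.one_lt_top).ne hle ?_
    · have e3 := h k3 a3
      have e4 := h k4 a4
      simp only [b3, c3, b4, c4] at e3 e4
      exact ⟨by linarith, by linarith⟩
    · exact_mod_cast Int.one_le_abs hm0
  · have hm1 : m 1 ≠ 0 := fun h => hm ⟨by simpa [h] using hle, h⟩
    have := norm_integral_convexCell_le_of_abs_le (α := β) (β := α) (γ := γ) (a := m 1) (b := m 0)
      ⟨k4, by simp [b4]⟩ ⟨k3, by simp [b3]⟩
      (fun y h => ?_) hvol' hle ?_
    · rw [← integral_convexCell_swap]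
      refine (le_of_eq ?_).trans (this.trans (le_of_eq ?_))
      · congr 2 with z
        simp only [Prod.fst_swap, Prod.snd_swap, add_comm]
      · refine Finset.sum_congr rfl fun i _ => ?_
        rw [abs_sub_comm (α i * (m 1 : ℝ))]
        ring
    · have e1 := h k1 b1
      have e2 := h k2 b2
      simp only [a1, c1, a2, c2] at e1 e2
      exact ⟨by linarith, by linarith⟩
    · exact_mod_cast Int.one_le_abs hm1

/-! ### Fourier coefficients of polygons -/

theorem volume_line_eq_zero {α β : ℝ} (h : α ≠ 0 ∨ β ≠ 0) (γ : ℝ) :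
    volume {z : ℝ × ℝ | α * z.1 + β * z.2 = γ} = 0 := by
  have hm : MeasurableSet {z : ℝ × ℝ | α * z.1 + β * z.2 = γ} :=
    measurableSet_eq_fun (by fun_prop) (by fun_prop)
  rw [Measure.volume_eq_prod, Measure.measure_prod_null hm]
  by_cases hβ : β = 0
  · have hα : α ≠ 0 := h.resolve_right (not_not.2 hβ)
    filter_upwards [Measure.ae_ne volume (γ / α)] with x hx
    have : Prod.mk x ⁻¹' {z : ℝ × ℝ | α * z.1 + β * z.2 = γ} = ∅ := by
      refine Set.eq_empty_of_forall_notMem fun y hy => hx ?_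
      simp only [Set.mem_preimage, Set.mem_ofPred_eq, hβ, zero_mul, add_zero] at hy
      rw [eq_div_iff hα, mul_comm]; exact hy
    rw [this]; simp
  · refine ae_of_all _ fun x => ?_
    have : Prod.mk x ⁻¹' {z : ℝ × ℝ | α * z.1 + β * z.2 = γ} ⊆ {(γ - α * x) / β} := by
      intro y hy
      simp only [Set.mem_preimage, Set.mem_ofPred_eq] at hy
      rw [Set.mem_singleton_iff, eq_div_iff hβ]; linarith
    exact measure_mono_null this (by simp)

theorem convex_convexCell {ι : Type*} (α β γ : ι → ℝ) : Convex ℝ (convexCell α β γ) := by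
  have e : convexCell α β γ = ⋂ k, {z : ℝ × ℝ | α k * z.1 + β k * z.2 < γ k} := by
    ext; simp [convexCell]
  rw [e]
  refine convex_iInter fun k => convex_halfSpace_lt (f := fun z : ℝ × ℝ => α k * z.1 + β k * z.2)
    ⟨fun x y => ?_, fun c x => ?_⟩ _
  · simp only [Prod.fst_add, Prod.snd_add]; ring
  · simp only [Prod.smul_fst, Prod.smul_snd, smul_eq_mul]; ring

theorem torusCoeff_eq_setIntegral (f : Torus2 → ℂ) (m : Fin 2 → ℤ) :
    torusCoeff f m = ∫ z in Set.Ioo (0 : ℝ) 1 ×ˢ Set.Ioo (0 : ℝ) 1,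
      Complex.exp ((-(2 * Real.pi * m 0) * z.1 + -(2 * Real.pi * m 1) * z.2 : ℝ) * Complex.I) *
        f (torusProj ![z.1, z.2]) := by
  have h1 : torusCoeff f m = _ := UnitAddTorus.mFourierCoeff_eq_integral f m 0
  rw [h1, ← ((volume_preserving_finTwoArrow ℝ).symm).setIntegral_preimage_emb
    (MeasurableEquiv.measurableEmbedding _)]
  have hs : (MeasurableEquiv.finTwoArrow.symm ⁻¹'
      {x : Fin 2 → ℝ | ∀ i, x i ∈ Set.Ioc ((0 : Fin 2 → ℝ) i) ((0 : Fin 2 → ℝ) i + 1)}) =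
      Set.Ioc (0 : ℝ) 1 ×ˢ Set.Ioc (0 : ℝ) 1 := by
    ext z
    simp only [Set.mem_preimage, Set.mem_ofPred_eq, Fin.forall_fin_two, Pi.zero_apply, zero_add,
      Set.mem_prod]
    rfl
  have hae : (Set.Ioc (0 : ℝ) 1 ×ˢ Set.Ioc (0 : ℝ) 1 : Set (ℝ × ℝ)) =ᵐ[volume]
      Set.Ioo (0 : ℝ) 1 ×ˢ Set.Ioo (0 : ℝ) 1 :=
    Measure.set_prod_ae_eq Ioo_ae_eq_Ioc.symm Ioo_ae_eq_Ioc.symm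
  rw [hs, setIntegral_congr_set hae]
  refine setIntegral_congr_fun (measurableSet_Ioo.prod measurableSet_Ioo) fun z _ => ?_
  have h2 : MeasurableEquiv.finTwoArrow.symm z = ![z.1, z.2] := rfl
  simp only [h2, smul_eq_mul]
  congr 1
  simp only [UnitAddTorus.mFourier, ContinuousMap.coe_mk, Fin.prod_univ_two, fourier_coe_apply,
    Pi.neg_apply, Matrix.cons_val_zero, Matrix.cons_val_one]
  rw [← Complex.exp_add]
  congr 1
  push_cast
  ring

theorem norm_integral_convexCell_exp_le' {ι : Type*} [Fintype ι]
    {α β γ : ι → ℝ} (h1 : ∃ k, α k = -1 ∧ β k = 0 ∧ γ k = 0) (h2 : ∃ k, α k = 1 ∧ β k = 0 ∧ γ k = 1)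
    (h3 : ∃ k, α k = 0 ∧ β k = -1 ∧ γ k = 0) (h4 : ∃ k, α k = 0 ∧ β k = 1 ∧ γ k = 1)
    (m : Fin 2 → ℤ) :
    ‖∫ z in convexCell α β γ, Complex.exp
        ((-(2 * Real.pi * m 0) * z.1 + -(2 * Real.pi * m 1) * z.2 : ℝ) * Complex.I)‖ ≤
      ∑ i, 6 * (1 + |α i| + |β i|) *
        (freqSize m ^ (-1 : ℝ) * dirSize ![-β i, α i] m ^ (-1 : ℝ)) := by
  let _ : LinearOrder ι := LinearOrder.lift' (Fintype.equivFin ι) (Fintype.equivFin ι).injective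
  exact norm_integral_convexCell_exp_le h1 h2 h3 h4 m

/-- A subset of the unit square whose boundary lies on finitely many lines. -/
theorem norm_setIntegral_exp_le_of_frontier {ι : Type} [Finite ι] {α β γ : ι → ℝ}
    (h0 : ∀ i, α i ≠ 0 ∨ β i ≠ 0) {Q : Set (ℝ × ℝ)}
    (hQ : ∀ z ∈ Set.Ioo (0 : ℝ) 1 ×ˢ Set.Ioo (0 : ℝ) 1, z ∈ frontier Q →
      ∃ i, α i * z.1 + β i * z.2 = γ i) :
    ∃ (J : Type) (_ : Fintype J) (τ : J → Fin 2 → ℝ) (B : J → ℝ), (∀ j, τ j ≠ 0) ∧ (∀ j, 0 ≤ B j) ∧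
      ∀ m : Fin 2 → ℤ, ‖∫ z in Set.Ioo (0 : ℝ) 1 ×ˢ Set.Ioo (0 : ℝ) 1, Complex.exp
        ((-(2 * Real.pi * m 0) * z.1 + -(2 * Real.pi * m 1) * z.2 : ℝ) * Complex.I) *
          Q.indicator (fun _ => (1 : ℂ)) z‖ ≤
        ∑ j, B j * (freqSize m ^ (-1 : ℝ) * dirSize (τ j) m ^ (-1 : ℝ)) := by
  classical
  have := Fintype.ofFinite ι
  set s : Bool → ℝ := fun b => if b then 1 else -1 with hs
  have hs0 : ∀ b, s b ≠ 0 := fun b => by cases b <;> simp [hs]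
  set A : (ι → Bool) → ι ⊕ Fin 4 → ℝ := fun σ => Sum.elim (fun i => s (σ i) * α i) ![-1, 1, 0, 0]
    with hA
  set B : (ι → Bool) → ι ⊕ Fin 4 → ℝ := fun σ => Sum.elim (fun i => s (σ i) * β i) ![0, 0, -1, 1]
    with hB
  set G : (ι → Bool) → ι ⊕ Fin 4 → ℝ := fun σ => Sum.elim (fun i => s (σ i) * γ i) ![0, 1, 0, 1]
    with hG
  set cell : (ι → Bool) → Set (ℝ × ℝ) := fun σ => convexCell (A σ) (B σ) (G σ) with hcell
  have mem_cell : ∀ σ z, z ∈ cell σ ↔ z ∈ Set.Ioo (0 : ℝ) 1 ×ˢ Set.Ioo (0 : ℝ) 1 ∧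
      ∀ i, s (σ i) * (α i * z.1 + β i * z.2) < s (σ i) * γ i := by
    intro σ z
    have : z ∈ cell σ ↔ (∀ i, s (σ i) * α i * z.1 + s (σ i) * β i * z.2 < s (σ i) * γ i) ∧
        (-1 * z.1 + 0 * z.2 < 0 ∧ 1 * z.1 + 0 * z.2 < 1 ∧ 0 * z.1 + -1 * z.2 < 0 ∧
          0 * z.1 + 1 * z.2 < 1) := by
      simp [hcell, convexCell, hA, hB, hG, Fin.forall_fin_succ]
    rw [this, and_comm]
    refine and_congr ?_ (forall_congr' fun i => ?_)
    · simp only [Set.mem_prod, Set.mem_Ioo]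
      constructor
      · rintro ⟨h1, h2, h3, h4⟩
        exact ⟨⟨by linarith, by linarith⟩, ⟨by linarith, by linarith⟩⟩
      · rintro ⟨⟨h1, h2⟩, ⟨h3, h4⟩⟩
        exact ⟨by linarith, by linarith, by linarith, by linarith⟩
    · rw [mul_add, mul_assoc, mul_assoc]
  have hmeas : ∀ σ, MeasurableSet (cell σ) := fun σ => (isOpen_convexCell _ _ _).measurableSet
  have hdisj : Pairwise (Function.onFun Disjoint cell) := by
    intro σ σ' hne
    obtain ⟨i, hi⟩ := Function.ne_iff.1 hne
    refine Set.disjoint_left.2 fun z hz hz' => ?_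
    have e1 := ((mem_cell σ z).1 hz).2 i
    have e2 := ((mem_cell σ' z).1 hz').2 i
    cases h : σ i <;> cases h' : σ' i <;> simp [h, h', hs] at hi e1 e2
    all_goals linarith
  have hdich : ∀ σ, cell σ ⊆ Q ∨ Disjoint (cell σ) Q := by
    intro σ
    have hfr : cell σ ⊆ interior Q ∪ interior Qᶜ := by
      rw [← compl_frontier_eq_union_interior]
      intro z hz hzQ
      obtain ⟨hz1, hz2⟩ := (mem_cell σ z).1 hz
      obtain ⟨i, hi⟩ := hQ z hz1 hzQ
      exact (hz2 i).ne (by rw [hi])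
    have hdj : Disjoint (interior Q) (interior Qᶜ) :=
      Set.disjoint_left.2 fun z hz hz' => interior_subset hz' (interior_subset hz)
    rcases (convex_convexCell (A σ) (B σ) (G σ)).isPreconnected.subset_or_subset isOpen_interior
      isOpen_interior hdj hfr with h | h
    · exact Or.inl (h.trans interior_subset)
    · exact Or.inr (Set.disjoint_left.2 fun z hz => interior_subset (h hz))
  have hae : (Set.Ioo (0 : ℝ) 1 ×ˢ Set.Ioo (0 : ℝ) 1 : Set (ℝ × ℝ)) =ᵐ[volume] ⋃ σ, cell σ := by
    have hline : ∀ᵐ z : ℝ × ℝ, ∀ i, α i * z.1 + β i * z.2 ≠ γ i :=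
      ae_all_iff.2 fun i => by
        rw [ae_iff]; simpa using volume_line_eq_zero (h0 i) (γ i)
    refine eventuallyEq_set.2 ?_
    filter_upwards [hline] with z hz
    simp only [Set.mem_iUnion, mem_cell]
    refine ⟨fun h => ⟨fun i => decide (α i * z.1 + β i * z.2 < γ i), h, fun i => ?_⟩,
      fun ⟨σ, h⟩ => h.1⟩
    rcases lt_or_gt_of_ne (hz i) with hlt | hgt
    · simp [hs, hlt]
    · simpa [hs, hgt.not_gt] using hgt
  refine ⟨(ι → Bool) × (ι ⊕ Fin 4), inferInstance, fun j => ![-B j.1 j.2, A j.1 j.2],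
    fun j => 6 * (1 + |A j.1 j.2| + |B j.1 j.2|), ?_, fun j => by positivity, fun m => ?_⟩
  · rintro ⟨σ, i | i⟩ h
    · have e0 := congrFun h 0
      have e1 := congrFun h 1
      simp [hA, hB, hs0] at e0 e1
      exact (h0 i).elim (fun h => h e1) fun h => h e0
    · have e0 := congrFun h 0
      have e1 := congrFun h 1
      fin_cases i <;> simp [hA, hB] at e0 e1
  · set φ : ℝ × ℝ → ℂ := fun z => Complex.exp
        ((-(2 * Real.pi * m 0) * z.1 + -(2 * Real.pi * m 1) * z.2 : ℝ) * Complex.I) with hφ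
    have hcellint : ∀ σ, ∫ z in cell σ, φ z * Q.indicator (fun _ => (1 : ℂ)) z =
        if cell σ ⊆ Q then ∫ z in cell σ, φ z else 0 := by
      intro σ
      split_ifs with h
      · refine setIntegral_congr_fun (hmeas σ) fun z hz => ?_
        simp only [Set.indicator_of_mem (h hz), mul_one]
      · refine setIntegral_eq_zero_of_forall_eq_zero fun z hz => ?_
        rw [Set.indicator_of_notMem (Set.disjoint_left.1 ((hdich σ).resolve_left h) hz), mul_zero]
    have hfin : ∀ σ, volume (cell σ) ≠ ∞ := fun σ => by
      refine ((measure_mono fun z hz => ((mem_cell σ z).1 hz).1).trans_lt ?_).ne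
      rw [Measure.volume_eq_prod, Measure.prod_prod]; simp
    have hint : ∀ σ, IntegrableOn (fun z => φ z * Q.indicator (fun _ => (1 : ℂ)) z) (cell σ) := by
      intro σ
      have h1 : IntegrableOn φ (cell σ) :=
        (integrable_indicator_iff (hmeas σ)).1
          (integrable_indicator_exp (hmeas σ) (hfin σ) (by fun_prop))
      rcases hdich σ with h | h
      · refine h1.congr_fun (fun z hz => ?_) (hmeas σ)
        simp only [Set.indicator_of_mem (h hz), mul_one]
      · refine (integrableOn_zero (μ := volume)).congr_fun (fun z hz => ?_) (hmeas σ)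
        simp only [Set.indicator_of_notMem (Set.disjoint_left.1 h hz), mul_zero]
    rw [setIntegral_congr_set hae, integral_iUnion_fintype hmeas hdisj hint,
      Fintype.sum_prod_type]
    refine (norm_sum_le _ _).trans (Finset.sum_le_sum fun σ _ => ?_)
    rw [hcellint]
    have hpos : 0 ≤ ∑ i, 6 * (1 + |A σ i| + |B σ i|) *
        (freqSize m ^ (-1 : ℝ) * dirSize ![-B σ i, A σ i] m ^ (-1 : ℝ)) :=
      Finset.sum_nonneg fun i _ => mul_nonneg (by positivity) (mul_nonneg
        (Real.rpow_nonneg (freqSize_pos m).le _) (Real.rpow_nonneg (dirSize_pos _ m).le _))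
    split_ifs with h
    · exact norm_integral_convexCell_exp_le' ⟨Sum.inr 0, by simp [hA, hB, hG]⟩
        ⟨Sum.inr 1, by simp [hA, hB, hG]⟩ ⟨Sum.inr 2, by simp [hA, hB, hG]⟩
        ⟨Sum.inr 3, by simp [hA, hB, hG]⟩ m
    · simpa using hpos

/-- Finitely many lines carry the part of the boundary of a polygon over the unit square. -/
theorem IsTorusPolygon.exists_lines {P : Set Torus2} (hP : IsTorusPolygon P) :
    ∃ (ι : Type) (_ : Finite ι) (α β γ : ι → ℝ), (∀ i, α i ≠ 0 ∨ β i ≠ 0) ∧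
      ∀ z ∈ Set.Ioo (0 : ℝ) 1 ×ˢ Set.Ioo (0 : ℝ) 1, torusProj ![z.1, z.2] ∈ frontier P →
        ∃ i, α i * z.1 + β i * z.2 = γ i := by
  obtain ⟨E, hE, hsub⟩ := hP.frontier_subset
  obtain ⟨R, hR⟩ := (hE.image fun e => |e.1 0| + |e.1 1| + |e.2 0| + |e.2 1|).bddAbove
  set N : ℤ := ⌈R⌉ + 1 with hN
  set S : Set (((Fin 2 → ℝ) × (Fin 2 → ℝ)) × (Fin 2 → ℤ)) :=
    E ×ˢ Set.Icc (fun _ => -N) (fun _ => N) with hS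
  have hSf : S.Finite := hE.prod (Set.finite_Icc _ _)
  set d : (Fin 2 → ℝ) × (Fin 2 → ℝ) → Fin 2 → ℝ :=
    fun e => if e.1 = e.2 then ![0, 1] else e.2 - e.1 with hd
  have hd0 : ∀ e, d e 0 ≠ 0 ∨ d e 1 ≠ 0 := by
    intro e
    by_cases he : e.1 = e.2
    · right; simp [hd, he]
    · by_contra! h
      simp only [hd, if_neg he, Pi.sub_apply, sub_eq_zero] at h
      exact he (funext fun i => by fin_cases i <;> simp [h])
  have hdseg : ∀ e w, w ∈ segment ℝ e.1 e.2 → ∃ t : ℝ, w = e.1 + t • d e := by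
    intro e w hw
    rw [segment_eq_image'] at hw
    obtain ⟨t, -, rfl⟩ := hw
    by_cases he : e.1 = e.2
    · exact ⟨0, by simp [he]⟩
    · exact ⟨t, by simp [hd, he]⟩
  refine ⟨S, hSf, fun i => -d i.1.1 1, fun i => d i.1.1 0,
    fun i => -d i.1.1 1 * (i.1.1.1 0 - i.1.2 0) + d i.1.1 0 * (i.1.1.1 1 - i.1.2 1),
    fun i => ?_, fun z hz hzP => ?_⟩
  · rcases hd0 i.1.1 with h | h
    · exact Or.inr h
    · exact Or.inl (neg_ne_zero.2 h)
  · obtain ⟨e, he, w, hw, hwz⟩ : ∃ e ∈ E, ∃ w ∈ segment ℝ e.1 e.2, torusProj w =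
        torusProj ![z.1, z.2] := by
      simpa using hsub hzP
    have hn : ∀ i, ∃ n : ℤ, w i - ![z.1, z.2] i = n := fun i => by
      have := congrFun hwz i
      simp only [torusProj] at this
      rw [← sub_eq_zero, ← AddCircle.coe_sub, AddCircle.coe_eq_zero_iff] at this
      obtain ⟨n, hn⟩ := this
      exact ⟨n, by rw [← hn]; simp⟩
    choose n hn using hn
    have hbd : ∀ i, |w i| ≤ R := by
      intro i
      have h1 : |e.1 0| + |e.1 1| + |e.2 0| + |e.2 1| ≤ R := hR (Set.mem_image_of_mem _ he)
      rw [segment_eq_image] at hw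
      obtain ⟨t, ht, rfl⟩ := hw
      have h2 : |((1 - t) • e.1 + t • e.2) i| ≤ |e.1 i| + |e.2 i| := by
        simp only [Pi.add_apply, Pi.smul_apply, smul_eq_mul]
        refine (abs_add_le _ _).trans ?_
        rw [abs_mul, abs_mul, abs_of_nonneg ht.1, abs_of_nonneg (sub_nonneg.2 ht.2)]
        nlinarith [abs_nonneg (e.1 i), abs_nonneg (e.2 i), ht.1, ht.2]
      have h3 : |e.1 i| + |e.2 i| ≤ |e.1 0| + |e.1 1| + |e.2 0| + |e.2 1| := by
        fin_cases i <;> simp only [Fin.zero_eta, Fin.mk_one] <;>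
          linarith [abs_nonneg (e.1 0), abs_nonneg (e.2 0), abs_nonneg (e.1 1), abs_nonneg (e.2 1)]
      exact h2.trans (h3.trans h1)
    have hz' : ∀ i, 0 < ![z.1, z.2] i ∧ ![z.1, z.2] i < 1 := fun i => by
      fin_cases i
      · exact hz.1
      · exact hz.2
    have hnN : ∀ i, -N ≤ n i ∧ n i ≤ N := fun i => by
      have h1 := abs_le.1 (hbd i)
      have h2 := Int.le_ceil R
      have h3 := hz' i
      have h4 := hn i
      constructor
      · have : ((-N : ℤ) : ℝ) ≤ n i := by rw [hN]; push_cast; linarith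
        exact_mod_cast this
      · have : (n i : ℝ) ≤ (N : ℤ) := by rw [hN]; push_cast; linarith
        exact_mod_cast this
    refine ⟨⟨(e, n), he, fun i => (hnN i).1, fun i => (hnN i).2⟩, ?_⟩
    obtain ⟨t, ht⟩ := hdseg e w hw
    have w0 := hn 0
    have w1 := hn 1
    simp only [ht, Pi.add_apply, Pi.smul_apply, smul_eq_mul, Matrix.cons_val_zero,
      Matrix.cons_val_one] at w0 w1
    linear_combination (d e 1) * w0 - (d e 0) * w1

theorem continuous_torusProj_pair : Continuous fun z : ℝ × ℝ => torusProj ![z.1, z.2] := by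
  refine continuous_pi fun i => ?_
  fin_cases i
  · exact (AddCircle.continuous_mk' 1).comp continuous_fst
  · exact (AddCircle.continuous_mk' 1).comp continuous_snd

/-- The Fourier coefficients of a polygon decay along finitely many directions. -/
theorem IsTorusPolygon.norm_torusCoeff_le {P : Set Torus2} (hP : IsTorusPolygon P) :
    ∃ (J : Type) (_ : Fintype J) (τ : J → Fin 2 → ℝ) (B : J → ℝ), (∀ j, τ j ≠ 0) ∧ (∀ j, 0 ≤ B j) ∧
      ∀ m : Fin 2 → ℤ, ‖torusCoeff (P.indicator fun _ => (1 : ℂ)) m‖ ≤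
        ∑ j, B j * (freqSize m ^ (-1 : ℝ) * dirSize (τ j) m ^ (-1 : ℝ)) := by
  obtain ⟨ι, _, α, β, γ, h0, hQ⟩ := hP.exists_lines
  obtain ⟨J, hJ, τ, B, hτ, hB, h⟩ := norm_setIntegral_exp_le_of_frontier h0
    (Q := (fun z : ℝ × ℝ => torusProj ![z.1, z.2]) ⁻¹' P) fun z hz hzQ =>
      hQ z hz (continuous_torusProj_pair.frontier_preimage_subset P hzQ)
  refine ⟨J, hJ, τ, B, hτ, hB, fun m => ?_⟩
  rw [torusCoeff_eq_setIntegral]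
  exact h m

/-! ### The evolution of a polygon -/

theorem AlmostHalfRegular.of_norm_sub_le {E F : Type*} [NormedAddCommGroup E]
    [NormedAddCommGroup F] {v : Torus2 → E} {w : Torus2 → F} (hv : AlmostHalfRegular v)
    (h : ∀ x y, ‖w x - w y‖ ≤ ‖v x - v y‖) : AlmostHalfRegular w where
  holder := by
    obtain ⟨C, ρ, hC, h0, h1, hh⟩ := hv.holder
    exact ⟨C, ρ, hC, h0, h1, fun n x y hxy => (h x y).trans (hh n x y hxy)⟩
  modulus ε hε := by
    obtain ⟨C, hC, hh⟩ := hv.modulus ε hε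
    refine ⟨C, hC, fun k i => (lintegral_mono fun x => ?_).trans (hh k i)⟩
    exact pow_le_pow_left' (enorm_le_iff_norm_le.2 (h _ _)) 4

theorem almostHalfRegular_zero {E : Type*} [NormedAddCommGroup E] :
    AlmostHalfRegular (fun _ : Torus2 => (0 : E)) where
  holder := ⟨0, 1 / 2, le_rfl, by norm_num, by norm_num, fun n x y _ => by simp⟩
  modulus ε _ := ⟨0, le_rfl, fun k i => by simp⟩

theorem ENNReal.add_pow_four_le (a b : ℝ≥0∞) : (a + b) ^ 4 ≤ 16 * a ^ 4 + 16 * b ^ 4 := by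
  rcases le_total a b with h | h
  · calc (a + b) ^ 4 ≤ (b + b) ^ 4 := by gcongr
      _ = 16 * b ^ 4 := by ring
      _ ≤ _ := le_add_self
  · calc (a + b) ^ 4 ≤ (a + a) ^ 4 := by gcongr
      _ = 16 * a ^ 4 := by ring
      _ ≤ _ := le_self_add

theorem AlmostHalfRegular.add {v w : Torus2 → ℂ} (hv : AlmostHalfRegular v)
    (hw : AlmostHalfRegular w) (hvc : Continuous v) :
    AlmostHalfRegular (fun x => v x + w x) where
  holder := by
    obtain ⟨C, ρ, hC, h0, h1, hh⟩ := hv.holder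
    obtain ⟨C', ρ', hC', h0', h1', hh'⟩ := hw.holder
    refine ⟨C + C', max ρ ρ', by positivity, lt_max_of_lt_left h0, max_lt h1 h1',
      fun n x y hxy => ?_⟩
    calc ‖v x + w x - (v y + w y)‖ ≤ ‖v x - v y‖ + ‖w x - w y‖ := by
          rw [add_sub_add_comm]; exact norm_add_le _ _
      _ ≤ C * ρ ^ n + C' * ρ' ^ n := add_le_add (hh n x y hxy) (hh' n x y hxy)
      _ ≤ C * max ρ ρ' ^ n + C' * max ρ ρ' ^ n := by
          gcongr
          · exact le_max_left _ _
          · exact le_max_right _ _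
      _ = _ := by ring
  modulus ε hε := by
    obtain ⟨C, hC, hh⟩ := hv.modulus ε hε
    obtain ⟨C', hC', hh'⟩ := hw.modulus ε hε
    refine ⟨16 * C + 16 * C', by positivity, fun k i => ?_⟩
    set r : ℝ := ((2 : ℝ) ^ (-(2 - ε))) ^ k with hr
    have hr0 : 0 ≤ r := by positivity
    calc ∫⁻ x, ‖v (x + dyadicShift k i) + w (x + dyadicShift k i) - (v x + w x)‖ₑ ^ 4
            ∂torusMeasure
        ≤ ∫⁻ x, (16 * ‖v (x + dyadicShift k i) - v x‖ₑ ^ 4 +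
            16 * ‖w (x + dyadicShift k i) - w x‖ₑ ^ 4) ∂torusMeasure := by
          refine lintegral_mono fun x => ?_
          rw [add_sub_add_comm]
          exact (pow_le_pow_left' (enorm_add_le _ _) 4).trans (ENNReal.add_pow_four_le _ _)
      _ = 16 * ∫⁻ x, ‖v (x + dyadicShift k i) - v x‖ₑ ^ 4 ∂torusMeasure +
            16 * ∫⁻ x, ‖w (x + dyadicShift k i) - w x‖ₑ ^ 4 ∂torusMeasure := by
          have hm : Measurable fun x => 16 * ‖v (x + dyadicShift k i) - v x‖ₑ ^ 4 := by
            have : Continuous fun x => v (x + dyadicShift k i) - v x := by fun_prop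
            exact (this.measurable.enorm.pow_const 4).const_mul 16
          rw [lintegral_add_left hm, lintegral_const_mul' _ _ (by norm_num),
            lintegral_const_mul' _ _ (by norm_num)]
      _ ≤ 16 * ENNReal.ofReal (C * r) + 16 * ENNReal.ofReal (C' * r) := by
          gcongr
          · exact hh k i
          · exact hh' k i
      _ = _ := by
          have h16 : (16 : ℝ≥0∞) = ENNReal.ofReal 16 := by norm_num
          rw [h16, ← ENNReal.ofReal_mul (by norm_num), ← ENNReal.ofReal_mul (by norm_num),
            ← ENNReal.ofReal_add (by positivity) (by positivity)]
          congr 1; ring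

theorem almostHalfRegular_sum {ι : Type*} (s : Finset ι) (v : ι → C(Torus2, ℂ))
    (h : ∀ i ∈ s, AlmostHalfRegular (v i)) : AlmostHalfRegular (fun x => ∑ i ∈ s, v i x) := by
  classical
  induction s using Finset.induction_on with
  | empty => simpa using almostHalfRegular_zero
  | insert i s hi ih =>
    simp only [Finset.sum_insert hi]
    exact (h i (Finset.mem_insert_self i s)).add
      (ih fun j hj => h j (Finset.mem_insert_of_mem hj)) (v i).continuous

/-- For almost every time, a sequence bounded by a finite sum of one-directional weights evolves
into the coefficients of a regular function. -/
theorem ae_exists_regular_evolution_of_sum {J : Type*} [Fintype J] {τ : J → Fin 2 → ℝ} {B : J → ℝ}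
    (hτ : ∀ j, τ j ≠ 0) (hB : ∀ j, 0 ≤ B j) {a : (Fin 2 → ℤ) → ℂ}
    (ha : ∀ m, ‖a m‖ ≤ ∑ j, B j * (freqSize m ^ (-1 : ℝ) * dirSize (τ j) m ^ (-1 : ℝ))) :
    ∀ᵐ t : ℝ, ∃ u : C(Torus2, ℂ), (∀ m, torusCoeff u m = schrodingerMultiplier t m * a m) ∧
      AlmostHalfRegular u := by
  set b : J → (Fin 2 → ℤ) → ℝ :=
    fun j m => B j * (freqSize m ^ (-1 : ℝ) * dirSize (τ j) m ^ (-1 : ℝ)) with hb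
  have hb0 : ∀ j m, 0 ≤ b j m := fun j m => mul_nonneg (hB j) (mul_nonneg
    (Real.rpow_nonneg (freqSize_pos m).le _) (Real.rpow_nonneg (dirSize_pos _ m).le _))
  set c : J → (Fin 2 → ℤ) → ℂ := fun j m => ((b j m / ∑ l, b l m : ℝ) : ℂ) * a m with hc
  have hW : ∀ m, 0 ≤ ∑ l, b l m := fun m => Finset.sum_nonneg fun l _ => hb0 l m
  have hdec : ∀ j, DirDecay (τ j) (B j) (c j) := by
    intro j m
    rw [hc, norm_mul, Complex.norm_real, Real.norm_of_nonneg (div_nonneg (hb0 j m) (hW m))]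
    calc _ ≤ b j m / (∑ l, b l m) * ∑ l, b l m :=
          mul_le_mul_of_nonneg_left (ha m) (div_nonneg (hb0 j m) (hW m))
      _ ≤ b j m := by
          rcases (hW m).eq_or_lt with h0 | h0
          · rw [← h0, mul_zero]; exact hb0 j m
          · rw [div_mul_cancel₀ _ h0.ne']
  have hsum : ∀ m, ∑ j, c j m = a m := by
    intro m
    rw [hc, ← Finset.sum_mul, ← Complex.ofReal_sum, ← Finset.sum_div]
    by_cases h0 : ∑ l, b l m = 0
    · have : a m = 0 := norm_le_zero_iff.1 ((ha m).trans_eq h0)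
      rw [this, mul_zero]
    · rw [div_self h0, Complex.ofReal_one, one_mul]
  filter_upwards [ae_all_iff.2 fun j => ae_exists_regular_evolution (hτ j) (hdec j)] with t ht
  choose v hv hreg using ht
  have hcoe : ⇑(∑ j, v j) = fun x => ∑ j, v j x := by ext x; simp
  refine ⟨∑ j, v j, fun m => ?_, ?_⟩
  · rw [hcoe, torusCoeff_sum]
    simp only [hv, evolveCoeff, ← Finset.mul_sum, hsum]
  · rw [hcoe]
    exact almostHalfRegular_sum Finset.univ v fun j _ => hreg j

theorem torusCharFun_ae_eq {P : Set Torus2} (hP : IsClosed P) :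
    torusCharFun P hP =ᵐ[torusMeasure] P.indicator fun _ => (1 : ℂ) :=
  indicatorConstLp_coeFn

theorem ae_eq_schrodingerEvolution {t : ℝ} {f : Lp ℂ 2 torusMeasure} {u : C(Torus2, ℂ)}
    (h : ∀ m, torusCoeff u m = schrodingerMultiplier t m * torusCoeff f m) :
    u =ᵐ[torusMeasure] schrodingerEvolution t f := by
  have hu : MemLp u 2 torusMeasure := u.memLp torusMeasure ℂ
  have e : hu.toLp u = schrodingerEvolution t f := by
    refine torusFourierBasis.repr.injective ?_
    ext m
    rw [torusFourierBasis_repr, torusCoeff_congr_ae hu.coeFn_toLp, h, ← torusFourierBasis_repr f,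
      schrodingerEvolution, LinearIsometryEquiv.apply_symm_apply]
  rw [← e]
  exact hu.coeFn_toLp.symm
/-- For almost every time the Schrödinger evolution of the characteristic function of a polygon in
the torus has a (necessarily unique) continuous representative `u`, and the larger one of the upper
box dimensions of the graphs of `Re u` and `Im u` is `5/2`. -/
theorem mainTheorem11 (P : Set Torus2) (hP : IsTorusPolygon P) :
    ∀ᵐ t : ℝ ∂volume, ∃ u : C(Torus2, ℂ),
      (⇑u =ᵐ[torusMeasure] ⇑(schrodingerEvolution t (torusCharFun P hP.isClosed))) ∧
      max (upperBoxDim (torusGraph fun x => (u x).re))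
          (upperBoxDim (torusGraph fun x => (u x).im)) = ((5 / 2 : ℝ) : EReal) := by
  set χ : Torus2 → ℂ := P.indicator fun _ => (1 : ℂ) with hχ
  obtain ⟨J, _, τ, B, hτ, hB, hdecay⟩ := hP.norm_torusCoeff_le
  obtain ⟨c, i, k₀, hc0, hlow⟩ :=
    exists_translate_lower_bound hP.isClosed hP.nonempty_interior hP.ne_univ
  filter_upwards [ae_exists_regular_evolution_of_sum hτ hB hdecay] with t ht
  obtain ⟨u, hu, hreg⟩ := ht
  have hχm : MemLp χ 2 torusMeasure :=
    memLp_indicator_const 2 hP.isClosed.measurableSet 1 (Or.inr (measure_ne_top _ _))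
  refine ⟨u, ae_eq_schrodingerEvolution fun m => ?_, le_antisymm (max_le ?_ ?_) ?_⟩
  · rw [hu, torusCoeff_congr_ae (torusCharFun_ae_eq hP.isClosed)]
  · refine upperBoxDim_torusGraph_le (Complex.continuous_re.comp u.continuous)
      (hreg.of_norm_sub_le fun x y => ?_)
    rw [← Complex.sub_re]
    exact Complex.abs_re_le_norm _
  · refine upperBoxDim_torusGraph_le (Complex.continuous_im.comp u.continuous)
      (hreg.of_norm_sub_le fun x y => ?_)
    rw [← Complex.sub_im]
    exact Complex.abs_im_le_norm _
  · refine le_max_upperBoxDim (i := i) u.continuous hreg hc0 fun k hk => (hlow k hk).trans_eq ?_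
    refine lintegral_translate_sub_eq hχm (u.memLp torusMeasure ℂ) (fun m => ?_) _
    rw [hu, norm_mul, norm_schrodingerMultiplier, one_mul]
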